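/- Let $\bar S$ be the compact one-holed torus (a torus with an open disc removed). For $b>0$ let $\mathcal{T}(S_{1,1},b)$ be the Teichmüller space of marked hyperbolic structures on $\bar S$ whose boundary $\partial\bar S$ is a geodesic of length $b$, up to isometries compatible with the markings up to homotopy; equivalently, passing to convex cores, of complete hyperbolic structures on the interior of $\bar S$ for which the geodesic representative of the boundary has length $b$. Let $\mathcal{S}$ be the set of free homotopy classes of essential simple closed curves on $\bar S$ (simple closed curves that are neither null-homotopic nor homotopic into $\partial\bar S$), and let $\mathcal{A}$ be the set of homotopy classes, with endpoints staying on $\partial\bar S$, of essential simple arcs (simple paths with endpoints on $\partial\bar S$ that are not homotopic, through paths with endpoints on $\partial\bar S$, to a path in $\partial\bar S$). For $h\in\mathcal{T}(S_{1,1},b)$ let $\ell_h(\alpha)$ be the length of the geodesic representative of $\alpha\in\mathcal{S}$, respectively of the orthogeodesic representative of $\alpha\in\mathcal{A}$, that is, the infimum of the $h$-lengths of the curves in the class $\alpha$. Define the curve metric (Thurston metric) and the arc metric by $$K(h_0,h_1)=\sup_{\gamma\in\mathcal{S}}\log\frac{\ell_{h_1}(\gamma)}{\ell_{h_0}(\gamma)},\qquad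 A(h_0,h_1)=\sup_{\alpha\in\mathcal{A}\cup\mathcal{S}}\log\frac{\ell_{h_1}(\alpha)}{\ell_{h_0}(\alpha)}.$$ Then there is $B>0$ such that for every $b\ge B$ there exist $h_0,h_1\in\mathcal{T}(S_{1,1},b)$ with $$K(h_0,h_1)<A(h_0,h_1).$$ -/

import Mathlib

open scoped ENNReal UpperHalfPlane

noncomputable section

namespace TorusMetrics

/-! ### The compact one-holed torus -/

/-- The compact one-holed torus: the torus `(ℝ/ℤ)²` with the open round disc of radius `1/4`
about the origin removed. (`‖x‖` is the distance from `x` to `0` in `ℝ/ℤ`.) -/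
def OneHoledTorus : Type :=
  {p : UnitAddCircle × UnitAddCircle // (1 / 4 : ℝ) ^ 2 ≤ ‖p.1‖ ^ 2 + ‖p.2‖ ^ 2}

instance : TopologicalSpace OneHoledTorus :=
  inferInstanceAs (TopologicalSpace
    {p : UnitAddCircle × UnitAddCircle // (1 / 4 : ℝ) ^ 2 ≤ ‖p.1‖ ^ 2 + ‖p.2‖ ^ 2})

/-- The boundary circle of the one-holed torus. -/
def bdry : Set OneHoledTorus := {p | ‖p.1.1‖ ^ 2 + ‖p.1.2‖ ^ 2 = (1 / 4 : ℝ) ^ 2}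

theorem norm_coe_of_abs_le_one {s : ℝ} (hs : |s| ≤ 1) :
    ‖((s / 4 : ℝ) : UnitAddCircle)‖ = |s| / 4 := by
  have h4 : |s / 4| = |s| / 4 := by rw [abs_div]; norm_num
  rw [← h4]
  refine (AddCircle.norm_coe_eq_abs_iff (1 : ℝ) one_ne_zero).2 ?_
  rw [h4, abs_one]
  linarith

theorem boundary_equation (z : Circle) :
    ‖(((z : ℂ).re / 4 : ℝ) : UnitAddCircle)‖ ^ 2 + ‖(((z : ℂ).im / 4 : ℝ) : UnitAddCircle)‖ ^ 2
      = (1 / 4 : ℝ) ^ 2 := by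
  have hz : ‖(z : ℂ)‖ = 1 := z.norm_coe
  have hre : |(z : ℂ).re| ≤ 1 := hz ▸ Complex.abs_re_le_norm _
  have him : |(z : ℂ).im| ≤ 1 := hz ▸ Complex.abs_im_le_norm _
  rw [norm_coe_of_abs_le_one hre, norm_coe_of_abs_le_one him, div_pow, div_pow, sq_abs, sq_abs]
  have h : (z : ℂ).re * (z : ℂ).re + (z : ℂ).im * (z : ℂ).im = 1 := by
    rw [← Complex.normSq_apply, Complex.normSq_eq_norm_sq, hz, one_pow]
  linarith

/-- The boundary circle as a loop, traversed once: `z ↦ (Re z / 4, Im z / 4)`. -/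
def boundaryLoop : C(Circle, OneHoledTorus) where
  toFun z := ⟨(((z : ℂ).re / 4 : ℝ), ((z : ℂ).im / 4 : ℝ)), (boundary_equation z).ge⟩
  continuous_toFun := by
    refine Continuous.subtype_mk (Continuous.prodMk ?_ ?_) _
    · exact (AddCircle.continuous_mk' (1 : ℝ)).comp
        ((Complex.continuous_re.comp continuous_subtype_val).div_const 4)
    · exact (AddCircle.continuous_mk' (1 : ℝ)).comp
        ((Complex.continuous_im.comp continuous_subtype_val).div_const 4)

/-! ### Homotopy classes of curves and arcs -/

/-- A simple closed curve that is essential: neither null-homotopic nor freely homotopic into the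
boundary. -/
def IsEssentialSimpleClosedCurve (γ : C(Circle, OneHoledTorus)) : Prop :=
  Function.Injective γ ∧ ¬ γ.Nullhomotopic ∧
    ¬ ∃ γ' : C(Circle, OneHoledTorus), γ.Homotopic γ' ∧ ∀ z, γ' z ∈ bdry

/-- Homotopy of paths whose two endpoints stay on the boundary (and may slide along it). -/
def BoundaryHomotopic (a a' : C(unitInterval, OneHoledTorus)) : Prop :=
  a.HomotopicWith a' fun k => k 0 ∈ bdry ∧ k 1 ∈ bdry

/-- A simple path with endpoints on the boundary that is not homotopic, relative to the boundary,
to a path in the boundary. -/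
def IsEssentialSimpleArc (a : C(unitInterval, OneHoledTorus)) : Prop :=
  Function.Injective a ∧ a 0 ∈ bdry ∧ a 1 ∈ bdry ∧
    ¬ ∃ a' : C(unitInterval, OneHoledTorus), BoundaryHomotopic a a' ∧ ∀ t, a' t ∈ bdry

/-! ### Hyperbolic structures with geodesic boundary -/

/-- The length of a closed curve in a metric space. -/
def loopLength {X : Type} [PseudoEMetricSpace X] (c : Circle → X) : ℝ≥0∞ :=
  eVariationOn (fun t : ℝ => c (Circle.exp t)) (Set.Icc 0 (2 * Real.pi))

/-- The length of a path in a metric space. -/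
def pathLength {X : Type} [PseudoEMetricSpace X] (a : unitInterval → X) : ℝ≥0∞ :=
  eVariationOn a Set.univ

/-- Some ball about `x` is isometric to the ball of the same radius in the subset `M` of the
hyperbolic plane about the point `i`, by an isometry that sends `x` to `i`. -/
def IsModeledAt {X : Type} [MetricSpace X] (M : Set ℍ) (x : X) : Prop :=
  ∃ r > 0, ∃ φ : X → ℍ, φ x = UpperHalfPlane.I ∧
    (∀ y ∈ Metric.ball x r, ∀ z ∈ Metric.ball x r, dist (φ y) (φ z) = dist y z) ∧
    φ '' Metric.ball x r = Metric.ball UpperHalfPlane.I r ∩ M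

/-- The closed half-plane of the hyperbolic plane to the right of the geodesic `Re z = 0`, which
passes through `i`. -/
def halfPlane : Set ℍ := {z | 0 ≤ z.re}

/-- A marked hyperbolic one-holed torus with geodesic boundary of length `b`: a length metric
space which is locally isometric to the hyperbolic plane at interior points and to a closed
hyperbolic half-plane at boundary points, with a homeomorphism from `OneHoledTorus`. -/
structure MarkedTorus (b : ℝ) where
  carrier : Type
  [metric : MetricSpace carrier]
  marking : OneHoledTorus ≃ₜ carrier
  exists_short_path : ∀ x y : carrier, ∀ ε > 0,
    ∃ γ : Path x y, pathLength γ ≤ ENNReal.ofReal (dist x y + ε)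
  interior_hyperbolic : ∀ p, p ∉ bdry → IsModeledAt Set.univ (marking p)
  boundary_geodesic : ∀ p, p ∈ bdry → IsModeledAt halfPlane (marking p)
  boundary_length : loopLength (fun z => marking (boundaryLoop z)) = ENNReal.ofReal b

attribute [instance] MarkedTorus.metric

/-- The self-map of `OneHoledTorus` that an isometry of the underlying surfaces induces through
the markings. -/
def transition {b : ℝ} (h h' : MarkedTorus b) (φ : h.carrier ≃ᵢ h'.carrier) :
    C(OneHoledTorus, OneHoledTorus) :=
  ⟨fun p => h'.marking.symm (φ (h.marking p)), by fun_prop⟩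

/-- Two marked tori are equivalent if there is an isometry between them which commutes with the
markings up to homotopy through maps of the pair `(OneHoledTorus, bdry)`. -/
def TeichEquiv {b : ℝ} (h h' : MarkedTorus b) : Prop :=
  ∃ φ : h.carrier ≃ᵢ h'.carrier, (∀ p, transition h h' φ p ∈ bdry ↔ p ∈ bdry) ∧
    (transition h h' φ).HomotopicWith (ContinuousMap.id _) fun k => Set.MapsTo k bdry bdry

theorem TeichEquiv.refl {b : ℝ} (h : MarkedTorus b) : TeichEquiv h h := by
  have e : transition h h (IsometryEquiv.refl _) = ContinuousMap.id _ := by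
    ext1 p
    exact h.marking.symm_apply_apply p
  refine ⟨IsometryEquiv.refl _, ?_, ?_⟩
  · intro p
    rw [e]
    rfl
  · rw [e]
    exact ContinuousMap.HomotopicWith.refl _ fun p hp => hp

theorem TeichEquiv.symm {b : ℝ} {h h' : MarkedTorus b} (H : TeichEquiv h h') :
    TeichEquiv h' h := by
  obtain ⟨φ, hφ, ⟨F⟩⟩ := H
  have e : ∀ p, transition h h' φ (transition h' h φ.symm p) = p := by
    intro p
    simp [transition]
  have hb : ∀ p, transition h' h φ.symm p ∈ bdry ↔ p ∈ bdry := by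
    intro p
    rw [← hφ, e]
  refine ⟨φ.symm, hb, ContinuousMap.HomotopicWith.symm ⟨?_⟩⟩
  refine
    { toFun := fun q => F (q.1, transition h' h φ.symm q.2)
      continuous_toFun := by fun_prop
      map_zero_left := fun p => by simp [e]
      map_one_left := fun p => by simp
      prop' := fun t p hp => F.prop t ((hb p).2 hp) }

theorem TeichEquiv.trans {b : ℝ} {h h' h'' : MarkedTorus b} (H : TeichEquiv h h')
    (H' : TeichEquiv h' h'') : TeichEquiv h h'' := by
  obtain ⟨φ, hφ, ⟨F⟩⟩ := H
  obtain ⟨ψ, hψ, hF'⟩ := H'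
  have e : ∀ p, transition h h'' (φ.trans ψ) p
      = transition h' h'' ψ (transition h h' φ p) := by
    intro p
    simp [transition]
  refine ⟨φ.trans ψ, fun p => by rw [e, hψ, hφ], ContinuousMap.HomotopicWith.trans ⟨?_⟩ hF'⟩
  refine
    { toFun := fun q => transition h' h'' ψ (F q)
      continuous_toFun := by fun_prop
      map_zero_left := fun p => by simp [e]
      map_one_left := fun p => by simp
      prop' := fun t p hp => (hψ _).2 (F.prop t hp) }

instance teichSetoid (b : ℝ) : Setoid (MarkedTorus b) :=
  ⟨TeichEquiv, TeichEquiv.refl, TeichEquiv.symm, TeichEquiv.trans⟩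

/-- The Teichmüller space of hyperbolic one-holed tori with geodesic boundary of length `b`. -/
def Teich (b : ℝ) : Type 1 := Quotient (teichSetoid b)

/-! ### Lengths of homotopy classes -/

/-- The length of the geodesic representative of the closed curve `γ`: the infimum of the lengths
of the closed curves freely homotopic to `γ`. -/
def curveLength {b : ℝ} (h : MarkedTorus b) (γ : C(Circle, OneHoledTorus)) : ℝ≥0∞ :=
  ⨅ (c : C(Circle, OneHoledTorus)) (_ : γ.Homotopic c), loopLength fun z => h.marking (c z)

/-- The length of the orthogeodesic representative of the arc `a`: the infimum of the lengths of
the paths homotopic to `a` relative to the boundary. -/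
def arcLength {b : ℝ} (h : MarkedTorus b) (a : C(unitInterval, OneHoledTorus)) : ℝ≥0∞ :=
  ⨅ (c : C(unitInterval, OneHoledTorus)) (_ : BoundaryHomotopic a c),
    pathLength fun t => h.marking (c t)

theorem marking_transition {b : ℝ} (h h' : MarkedTorus b) (φ : h.carrier ≃ᵢ h'.carrier)
    (p : OneHoledTorus) : h'.marking (transition h h' φ p) = φ (h.marking p) := by
  simp [transition]

theorem eVariationOn_isometry {α X Y : Type} [LinearOrder α] [PseudoEMetricSpace X]
    [PseudoEMetricSpace Y] {φ : X → Y} (hφ : Isometry φ) (f : α → X) (s : Set α) :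
    eVariationOn (fun t => φ (f t)) s = eVariationOn f s := by
  simp only [eVariationOn, hφ.edist_eq]

theorem curveLength_le {b : ℝ} {h h' : MarkedTorus b} (H : TeichEquiv h h')
    (γ : C(Circle, OneHoledTorus)) : curveLength h' γ ≤ curveLength h γ := by
  obtain ⟨φ, -, ⟨F⟩⟩ := H
  refine le_iInf₂ fun c hc => ?_
  have hc' : γ.Homotopic ((transition h h' φ).comp c) := by
    have h1 : ((transition h h' φ).comp c).Homotopic ((ContinuousMap.id _).comp c) :=
      ContinuousMap.Homotopic.comp ⟨F.toHomotopy⟩ (ContinuousMap.Homotopic.refl c)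
    rw [ContinuousMap.id_comp] at h1
    exact hc.trans h1.symm
  refine (iInf₂_le _ hc').trans (le_of_eq ?_)
  simp only [ContinuousMap.comp_apply, marking_transition]
  exact eVariationOn_isometry φ.isometry _ _

theorem arcLength_le {b : ℝ} {h h' : MarkedTorus b} (H : TeichEquiv h h')
    (a : C(unitInterval, OneHoledTorus)) : arcLength h' a ≤ arcLength h a := by
  obtain ⟨φ, -, ⟨F⟩⟩ := H
  refine le_iInf₂ fun c hc => ?_
  have hend : c 0 ∈ bdry ∧ c 1 ∈ bdry := by
    obtain ⟨G⟩ := hc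
    simpa using G.prop 1
  have hc' : BoundaryHomotopic a ((transition h h' φ).comp c) := by
    refine ContinuousMap.HomotopicWith.trans hc (ContinuousMap.HomotopicWith.symm ⟨?_⟩)
    refine
      { toFun := fun q => F (q.1, c q.2)
        continuous_toFun := by fun_prop
        map_zero_left := fun p => by simp
        map_one_left := fun p => by simp
        prop' := fun t => ⟨F.prop t hend.1, F.prop t hend.2⟩ }
  refine (iInf₂_le _ hc').trans (le_of_eq ?_)
  simp only [ContinuousMap.comp_apply, marking_transition]
  exact eVariationOn_isometry φ.isometry _ _

/-- The length of a closed curve as a function on Teichmüller space. -/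
def Teich.curveLength {b : ℝ} (h : Teich b) (γ : C(Circle, OneHoledTorus)) : ℝ≥0∞ :=
  Quotient.lift (fun h => TorusMetrics.curveLength h γ)
    (fun _ _ H => le_antisymm (curveLength_le (TeichEquiv.symm H) γ) (curveLength_le H γ)) h

/-- The length of an arc as a function on Teichmüller space. -/
def Teich.arcLength {b : ℝ} (h : Teich b) (a : C(unitInterval, OneHoledTorus)) : ℝ≥0∞ :=
  Quotient.lift (fun h => TorusMetrics.arcLength h a)
    (fun _ _ H => le_antisymm (arcLength_le (TeichEquiv.symm H) a) (arcLength_le H a)) h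

/-! ### The two metrics -/

/-- The curve metric: the supremum, over the essential simple closed curves, of the logarithm of
the ratio of lengths. -/
def curveMetric {b : ℝ} (h₀ h₁ : Teich b) : EReal :=
  ⨆ (γ : C(Circle, OneHoledTorus)) (_ : IsEssentialSimpleClosedCurve γ),
    ENNReal.log (h₁.curveLength γ / h₀.curveLength γ)

/-- The arc metric: the supremum, over the essential simple arcs and the essential simple closed
curves, of the logarithm of the ratio of lengths. -/
def arcMetric {b : ℝ} (h₀ h₁ : Teich b) : EReal :=
  (⨆ (a : C(unitInterval, OneHoledTorus)) (_ : IsEssentialSimpleArc a),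
    ENNReal.log (h₁.arcLength a / h₀.arcLength a)) ⊔
  ⨆ (γ : C(Circle, OneHoledTorus)) (_ : IsEssentialSimpleClosedCurve γ),
    ENNReal.log (h₁.curveLength γ / h₀.curveLength γ)

end TorusMetrics

end

open scoped ENNReal UpperHalfPlane

noncomputable section

namespace TorusMetrics

/-! ### Hyperboloid coordinates on the upper half-plane -/

/-! The two structures are rectangular tori. In the hyperboloid model, take two perpendicular
geodesics through `i`, the axes `cY = 0` and `cX = 0`. Cut the plane by walls orthogonal to them at
distances `p` and `q` from `i`, and by the four common perpendiculars of adjacent walls. This is a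
right-angled octagon. Gluing opposite walls by the translations of lengths `2 * p` and `2 * q` gives
a one-holed torus, and the pentagon formula `dist_edge_ends` gives its boundary length by `cosh (b /
4) = sinh p * sinh q`. The formula is symmetric, so a shape `S` and `S.swap`, with `p` and `q`
exchanged but the marking kept, lie in the same Teichmüller space. With `sinh q = 4 / 3` fixed, `p`
tends to infinity with `b`; `h₀` is the torus of `S` and `h₁` that of `S.swap`.

One arc has a huge ratio of lengths. `verticalArc` runs along a wall from boundary to boundary. In
`h₀` its length is at most `4 / cosh p` (`arcLength_verticalArc_le`, `longShape_height_le`). In `h₁`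
every homotopic path has length at least `1 / 2` (`le_arcLength_verticalArc`,
`longShape_swap_height`), because it must go from the boundary to an axis. So the arc metric is at
least `log (cosh p / 8)`, with an argument exponential in `p`.

Closed curves have a ratio at most linear in `p`. There is a Lipschitz map from `h₀` to `h₁`,
homotopic to the change of marking, that collapses the octagon to the cross of the two axes and
stretches only bands near the walls (`lipschitzWith_surfaceMap`, `surfaceMap_homotopic`). It does
not respect the boundary, so it says nothing about arcs, but by `curveLength_swap_le` every curve
ratio is at most its constant, which is at most `28 + 10 * p` and hence below `cosh p / 8` for `p ≥
100`.

The surfaces are metric quotients. The structure `Gluing` isolates what is needed for small glued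
distances to be realized by one gluing isometry; charts and geodesic boundary follow. Lower bounds
on glued distances come from `fold`, which descends to a contracting map on the surface
(`dist_fold_le_dist_proj`). -/

/-- The timelike hyperboloid coordinate of a point of the upper half-plane. -/
def cT (z : ℍ) : ℝ := (z.re ^ 2 + z.im ^ 2 + 1) / (2 * z.im)

/-- The first spacelike hyperboloid coordinate. -/
def cX (z : ℍ) : ℝ := (z.re ^ 2 + z.im ^ 2 - 1) / (2 * z.im)

/-- The second spacelike hyperboloid coordinate. -/
def cY (z : ℍ) : ℝ := z.re / z.im

theorem cT_pos (z : ℍ) : 0 < cT z := by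
  have := z.im_pos
  unfold cT
  positivity

theorem cT_sq (z : ℍ) : cT z ^ 2 = 1 + cX z ^ 2 + cY z ^ 2 := by
  have := z.im_pos.ne'
  unfold cT cX cY
  field_simp
  ring

theorem one_le_cT (z : ℍ) : 1 ≤ cT z := by
  nlinarith [cT_sq z, cT_pos z, sq_nonneg (cX z), sq_nonneg (cY z)]

theorem cosh_dist_eq (z w : ℍ) :
    Real.cosh (dist z w) = cT z * cT w - cX z * cX w - cY z * cY w := by
  have h1 := z.im_pos.ne'
  have h2 := w.im_pos.ne'
  rw [UpperHalfPlane.cosh_dist']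
  unfold cT cX cY
  field_simp
  ring

theorem dist_le_dist_of_cosh {z w z' w' : ℍ}
    (h : Real.cosh (dist z w) ≤ Real.cosh (dist z' w')) : dist z w ≤ dist z' w' := by
  rwa [Real.cosh_le_cosh, abs_of_nonneg dist_nonneg, abs_of_nonneg dist_nonneg] at h

theorem dist_eq_of_cosh {z w : ℍ} {a : ℝ} (h : Real.cosh (dist z w) = Real.cosh a) :
    dist z w = |a| := by
  have h1 := Real.cosh_le_cosh.1 h.le
  have h2 := Real.cosh_le_cosh.1 h.ge
  rw [abs_of_nonneg dist_nonneg] at h1 h2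
  exact le_antisymm h1 h2

theorem continuous_cT : Continuous cT := by
  unfold cT
  refine Continuous.div ?_ ?_ fun z => (mul_pos two_pos z.im_pos).ne'
  all_goals have := UpperHalfPlane.continuous_re; have := UpperHalfPlane.continuous_im; fun_prop

theorem continuous_cX : Continuous cX := by
  unfold cX
  refine Continuous.div ?_ ?_ fun z => (mul_pos two_pos z.im_pos).ne'
  all_goals have := UpperHalfPlane.continuous_re; have := UpperHalfPlane.continuous_im; fun_prop

theorem continuous_cY : Continuous cY :=
  UpperHalfPlane.continuous_re.div UpperHalfPlane.continuous_im fun z => z.im_pos.ne'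

theorem im_eq (z : ℍ) : z.im = 1 / (cT z - cX z) := by
  have h1 := z.im_pos.ne'
  have : cT z - cX z = 1 / z.im := by
    unfold cT cX
    field_simp
    ring
  rw [this, one_div_one_div]

/-- The hyperboloid equation with `cT > 0` recovers `cT`, then `cT - cX` recovers the imaginary
part. Identities between isometries are checked on `cX` and `cY` through this. -/
theorem ext_coords {z w : ℍ} (hX : cX z = cX w) (hY : cY z = cY w) : z = w := by
  have hT : cT z = cT w := by
    have h := cT_sq z
    rw [hX, hY, ← cT_sq w] at h
    exact (pow_left_inj₀ (cT_pos z).le (cT_pos w).le two_ne_zero).1 h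
  have him : z.im = w.im := by rw [im_eq, im_eq, hX, hT]
  have hre : z.re = w.re := by
    have h1 := z.im_pos.ne'
    unfold cY at hY
    rw [him] at hY h1
    field_simp at hY
    exact hY
  exact UpperHalfPlane.ext (Complex.ext hre him)

theorem sqrt_coords_gt (x y : ℝ) : 0 < √(1 + x ^ 2 + y ^ 2) - x := by
  have : x < √(1 + x ^ 2 + y ^ 2) := by
    refine lt_of_abs_lt ?_
    rw [← Real.sqrt_sq_eq_abs]
    exact Real.sqrt_lt_sqrt (sq_nonneg x) (by nlinarith [sq_nonneg y])
  linarith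

/-- The point of the upper half-plane with given spacelike hyperboloid coordinates. -/
def ofCoords (x y : ℝ) : ℍ :=
  UpperHalfPlane.mk ⟨y / (√(1 + x ^ 2 + y ^ 2) - x), 1 / (√(1 + x ^ 2 + y ^ 2) - x)⟩
    (one_div_pos.2 (sqrt_coords_gt x y))

theorem re_ofCoords (x y : ℝ) : (ofCoords x y).re = y / (√(1 + x ^ 2 + y ^ 2) - x) := rfl

theorem im_ofCoords (x y : ℝ) : (ofCoords x y).im = 1 / (√(1 + x ^ 2 + y ^ 2) - x) := rfl

@[simp] theorem cX_ofCoords (x y : ℝ) : cX (ofCoords x y) = x := by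
  have h := (sqrt_coords_gt x y).ne'
  have h2 : √(1 + x ^ 2 + y ^ 2) ^ 2 = 1 + x ^ 2 + y ^ 2 := Real.sq_sqrt (by positivity)
  rw [cX, re_ofCoords, im_ofCoords]
  field_simp
  linear_combination -h2

@[simp] theorem cY_ofCoords (x y : ℝ) : cY (ofCoords x y) = y := by
  have h := (sqrt_coords_gt x y).ne'
  rw [cY, re_ofCoords, im_ofCoords]
  field_simp

theorem cT_ofCoords {x y c : ℝ} (hc : 0 ≤ c) (h : c ^ 2 = 1 + x ^ 2 + y ^ 2) :
    cT (ofCoords x y) = c := by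
  refine (pow_left_inj₀ (cT_pos _).le hc two_ne_zero).1 ?_
  rw [cT_sq, h, cX_ofCoords, cY_ofCoords]

theorem ofCoords_coords (z : ℍ) : ofCoords (cX z) (cY z) = z :=
  ext_coords (cX_ofCoords _ _) (cY_ofCoords _ _)

theorem continuous_ofCoords : Continuous fun v : ℝ × ℝ => ofCoords v.1 v.2 := by
  have h : Continuous fun v : ℝ × ℝ => √(1 + v.1 ^ 2 + v.2 ^ 2) - v.1 := by fun_prop
  have h0 : ∀ v : ℝ × ℝ, √(1 + v.1 ^ 2 + v.2 ^ 2) - v.1 ≠ 0 := fun v =>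
    (sqrt_coords_gt v.1 v.2).ne'
  refine Continuous.upperHalfPlaneMk (f := fun v : ℝ × ℝ =>
    (⟨v.2 / (√(1 + v.1 ^ 2 + v.2 ^ 2) - v.1), 1 / (√(1 + v.1 ^ 2 + v.2 ^ 2) - v.1)⟩ : ℂ)) ?_ _
  exact Complex.equivRealProdCLM.symm.continuous.comp
    ((continuous_snd.div h h0).prodMk (continuous_const.div h h0))

@[simp] theorem cX_I : cX UpperHalfPlane.I = 0 := by simp [cX]
@[simp] theorem cY_I : cY UpperHalfPlane.I = 0 := by simp [cY]

theorem mem_halfPlane_iff (z : ℍ) : z ∈ halfPlane ↔ 0 ≤ cY z := by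
  rw [halfPlane, Set.mem_ofPred_eq, cY, le_div_iff₀ z.im_pos, zero_mul]

theorem abs_cX_lt_cT (z : ℍ) : |cX z| < cT z :=
  abs_lt_of_sq_lt_sq (by nlinarith [cT_sq z, sq_nonneg (cY z)]) (cT_pos z).le

theorem abs_cY_lt_cT (z : ℍ) : |cY z| < cT z :=
  abs_lt_of_sq_lt_sq (by nlinarith [cT_sq z, sq_nonneg (cX z)]) (cT_pos z).le

/-! ### Isometries in hyperboloid coordinates -/

/-- The Lorentz form of two points is the `cosh` of their distance. -/
theorem isometry_of_coords {f : ℍ → ℍ} (h : ∀ z w,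
    cT (f z) * cT (f w) - cX (f z) * cX (f w) - cY (f z) * cY (f w)
      = cT z * cT w - cX z * cX w - cY z * cY w) : Isometry f := by
  refine Isometry.of_dist_eq fun z w => ?_
  have := dist_eq_of_cosh (z := f z) (w := f w) (a := dist z w)
    (by rw [cosh_dist_eq, cosh_dist_eq, h])
  rwa [abs_of_nonneg dist_nonneg] at this

/-- The map underlying `boostX`. -/
def boostFun (a : ℝ) (z : ℍ) : ℍ := ofCoords (Real.cosh a * cX z + Real.sinh a * cT z) (cY z)

theorem cX_boostFun (a : ℝ) (z : ℍ) :
    cX (boostFun a z) = Real.cosh a * cX z + Real.sinh a * cT z := cX_ofCoords _ _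

theorem cY_boostFun (a : ℝ) (z : ℍ) : cY (boostFun a z) = cY z := cY_ofCoords _ _

theorem cT_boostFun (a : ℝ) (z : ℍ) :
    cT (boostFun a z) = Real.cosh a * cT z + Real.sinh a * cX z := by
  refine cT_ofCoords ?_ ?_
  · have h1 : |Real.sinh a| ≤ Real.cosh a :=
      abs_le_of_sq_le_sq (by nlinarith [Real.cosh_sq a]) (Real.cosh_pos a).le
    have h2 := (abs_cX_lt_cT z).le
    have h3 : |Real.sinh a| * |cX z| ≤ Real.cosh a * cT z :=
      mul_le_mul h1 h2 (abs_nonneg _) (Real.cosh_pos a).le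
    rw [← abs_mul] at h3
    linarith [neg_abs_le (Real.sinh a * cX z)]
  · linear_combination cT_sq z + (cT z ^ 2 - cX z ^ 2) * Real.cosh_sq a

theorem boostFun_neg (a : ℝ) (z : ℍ) : boostFun (-a) (boostFun a z) = z := by
  refine ext_coords ?_ ?_
  · rw [cX_boostFun, cX_boostFun, cT_boostFun, Real.cosh_neg, Real.sinh_neg]
    linear_combination cX z * Real.cosh_sq a
  · rw [cY_boostFun, cY_boostFun]

/-- The translation by `a` along the geodesic `cY = 0`. -/
def boostX (a : ℝ) : ℍ ≃ᵢ ℍ where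
  toFun := boostFun a
  invFun := boostFun (-a)
  left_inv := boostFun_neg a
  right_inv z := by simpa using boostFun_neg (-a) z
  isometry_toFun := isometry_of_coords fun z w => by
    rw [cT_boostFun, cX_boostFun, cY_boostFun, cT_boostFun, cX_boostFun, cY_boostFun]
    linear_combination (cT z * cT w - cX z * cX w) * Real.cosh_sq a

@[simp] theorem cX_boostX (a : ℝ) (z : ℍ) :
    cX (boostX a z) = Real.cosh a * cX z + Real.sinh a * cT z := cX_boostFun a z
@[simp] theorem cY_boostX (a : ℝ) (z : ℍ) : cY (boostX a z) = cY z := cY_boostFun a z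
@[simp] theorem cT_boostX (a : ℝ) (z : ℍ) :
    cT (boostX a z) = Real.cosh a * cT z + Real.sinh a * cX z := cT_boostFun a z

theorem boostX_inv (a : ℝ) : (boostX a)⁻¹ = boostX (-a) :=
  inv_eq_of_mul_eq_one_left (IsometryEquiv.ext fun z => boostFun_neg a z)

/-- The reflection exchanging the two spacelike coordinates. -/
def swapXY : ℍ ≃ᵢ ℍ where
  toFun z := ofCoords (cY z) (cX z)
  invFun z := ofCoords (cY z) (cX z)
  left_inv z := ext_coords (by simp) (by simp)
  right_inv z := ext_coords (by simp) (by simp)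
  isometry_toFun := isometry_of_coords fun z w => by
    have h : ∀ z, cT (ofCoords (cY z) (cX z)) = cT z := fun z =>
      cT_ofCoords (cT_pos z).le (by linear_combination cT_sq z)
    simp only [h, cX_ofCoords, cY_ofCoords]
    ring

@[simp] theorem cX_swapXY (z : ℍ) : cX (swapXY z) = cY z := cX_ofCoords _ _
@[simp] theorem cY_swapXY (z : ℍ) : cY (swapXY z) = cX z := cY_ofCoords _ _
@[simp] theorem cT_swapXY (z : ℍ) : cT (swapXY z) = cT z :=
  cT_ofCoords (cT_pos z).le (by linear_combination cT_sq z)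

/-- The rotation about `I` by the angle `a`. -/
def rotXY (a : ℝ) : ℍ ≃ᵢ ℍ where
  toFun z := ofCoords (Real.cos a * cX z - Real.sin a * cY z)
    (Real.sin a * cX z + Real.cos a * cY z)
  invFun z := ofCoords (Real.cos a * cX z + Real.sin a * cY z)
    (-Real.sin a * cX z + Real.cos a * cY z)
  left_inv z := by
    refine ext_coords ?_ ?_ <;> simp only [cX_ofCoords, cY_ofCoords]
    · linear_combination cX z * Real.sin_sq_add_cos_sq a
    · linear_combination cY z * Real.sin_sq_add_cos_sq a
  right_inv z := by
    refine ext_coords ?_ ?_ <;> simp only [cX_ofCoords, cY_ofCoords]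
    · linear_combination cX z * Real.sin_sq_add_cos_sq a
    · linear_combination cY z * Real.sin_sq_add_cos_sq a
  isometry_toFun := isometry_of_coords fun z w => by
    have h : ∀ z, cT (ofCoords (Real.cos a * cX z - Real.sin a * cY z)
        (Real.sin a * cX z + Real.cos a * cY z)) = cT z := fun z =>
      cT_ofCoords (cT_pos z).le
        (by linear_combination cT_sq z - (cX z ^ 2 + cY z ^ 2) * Real.sin_sq_add_cos_sq a)
    simp only [h, cX_ofCoords, cY_ofCoords]
    linear_combination -(cX z * cX w + cY z * cY w) * Real.sin_sq_add_cos_sq a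

@[simp] theorem cX_rotXY (a : ℝ) (z : ℍ) :
    cX (rotXY a z) = Real.cos a * cX z - Real.sin a * cY z := cX_ofCoords _ _
@[simp] theorem cY_rotXY (a : ℝ) (z : ℍ) :
    cY (rotXY a z) = Real.sin a * cX z + Real.cos a * cY z := cY_ofCoords _ _
@[simp] theorem cT_rotXY (a : ℝ) (z : ℍ) : cT (rotXY a z) = cT z :=
  cT_ofCoords (cT_pos z).le
    (by linear_combination cT_sq z - (cX z ^ 2 + cY z ^ 2) * Real.sin_sq_add_cos_sq a)

/-- The reflection in the geodesic `cY = 0`. -/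
def reflY : ℍ ≃ᵢ ℍ := (rotXY (Real.pi / 2)).trans swapXY

@[simp] theorem cX_reflY (z : ℍ) : cX (reflY z) = cX z := by simp [reflY]
@[simp] theorem cY_reflY (z : ℍ) : cY (reflY z) = -cY z := by simp [reflY]
@[simp] theorem cT_reflY (z : ℍ) : cT (reflY z) = cT z := by simp [reflY]

/-- The reflection in the geodesic `cX = 0`. -/
def reflX : ℍ ≃ᵢ ℍ := swapXY.trans (rotXY (Real.pi / 2))

@[simp] theorem cX_reflX (z : ℍ) : cX (reflX z) = -cX z := by simp [reflX]
@[simp] theorem cY_reflX (z : ℍ) : cY (reflX z) = cY z := by simp [reflX]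
@[simp] theorem cT_reflX (z : ℍ) : cT (reflX z) = cT z := by simp [reflX]

/-- The translation by `a` along the geodesic `cX = 0`. -/
def boostY (a : ℝ) : ℍ ≃ᵢ ℍ := swapXY * boostX a * swapXY

@[simp] theorem cX_boostY (a : ℝ) (z : ℍ) : cX (boostY a z) = cX z := by simp [boostY]
@[simp] theorem cY_boostY (a : ℝ) (z : ℍ) :
    cY (boostY a z) = Real.cosh a * cY z + Real.sinh a * cT z := by simp [boostY]
theorem swapXY_mul_self : swapXY * swapXY = 1 :=
  IsometryEquiv.ext fun z => ext_coords (by simp) (by simp)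

/-! ### Distance estimates and geodesics -/

/-- The function `arsinh ∘ cX`, the signed distance to the geodesic `cX = 0`, is contracting. -/
theorem abs_arsinh_cX_sub_le (z w : ℍ) :
    |Real.arsinh (cX z) - Real.arsinh (cX w)| ≤ dist z w := by
  rw [← abs_of_nonneg (dist_nonneg (x := z) (y := w)), ← Real.cosh_le_cosh, cosh_dist_eq,
    Real.cosh_sub, Real.cosh_arsinh, Real.cosh_arsinh, Real.sinh_arsinh, Real.sinh_arsinh,
    ← Real.sqrt_mul (by positivity)]
  have h1 := abs_le.1 (abs_cY_lt_cT z).le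
  have h2 := abs_le.1 (abs_cY_lt_cT w).le
  have h3 : cY z * cY w ≤ cT z * cT w := by
    have := mul_le_mul (abs_cY_lt_cT z).le (abs_cY_lt_cT w).le (abs_nonneg _) (cT_pos z).le
    rw [← abs_mul] at this
    exact (le_abs_self _).trans this
  -- Reversed Cauchy–Schwarz inequality in the plane of the coordinates `cT`, `cY`.
  have : √((1 + cX z ^ 2) * (1 + cX w ^ 2)) ≤ cT z * cT w - cY z * cY w := by
    rw [Real.sqrt_le_left (by linarith)]
    have e1 : 1 + cX z ^ 2 = cT z ^ 2 - cY z ^ 2 := by linear_combination -cT_sq z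
    have e2 : 1 + cX w ^ 2 = cT w ^ 2 - cY w ^ 2 := by linear_combination -cT_sq w
    rw [e1, e2]
    nlinarith [sq_nonneg (cT z * cY w - cY z * cT w)]
  linarith

theorem abs_arsinh_cY_sub_le (z w : ℍ) :
    |Real.arsinh (cY z) - Real.arsinh (cY w)| ≤ dist z w := by
  simpa [swapXY.isometry.dist_eq] using abs_arsinh_cX_sub_le (swapXY z) (swapXY w)

/-- On a geodesic orthogonal to `cX = 0`, the distance is the difference of the values of
`arsinh ∘ cX`. -/
theorem dist_eq_of_cY_eq_zero {z w : ℍ} (hz : cY z = 0) (hw : cY w = 0) :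
    dist z w = |Real.arsinh (cX z) - Real.arsinh (cX w)| := by
  refine dist_eq_of_cosh ?_
  have h1 := cT_sq z
  have h2 := cT_sq w
  rw [hz, zero_pow two_ne_zero, add_zero] at h1
  rw [hw, zero_pow two_ne_zero, add_zero] at h2
  rw [cosh_dist_eq, Real.cosh_sub, Real.cosh_arsinh, Real.cosh_arsinh, Real.sinh_arsinh,
    Real.sinh_arsinh, ← h1, ← h2, Real.sqrt_sq (cT_pos z).le, Real.sqrt_sq (cT_pos w).le, hz]
  ring

/-- Any two points are joined by a geodesic of constant speed, inside the convex cone that they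
span in the hyperboloid model. -/
theorem exists_geodesic (u v : ℍ) : ∃ γ : ℝ → ℍ, γ 0 = u ∧ γ 1 = v ∧
    (∀ σ ∈ Set.Icc (0 : ℝ) 1, ∀ τ ∈ Set.Icc (0 : ℝ) 1,
      dist (γ σ) (γ τ) = |σ - τ| * dist u v) ∧
    ∀ τ ∈ Set.Icc (0 : ℝ) 1, ∃ a b : ℝ, 0 ≤ a ∧ 0 ≤ b ∧ cT (γ τ) = a * cT u + b * cT v ∧
      cX (γ τ) = a * cX u + b * cX v ∧ cY (γ τ) = a * cY u + b * cY v := by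
  rcases eq_or_ne u v with rfl | huv
  · exact ⟨fun _ => u, rfl, rfl, by simp, fun τ _ => ⟨1, 0, by simp⟩⟩
  set D := dist u v with hD
  have hDpos : 0 < D := dist_pos.2 huv
  have hS : 0 < Real.sinh D := Real.sinh_pos_iff.2 hDpos
  have hC : cT u * cT v - cX u * cX v - cY u * cY v = Real.cosh D := (cosh_dist_eq u v).symm
  -- Hyperbolic spherical interpolation: these weights keep the combination on the hyperboloid, and
  -- by `key` the Lorentz form of the points at `σ` and `τ` is `cosh ((σ - τ) * D)`.
  let a : ℝ → ℝ := fun τ => Real.sinh (D - τ * D) / Real.sinh D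
  let b : ℝ → ℝ := fun τ => Real.sinh (τ * D) / Real.sinh D
  let γ : ℝ → ℍ := fun τ => ofCoords (a τ * cX u + b τ * cX v) (a τ * cY u + b τ * cY v)
  have ha : ∀ τ ∈ Set.Icc (0 : ℝ) 1, 0 ≤ a τ := fun τ hτ =>
    div_nonneg (Real.sinh_nonneg_iff.2 (by nlinarith [hτ.2])) hS.le
  have hb : ∀ τ ∈ Set.Icc (0 : ℝ) 1, 0 ≤ b τ := fun τ hτ =>
    div_nonneg (Real.sinh_nonneg_iff.2 (mul_nonneg hτ.1 hDpos.le)) hS.le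
  have key : ∀ σ τ, a σ * a τ + b σ * b τ + (a σ * b τ + b σ * a τ) * Real.cosh D
      = Real.cosh ((σ - τ) * D) := by
    intro σ τ
    simp only [a, b, sub_mul, Real.sinh_sub, Real.cosh_sub]
    generalize σ * D = x
    generalize τ * D = y
    field_simp
    linear_combination (-Real.sinh x * Real.sinh y) * Real.cosh_sq D
  have hT : ∀ τ ∈ Set.Icc (0 : ℝ) 1, cT (γ τ) = a τ * cT u + b τ * cT v := by
    intro τ hτ
    refine cT_ofCoords ?_ ?_
    · have := mul_nonneg (ha τ hτ) (cT_pos u).le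
      have := mul_nonneg (hb τ hτ) (cT_pos v).le
      linarith
    · have := key τ τ
      rw [sub_self, zero_mul, Real.cosh_zero] at this
      linear_combination this + a τ ^ 2 * cT_sq u + b τ ^ 2 * cT_sq v + 2 * a τ * b τ * hC
  refine ⟨γ, ?_, ?_, ?_, fun τ hτ => ⟨a τ, b τ, ha τ hτ, hb τ hτ, hT τ hτ, ?_, ?_⟩⟩
  · have h0 : a 0 = 1 := by simp [a, hS.ne']
    have h1 : b 0 = 0 := by simp [b]
    simp only [γ, h0, h1, one_mul, zero_mul, add_zero, ofCoords_coords]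
  · have h0 : a 1 = 0 := by simp [a]
    have h1 : b 1 = 1 := by simp [b, hS.ne']
    simp only [γ, h0, h1, one_mul, zero_mul, zero_add, ofCoords_coords]
  · intro σ hσ τ hτ
    have h : dist (γ σ) (γ τ) = |(σ - τ) * D| := by
      refine dist_eq_of_cosh ?_
      rw [cosh_dist_eq, hT σ hσ, hT τ hτ, ← key]
      simp only [γ, cX_ofCoords, cY_ofCoords]
      linear_combination a σ * a τ * cT_sq u + b σ * b τ * cT_sq v + (a σ * b τ + b σ * a τ) * hC
    rw [h, abs_mul, abs_of_pos hDpos]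
  · simp [γ]
  · simp [γ]

/-! ### Lengths of concatenated paths -/

/-- Split the parameter interval at `1 / 2`. Each half is a monotone reparametrization of one of the
two paths, which cannot increase the variation. -/
theorem pathLength_trans_le {X : Type} [PseudoEMetricSpace X] {x y z : X} (γ : Path x y)
    (γ' : Path y z) : pathLength (γ.trans γ') ≤ pathLength γ + pathLength γ' := by
  let m : unitInterval := ⟨1 / 2, by norm_num, by norm_num⟩
  have hu : (Set.univ : Set unitInterval) = Set.Iic m ∪ Set.Ici m := Set.Iic_union_Ici.symm
  rw [pathLength, hu, eVariationOn.union _ isGreatest_Iic isLeast_Ici]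
  refine add_le_add ?_ ?_
  · refine le_trans (le_of_eq ?_) (eVariationOn.comp_le_of_monotoneOn (γ : unitInterval → X)
      (t := Set.Iic m) (fun t => Set.projIcc 0 1 zero_le_one (2 * (t : ℝ))) ?_
      (Set.mapsTo_univ _ _))
    · refine eVariationOn.eq_of_eqOn fun t ht => ?_
      have ht' : (t : ℝ) ≤ 1 / 2 := ht
      simp only [Path.trans, Path.coe_mk_mk, Function.comp_apply, if_pos ht']
      rfl
    · intro a _ b _ hab
      exact Set.monotone_projIcc _ (mul_le_mul_of_nonneg_left hab two_pos.le)
  · refine le_trans (le_of_eq ?_) (eVariationOn.comp_le_of_monotoneOn (γ' : unitInterval → X)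
      (t := Set.Ici m) (fun t => Set.projIcc 0 1 zero_le_one (2 * (t : ℝ) - 1)) ?_
      (Set.mapsTo_univ _ _))
    · refine eVariationOn.eq_of_eqOn fun t ht => ?_
      have ht' : (1 / 2 : ℝ) ≤ t := ht
      rcases eq_or_lt_of_le ht' with h | h
      · have e0 : (2 : ℝ) * t = 1 := by rw [← h]; norm_num
        simp [Path.trans, e0]
      · have : ¬ (t : ℝ) ≤ 1 / 2 := not_le.2 h
        simp only [Path.trans, Path.coe_mk_mk, Function.comp_apply, if_neg this]
        rfl
    · intro a _ b _ hab
      have hab' : (a : ℝ) ≤ b := hab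
      exact Set.monotone_projIcc _ (by linarith)

/-! ### Gluing a domain by finitely many isometries -/

/-- A subset of a metric space with a finite set of isometries that glue it to its neighbours,
in such a way that the neighbours of any point fit together at the scale `ε`. -/
structure Gluing (H : Type) [MetricSpace H] where
  dom : Set H
  G : Set (H ≃ᵢ H)
  finite : G.Finite
  one_mem : 1 ∈ G
  inv_mem : ∀ g ∈ G, g⁻¹ ∈ G
  ε : ℝ
  ε_pos : 0 < ε
  -- Two consecutive short links can be replaced by a single one; this is what shortens chains.
  mul_mem : ∀ x ∈ dom, ∀ y ∈ dom, ∀ z ∈ dom, ∀ g ∈ G, ∀ h ∈ G,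
    dist x (g y) < ε → dist y (h z) < ε → g * h ∈ G
  -- Makes the isometry behind a short link unique, so that charts are well defined.
  eq_one : ∀ z ∈ dom, ∀ g ∈ G, dist z (g z) < ε → g = 1

theorem dist_inv_apply {H : Type} [MetricSpace H] (g : H ≃ᵢ H) (x y : H) :
    dist x (g⁻¹ y) = dist y (g x) := by
  rw [← g.dist_eq, IsometryEquiv.apply_inv_self, dist_comm]

namespace Gluing

variable {H : Type} [MetricSpace H] (D : Gluing H)

/-- The distance between two points through one of the gluing isometries. -/
def preDist (x y : D.dom) : NNReal := ⨅ g : D.G, nndist x.1 (g.1 y.1)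

theorem preDist_le (x y : D.dom) {g : H ≃ᵢ H} (hg : g ∈ D.G) :
    (D.preDist x y : ℝ) ≤ dist x.1 (g y.1) := by
  rw [← coe_nndist]
  exact NNReal.coe_le_coe.2 (ciInf_le (OrderBot.bddBelow _) (⟨g, hg⟩ : D.G))

theorem exists_preDist_eq (x y : D.dom) : ∃ g ∈ D.G, (D.preDist x y : ℝ) = dist x.1 (g y.1) := by
  have : Finite D.G := D.finite
  have : Nonempty D.G := ⟨⟨1, D.one_mem⟩⟩
  obtain ⟨g, hg⟩ := exists_eq_ciInf_of_finite (f := fun g : D.G => nndist x.1 (g.1 y.1))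
  exact ⟨g.1, g.2, by rw [preDist, ← hg, coe_nndist]⟩

theorem preDist_self (x : D.dom) : D.preDist x x = 0 := by
  refine le_antisymm (NNReal.coe_le_coe.1 ((D.preDist_le x x D.one_mem).trans ?_)) bot_le
  simp

theorem preDist_comm (x y : D.dom) : D.preDist x y = D.preDist y x := by
  have h : ∀ x y, D.preDist x y ≤ D.preDist y x := by
    intro x y
    obtain ⟨g, hg, h⟩ := D.exists_preDist_eq y x
    rw [← NNReal.coe_le_coe, h]
    refine (D.preDist_le x y (D.inv_mem g hg)).trans (le_of_eq (dist_inv_apply _ _ _))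
  exact le_antisymm (h x y) (h y x)

/-- The glued pseudometric on the domain. -/
@[reducible] def gluedPseudoMetric : PseudoMetricSpace D.dom :=
  PseudoMetricSpace.ofPreNNDist D.preDist D.preDist_self D.preDist_comm

/-- The length of a chain from `x` to `y` through the points of `l`. -/
def chainSum (x : D.dom) (l : List D.dom) (y : D.dom) : NNReal :=
  ((x :: l).zipWith D.preDist (l ++ [y])).sum

theorem chainSum_nil (x y : D.dom) : D.chainSum x [] y = D.preDist x y := by simp [chainSum]

theorem chainSum_cons (x a : D.dom) (l : List D.dom) (y : D.dom) :
    D.chainSum x (a :: l) y = D.preDist x a + D.chainSum a l y := by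
  rw [chainSum, List.cons_append, List.zipWith_cons_cons, List.sum_cons]
  rfl

/-- The glued space. -/
def Space : Type :=
  @SeparationQuotient D.dom D.gluedPseudoMetric.toUniformSpace.toTopologicalSpace

instance : MetricSpace D.Space :=
  @SeparationQuotient.instMetricSpace D.dom D.gluedPseudoMetric

/-- The projection of the domain to the glued space. -/
def proj (x : D.dom) : D.Space :=
  @SeparationQuotient.mk D.dom D.gluedPseudoMetric.toUniformSpace.toTopologicalSpace x

theorem proj_surjective : Function.Surjective D.proj :=
  @SeparationQuotient.surjective_mk D.dom D.gluedPseudoMetric.toUniformSpace.toTopologicalSpace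

theorem dist_proj (x y : D.dom) : dist (D.proj x) (D.proj y) =
    ((⨅ l : List D.dom, D.chainSum x l y : NNReal) : ℝ) := rfl

theorem dist_proj_le {g : H ≃ᵢ H} (hg : g ∈ D.G) (x y : D.dom) :
    dist (D.proj x) (D.proj y) ≤ dist x.1 (g y.1) :=
  (PseudoMetricSpace.dist_ofPreNNDist_le _ D.preDist_self D.preDist_comm _ _).trans
    (D.preDist_le x y hg)

theorem dist_proj_le_dist (x y : D.dom) : dist (D.proj x) (D.proj y) ≤ dist x.1 y.1 :=
  D.dist_proj_le D.one_mem x y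

theorem continuous_proj : Continuous D.proj :=
  (LipschitzWith.of_dist_le_mul (K := 1) fun x y => by
    rw [NNReal.coe_one, one_mul]
    exact D.dist_proj_le_dist x y).continuous

/-- A function with the triangle inequality that is bounded by the distances through the gluing
isometries is bounded by the glued distance. -/
theorem le_dist_proj (ρ : D.dom → D.dom → ℝ) (htri : ∀ x y z, ρ x z ≤ ρ x y + ρ y z)
    (h : ∀ x y : D.dom, ∀ g ∈ D.G, ρ x y ≤ dist x.1 (g y.1)) (x y : D.dom) :
    ρ x y ≤ dist (D.proj x) (D.proj y) := by
  have hδ : ∀ x y : D.dom, ρ x y ≤ D.preDist x y := fun x y => by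
    obtain ⟨g, hg, e⟩ := D.exists_preDist_eq x y
    exact (h x y g hg).trans e.ge
  have key : ∀ (l : List D.dom) (x : D.dom), ρ x y ≤
      (D.chainSum x l y) := by
    intro l
    induction l with
    | nil => intro x; rw [chainSum_nil]; exact hδ x y
    | cons a l ih =>
      intro x
      rw [chainSum_cons, NNReal.coe_add]
      exact (htri x a y).trans (add_le_add (hδ x a) (ih a))
  rw [dist_proj, NNReal.coe_iInf]
  exact le_ciInf fun l => key l x

/-- In a chain shorter than `ε`, consecutive links merge by `mul_mem`, and the triangle inequality
shows that merging does not lengthen it. Finiteness of `G` then provides a minimizing isometry. -/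
theorem exists_dist_proj_eq {x y : D.dom} (hxy : dist (D.proj x) (D.proj y) < D.ε) :
    ∃ g ∈ D.G, dist (D.proj x) (D.proj y) = dist x.1 (g y.1) := by
  have key : ∀ (l : List D.dom) (x : D.dom),
      (D.chainSum x l y) < D.ε →
      (D.preDist x y : ℝ) ≤ (D.chainSum x l y) := by
    intro l
    induction l with
    | nil => intro x _; rw [chainSum_nil]
    | cons a l ih =>
      intro x hx
      rw [chainSum_cons, NNReal.coe_add] at hx ⊢
      have h0 := (D.preDist x a).coe_nonneg
      have h1 := ih a (by linarith)
      have h2 := (D.preDist a y).coe_nonneg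
      refine le_trans ?_ (add_le_add le_rfl h1)
      obtain ⟨g, hg, eg⟩ := D.exists_preDist_eq x a
      obtain ⟨k, hk, ek⟩ := D.exists_preDist_eq a y
      have hgk := D.mul_mem x.1 x.2 a.1 a.2 y.1 y.2 g hg k hk (by linarith) (by linarith)
      refine (D.preDist_le x y hgk).trans ?_
      rw [eg, ek, ← g.dist_eq a.1]
      exact dist_triangle _ _ _
  obtain ⟨g, hg, e⟩ := D.exists_preDist_eq x y
  refine ⟨g, hg, le_antisymm (D.dist_proj_le hg x y) ?_⟩
  rw [← e]
  refine le_of_forall_pos_lt_add fun η hη => ?_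
  have hlt : dist (D.proj x) (D.proj y) < min D.ε (dist (D.proj x) (D.proj y) + η) :=
    lt_min hxy (by linarith)
  rw [dist_proj, NNReal.coe_iInf] at hlt
  obtain ⟨l, hl⟩ := exists_lt_of_ciInf_lt hlt
  rw [← NNReal.coe_iInf, ← dist_proj] at hl
  exact (key l x (lt_of_lt_of_le hl (min_le_left _ _))).trans_lt
    (lt_of_lt_of_le hl (min_le_right _ _))

/-- Distance zero is below `ε`, so it is attained through a single gluing isometry. -/
theorem proj_eq_iff {x y : D.dom} : D.proj x = D.proj y ↔ ∃ g ∈ D.G, x.1 = g y.1 := by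
  constructor
  · intro h
    have h0 : dist (D.proj x) (D.proj y) = 0 := dist_eq_zero.2 h
    obtain ⟨g, hg, e⟩ := D.exists_dist_proj_eq (h0 ▸ D.ε_pos)
    exact ⟨g, hg, dist_eq_zero.1 (e ▸ h0)⟩
  · rintro ⟨g, hg, e⟩
    refine dist_le_zero.1 ((D.dist_proj_le hg x y).trans (le_of_eq ?_))
    rw [e, dist_self]

/-- If gluing links can be realized by paths, the glued distance is a length distance. -/
theorem exists_short_path (hpath : ∀ x y : D.dom, ∀ g ∈ D.G, ∃ γ : Path (D.proj x) (D.proj y),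
    pathLength γ ≤ ENNReal.ofReal (dist x.1 (g y.1))) (x y : D.Space) (η : ℝ) (hη : 0 < η) :
    ∃ γ : Path x y, pathLength γ ≤ ENNReal.ofReal (dist x y + η) := by
  obtain ⟨x, rfl⟩ := D.proj_surjective x
  obtain ⟨y, rfl⟩ := D.proj_surjective y
  have key : ∀ (l : List D.dom) (x : D.dom), ∃ γ : Path (D.proj x) (D.proj y),
      pathLength γ ≤ ENNReal.ofReal (D.chainSum x l y) := by
    intro l
    induction l with
    | nil =>
      intro x
      obtain ⟨g, hg, e⟩ := D.exists_preDist_eq x y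
      obtain ⟨γ, hγ⟩ := hpath x y g hg
      refine ⟨γ, hγ.trans (le_of_eq ?_)⟩
      rw [chainSum_nil, e]
    | cons a l ih =>
      intro x
      obtain ⟨g, hg, e⟩ := D.exists_preDist_eq x a
      obtain ⟨γ, hγ⟩ := hpath x a g hg
      obtain ⟨γ', hlen⟩ := ih a
      refine ⟨γ.trans γ', (pathLength_trans_le γ γ').trans ?_⟩
      rw [chainSum_cons, NNReal.coe_add,
        ENNReal.ofReal_add (NNReal.coe_nonneg _) (NNReal.coe_nonneg _), e]
      exact add_le_add hγ hlen
  have hlt : dist (D.proj x) (D.proj y) < dist (D.proj x) (D.proj y) + η := by linarith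
  rw [dist_proj, NNReal.coe_iInf] at hlt
  obtain ⟨l, hl⟩ := exists_lt_of_ciInf_lt hlt
  obtain ⟨γ, hγ⟩ := key l x
  refine ⟨γ, hγ.trans (ENNReal.ofReal_le_ofReal ?_)⟩
  rw [← NNReal.coe_iInf, ← dist_proj] at hl
  exact hl.le

/-- Near a point of the domain, the glued space is isometric to the union of the neighbouring
copies of the domain. -/
theorem exists_chart (x : D.dom) {r : ℝ} (hr : 4 * r ≤ D.ε) (hr0 : 0 < r) :
    ∃ φ : D.Space → H, φ (D.proj x) = x.1 ∧
      (∀ y ∈ Metric.ball (D.proj x) r, ∀ z ∈ Metric.ball (D.proj x) r,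
        dist (φ y) (φ z) = dist y z) ∧
      φ '' Metric.ball (D.proj x) r = Metric.ball x.1 r ∩ {u | ∃ g ∈ D.G, ∃ y ∈ D.dom, g y = u} := by
  -- The chart sends a class near the centre to a copy `g y'` of its representative that lies near
  -- `x`; off the ball the value is an arbitrary default.
  have hex : ∀ y : D.Space, ∃ u : H, y ∈ Metric.ball (D.proj x) r →
      dist x.1 u < r ∧ ∃ g ∈ D.G, ∃ y' : D.dom, D.proj y' = y ∧ u = g y'.1 := by
    intro y
    by_cases hy : y ∈ Metric.ball (D.proj x) r
    · obtain ⟨y', rfl⟩ := D.proj_surjective y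
      rw [Metric.mem_ball, dist_comm] at hy
      obtain ⟨g, hg, e⟩ := D.exists_dist_proj_eq (x := x) (y := y') (by linarith)
      exact ⟨g y'.1, fun _ => ⟨e ▸ hy, g, hg, y', rfl, rfl⟩⟩
    · exact ⟨x.1, fun h => absurd h hy⟩
  choose φ hφ using hex
  -- If `k` realizes the glued distance of `y` and `z`, then `g * k` and `h` both send `z` near `x`,
  -- to within `3 * r` and `r`. So `h⁻¹ * (g * k)` moves `z` by less than `4 * r ≤ ε` and is
  -- trivial: the glued distance is the distance of the chosen copies.
  have hiso : ∀ (y z : D.dom), ∀ g ∈ D.G, ∀ h ∈ D.G, dist x.1 (g y.1) < r → dist x.1 (h z.1) < r →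
      dist (D.proj y) (D.proj z) = dist (g y.1) (h z.1) := by
    intro y z g hg h hh hy hz
    have hy' : dist y.1 (g⁻¹ x.1) < r := by rwa [dist_inv_apply]
    have hz' : dist z.1 (h⁻¹ x.1) < r := by rwa [dist_inv_apply]
    have hgh : dist (g y.1) (h z.1) < 2 * r := by
      have := dist_triangle_left (g y.1) (h z.1) x.1
      linarith
    have e1 : dist y.1 ((g⁻¹ * h) z.1) = dist (g y.1) (h z.1) := by
      rw [IsometryEquiv.mul_apply, dist_inv_apply, dist_comm]
    have hle : dist (D.proj y) (D.proj z) ≤ dist (g y.1) (h z.1) := by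
      rw [← e1]
      exact D.dist_proj_le (D.mul_mem y.1 y.2 x.1 x.2 z.1 z.2 _ (D.inv_mem g hg) h hh (by linarith)
        (by linarith)) y z
    obtain ⟨k, hk, e⟩ := D.exists_dist_proj_eq (x := y) (y := z) (by linarith)
    have hgk := D.mul_mem x.1 x.2 y.1 y.2 z.1 z.2 g hg k hk (by linarith) (by linarith)
    have hxk : dist x.1 ((g * k) z.1) < 3 * r := by
      have := dist_triangle x.1 (g y.1) ((g * k) z.1)
      rw [IsometryEquiv.mul_apply, g.dist_eq] at this
      rw [IsometryEquiv.mul_apply]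
      linarith
    have hm := D.mul_mem z.1 z.2 x.1 x.2 z.1 z.2 _ (D.inv_mem h hh) _ hgk (by linarith)
      (by linarith)
    have h1 := D.eq_one z.1 z.2 _ hm (by
      rw [IsometryEquiv.mul_apply, dist_inv_apply, dist_comm]
      have := dist_triangle_left (h z.1) ((g * k) z.1) x.1
      linarith)
    have h2 : g * k = h := (inv_mul_eq_one.1 h1).symm
    rw [e, ← g.dist_eq, ← h2]
    rfl
  refine ⟨φ, ?_, ?_, ?_⟩
  · obtain ⟨h1, g, hg, y', hy', e⟩ := hφ (D.proj x) (Metric.mem_ball_self hr0)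
    have := hiso x y' 1 D.one_mem g hg (by simpa using hr0) (e ▸ h1)
    rw [hy', dist_self] at this
    rw [e]
    exact (dist_eq_zero.1 this.symm).symm
  · intro y hy z hz
    obtain ⟨h1, g, hg, y', hy', e⟩ := hφ y hy
    obtain ⟨h2, h, hh, z', hz', e'⟩ := hφ z hz
    rw [e, e', ← hy', ← hz', hiso y' z' g hg h hh (e ▸ h1) (e' ▸ h2)]
  · ext u
    constructor
    · rintro ⟨y, hy, rfl⟩
      obtain ⟨h1, g, hg, y', -, e⟩ := hφ y hy
      exact ⟨by rwa [Metric.mem_ball, dist_comm], g, hg, y'.1, y'.2, e.symm⟩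
    · rintro ⟨h1, g, hg, y, hy, rfl⟩
      rw [Metric.mem_ball, dist_comm] at h1
      have hb : D.proj ⟨y, hy⟩ ∈ Metric.ball (D.proj x) r := by
        rw [Metric.mem_ball, dist_comm]
        exact (D.dist_proj_le hg x ⟨y, hy⟩).trans_lt h1
      refine ⟨D.proj ⟨y, hy⟩, hb, ?_⟩
      obtain ⟨h2, h, hh, z, hz, e⟩ := hφ _ hb
      have := hiso ⟨y, hy⟩ z g hg h hh h1 (e ▸ h2)
      rw [hz, dist_self] at this
      rw [e]
      exact (dist_eq_zero.1 this.symm).symm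

end Gluing

/-! ### The right-angled octagon -/

/-- The two half-translation lengths of a rectangular one-holed torus. -/
structure Shape where
  p : ℝ
  q : ℝ
  p_pos : 0 < p
  q_pos : 0 < q
  -- In the Klein disc the lines of adjacent walls meet at `(tanh p, tanh q)` up to signs. This says
  -- that the point lies outside the disc, so the walls are disjoint; its polar line is their common
  -- perpendicular.
  one_lt : 1 < Real.tanh p ^ 2 + Real.tanh q ^ 2

namespace Shape

variable (S : Shape)

/-- The shape with the two translation lengths exchanged. -/
def swap : Shape := ⟨S.q, S.p, S.q_pos, S.p_pos, by rw [add_comm]; exact S.one_lt⟩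

/-- The Klein coordinate of the right wall. -/
def s : ℝ := Real.tanh S.p

/-- The Klein coordinate of the upper wall. -/
def t : ℝ := Real.tanh S.q

theorem swap_p : S.swap.p = S.q := rfl
theorem swap_s : S.swap.s = S.t := rfl
theorem swap_t : S.swap.t = S.s := rfl

theorem tanh_pos {a : ℝ} (ha : 0 < a) : 0 < Real.tanh a := by
  rw [Real.tanh_eq_sinh_div_cosh]
  exact div_pos (Real.sinh_pos_iff.2 ha) (Real.cosh_pos a)

theorem s_pos : 0 < S.s := tanh_pos S.p_pos
theorem t_pos : 0 < S.t := tanh_pos S.q_pos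
theorem s_lt_one : S.s < 1 := Real.tanh_lt_one _
theorem t_lt_one : S.t < 1 := Real.tanh_lt_one _
theorem one_lt_sq : 1 < S.s ^ 2 + S.t ^ 2 := S.one_lt

/-- The right-angled octagon bounded by the four walls and the four boundary geodesics. -/
def oct : Set ℍ :=
  {z | |cX z| ≤ S.s * cT z ∧ |cY z| ≤ S.t * cT z ∧ S.s * |cX z| + S.t * |cY z| ≤ cT z}

theorem reflX_mem_oct {z : ℍ} : reflX z ∈ S.oct ↔ z ∈ S.oct := by
  simp [oct]

theorem swapXY_mem_oct {z : ℍ} : swapXY z ∈ S.swap.oct ↔ z ∈ S.oct := by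
  simp only [oct, Set.mem_ofPred_eq, cX_swapXY, cY_swapXY, cT_swapXY, swap_s, swap_t]
  rw [add_comm (S.t * |cY z|)]
  tauto

/-- The octagon is cut out by convex homogeneous inequalities, and points of the geodesic are
nonnegative combinations of its ends. -/
theorem exists_geodesic_oct {u v : ℍ} (hu : u ∈ S.oct) (hv : v ∈ S.oct) : ∃ γ : ℝ → ℍ,
    γ 0 = u ∧ γ 1 = v ∧ (∀ σ ∈ Set.Icc (0 : ℝ) 1, ∀ τ ∈ Set.Icc (0 : ℝ) 1,
      dist (γ σ) (γ τ) = |σ - τ| * dist u v) ∧ ∀ τ ∈ Set.Icc (0 : ℝ) 1, γ τ ∈ S.oct := by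
  obtain ⟨γ, h0, h1, hd, hc⟩ := exists_geodesic u v
  refine ⟨γ, h0, h1, hd, fun τ hτ => ?_⟩
  obtain ⟨a, b, ha, hb, eT, eX, eY⟩ := hc τ hτ
  have hX : |cX (γ τ)| ≤ a * |cX u| + b * |cX v| := by
    rw [eX]
    refine (abs_add_le _ _).trans (le_of_eq ?_)
    rw [abs_mul, abs_mul, abs_of_nonneg ha, abs_of_nonneg hb]
  have hY : |cY (γ τ)| ≤ a * |cY u| + b * |cY v| := by
    rw [eY]
    refine (abs_add_le _ _).trans (le_of_eq ?_)
    rw [abs_mul, abs_mul, abs_of_nonneg ha, abs_of_nonneg hb]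
  have hs := S.s_pos
  have ht := S.t_pos
  refine ⟨?_, ?_, ?_⟩
  · have := mul_le_mul_of_nonneg_left hu.1 ha
    have := mul_le_mul_of_nonneg_left hv.1 hb
    rw [eT]
    linarith
  · have := mul_le_mul_of_nonneg_left hu.2.1 ha
    have := mul_le_mul_of_nonneg_left hv.2.1 hb
    rw [eT]
    linarith
  · have := mul_le_mul_of_nonneg_left hu.2.2 ha
    have := mul_le_mul_of_nonneg_left hv.2.2 hb
    have := mul_le_mul_of_nonneg_left hX hs.le
    have := mul_le_mul_of_nonneg_left hY ht.le
    rw [eT]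
    linarith

/-! ### The side pairings -/

theorem cosh_two_p : Real.cosh (2 * S.p) = 1 + S.s * Real.sinh (2 * S.p) := by
  have h : Real.sinh S.p = S.s * Real.cosh S.p := by
    rw [s, Real.tanh_eq_sinh_div_cosh, div_mul_cancel₀ _ (Real.cosh_pos _).ne']
  rw [Real.cosh_two_mul, Real.sinh_two_mul]
  linear_combination Real.cosh_sq S.p + 2 * Real.sinh S.p * h

theorem sinh_two_p : Real.sinh (2 * S.p) = S.s * (1 + Real.cosh (2 * S.p)) := by
  have h : Real.sinh S.p = S.s * Real.cosh S.p := by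
    rw [s, Real.tanh_eq_sinh_div_cosh, div_mul_cancel₀ _ (Real.cosh_pos _).ne']
  rw [Real.cosh_two_mul, Real.sinh_two_mul]
  linear_combination 2 * Real.cosh S.p * h + S.s * Real.cosh_sq S.p

/-- The translation that pairs the left wall with the right wall. -/
def trA : ℍ ≃ᵢ ℍ := boostX (2 * S.p)

/-- The translation that pairs the lower wall with the upper wall. -/
def trB : ℍ ≃ᵢ ℍ := boostY (2 * S.q)

theorem trB_apply (z : ℍ) : S.trB z = swapXY (S.swap.trA (swapXY z)) := rfl

theorem swapXY_swapXY (z : ℍ) : swapXY (swapXY z) = z :=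
  DFunLike.congr_fun swapXY_mul_self z

theorem dist_trB (x y : ℍ) : dist x (S.trB y) = dist (swapXY x) (S.swap.trA (swapXY y)) := by
  rw [trB_apply, ← swapXY.dist_eq, swapXY_swapXY]

theorem cY_trA (z : ℍ) : cY (S.trA z) = cY z := cY_boostX _ _

/-- The translation carries the left wall `cX = -s * cT` to the right wall. -/
theorem cX_sub_trA (z : ℍ) : cX (S.trA z) - S.s * cT (S.trA z) = cX z + S.s * cT z := by
  rw [trA, cX_boostX, cT_boostX]
  linear_combination cX z * S.cosh_two_p + cT z * S.sinh_two_p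

/-- Together with `cY_trA`, this shows that the boundary geodesics on the left go to those on the
right, so the boundary continues across a wall without a corner. -/
theorem cT_sub_trA (z : ℍ) : cT (S.trA z) - S.s * cX (S.trA z) = cT z + S.s * cX z := by
  rw [trA, cX_boostX, cT_boostX]
  linear_combination cT z * S.cosh_two_p + cX z * S.sinh_two_p

/-- The four side pairings: the first entry of the index selects the axis, the second one the
direction. -/
def pairing : Bool × Bool → ℍ ≃ᵢ ℍ
  | (false, true) => S.trA
  | (false, false) => S.trA⁻¹
  | (true, true) => S.trB
  | (true, false) => S.trB⁻¹

/-- The opposite side. -/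
def opp (i : Bool × Bool) : Bool × Bool := (i.1, !i.2)

/-- A function that is nonnegative on the inner side of a wall and vanishes on the wall. -/
def gap : Bool × Bool → ℍ → ℝ
  | (false, true), z => S.s * cT z - cX z
  | (false, false), z => S.s * cT z + cX z
  | (true, true), z => S.t * cT z - cY z
  | (true, false), z => S.t * cT z + cY z

theorem pairing_opp (i : Bool × Bool) : S.pairing (opp i) = (S.pairing i)⁻¹ := by
  rcases i with ⟨_ | _, _ | _⟩ <;> simp [pairing, opp]

theorem opp_ne (i : Bool × Bool) : opp i ≠ i := by
  rcases i with ⟨_ | _, _ | _⟩ <;> simp [opp]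

theorem gap_nonneg (i : Bool × Bool) {z : ℍ} (hz : z ∈ S.oct) : 0 ≤ S.gap i z := by
  have h1 := abs_le.1 hz.1
  have h2 := abs_le.1 hz.2.1
  rcases i with ⟨_ | _, _ | _⟩ <;> simp only [gap] <;> linarith

theorem gap_pairing (i : Bool × Bool) (z : ℍ) : S.gap i (S.pairing i z) = -S.gap (opp i) z := by
  have hA := S.cX_sub_trA
  have hB := fun z => S.swap.cX_sub_trA (swapXY z)
  rcases i with ⟨_ | _, _ | _⟩ <;> simp only [gap, pairing, opp, Bool.not_true, Bool.not_false]
  · have := hA (S.trA⁻¹ z)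
    rw [IsometryEquiv.apply_inv_self] at this
    linarith
  · linarith [hA z]
  · have := hB (S.trB⁻¹ z)
    have e : S.swap.trA (swapXY (S.trB⁻¹ z)) = swapXY z := by
      rw [← swapXY_swapXY (S.swap.trA (swapXY (S.trB⁻¹ z))), ← trB_apply,
        IsometryEquiv.apply_inv_self]
    rw [e] at this
    simp only [cX_swapXY, cT_swapXY, swap_s] at this
    linarith
  · have := hB z
    simp only [trB_apply, cY_swapXY, cT_swapXY, cX_swapXY, swap_s] at this ⊢
    linarith

/-- After the translation that moves the right wall to `cX = 0`, the expression is `-cX`; its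
`arsinh` is the signed distance to the wall. -/
theorem abs_arsinh_gap_right (z w : ℍ) :
    |Real.arsinh (Real.cosh S.p * (S.s * cT z - cX z)) -
      Real.arsinh (Real.cosh S.p * (S.s * cT w - cX w))| ≤ dist z w := by
  have h : Real.sinh S.p = S.s * Real.cosh S.p := by
    rw [s, Real.tanh_eq_sinh_div_cosh, div_mul_cancel₀ _ (Real.cosh_pos _).ne']
  have e : ∀ z, Real.cosh S.p * (S.s * cT z - cX z) = -cX (boostX (-S.p) z) := fun z => by
    rw [cX_boostX, Real.cosh_neg, Real.sinh_neg, h]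
    ring
  have := abs_arsinh_cX_sub_le (boostX (-S.p) z) (boostX (-S.p) w)
  rw [(boostX (-S.p)).dist_eq] at this
  rw [e, e, Real.arsinh_neg, Real.arsinh_neg, neg_sub_neg, abs_sub_comm]
  exact this

theorem exists_abs_arsinh_gap (i : Bool × Bool) : ∃ c : ℝ, 1 ≤ c ∧ ∀ z w,
    |Real.arsinh (c * S.gap i z) - Real.arsinh (c * S.gap i w)| ≤ dist z w := by
  rcases i with ⟨_ | _, _ | _⟩ <;> simp only [gap]
  · refine ⟨_, Real.one_le_cosh S.p, fun z w => ?_⟩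
    have := S.abs_arsinh_gap_right (reflX z) (reflX w)
    simpa only [cX_reflX, cT_reflX, sub_neg_eq_add, reflX.dist_eq] using this
  · exact ⟨_, Real.one_le_cosh S.p, S.abs_arsinh_gap_right⟩
  · refine ⟨_, Real.one_le_cosh S.q, fun z w => ?_⟩
    have := S.swap.abs_arsinh_gap_right (reflX (swapXY z)) (reflX (swapXY w))
    rw [swap_s, swap_p] at this
    simpa only [cX_reflX, cT_reflX, sub_neg_eq_add, reflX.dist_eq, swapXY.dist_eq, cX_swapXY,
      cT_swapXY] using this
  · refine ⟨_, Real.one_le_cosh S.q, fun z w => ?_⟩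
    have := S.swap.abs_arsinh_gap_right (swapXY z) (swapXY w)
    rw [swap_s, swap_p] at this
    simpa only [swapXY.dist_eq, cX_swapXY, cT_swapXY] using this

/-- The excess of the shape, which is positive because the walls are pairwise disjoint. -/
def excess : ℝ := S.s ^ 2 + S.t ^ 2 - 1

theorem excess_pos : 0 < S.excess := by
  have := S.one_lt_sq
  unfold excess
  linarith

/-- The two points lie on different sides of wall `i`, so when they are close the first is close to
the wall. -/
theorem gap_lt_of_dist_lt (i : Bool × Bool) {x y : ℍ} (hx : x ∈ S.oct) (hy : y ∈ S.oct)
    (h : dist x (S.pairing i y) < Real.arsinh (S.excess / 2)) : S.gap i x < S.excess / 2 := by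
  obtain ⟨c, hc, hl⟩ := S.exists_abs_arsinh_gap i
  have h1 := (le_abs_self _).trans (hl x (S.pairing i y))
  have h2 : Real.arsinh (c * S.gap i (S.pairing i y)) ≤ 0 := by
    rw [Real.arsinh_nonpos_iff, gap_pairing]
    have := S.gap_nonneg (opp i) hy
    nlinarith
  have h3 : Real.arsinh (c * S.gap i x) < Real.arsinh (S.excess / 2) := by linarith
  rw [Real.arsinh_lt_arsinh] at h3
  have := S.gap_nonneg i hx
  nlinarith

/-- For adjacent walls, the gaps weighted by `s` and `t` sum to at least `excess * cT` by the
boundary inequality. For opposite walls, the gaps sum to `2 * s * cT` or `2 * t * cT`, which exceeds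
`excess`. So no point of the octagon is near two walls. -/
theorem eq_of_gap_lt {i j : Bool × Bool} {x : ℍ} (hx : x ∈ S.oct) (hi : S.gap i x < S.excess / 2)
    (hj : S.gap j x < S.excess / 2) : i = j := by
  have h1 := abs_le.1 hx.1
  have h2 := abs_le.1 hx.2.1
  have h3 := hx.2.2
  have hs := S.s_pos
  have ht := S.t_pos
  have hs1 := S.s_lt_one
  have ht1 := S.t_lt_one
  have hT := one_le_cT x
  have ha := mul_le_mul_of_nonneg_left (le_abs_self (cX x)) hs.le
  have hb := mul_le_mul_of_nonneg_left (neg_abs_le (cX x)) hs.le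
  have hc := mul_le_mul_of_nonneg_left (le_abs_self (cY x)) ht.le
  have hd := mul_le_mul_of_nonneg_left (neg_abs_le (cY x)) ht.le
  have he : S.excess ≤ S.excess * cT x := le_mul_of_one_le_right S.excess_pos.le hT
  have hpos := S.excess_pos
  have hes : S.excess < S.s * cT x := by unfold excess; nlinarith
  have het : S.excess < S.t * cT x := by unfold excess; nlinarith
  have hex : S.excess * cT x = S.s * (S.s * cT x) + S.t * (S.t * cT x) - cT x := by
    unfold excess; ring
  have hse : S.s * (S.excess / 2) < S.excess / 2 := by nlinarith
  have hte : S.t * (S.excess / 2) < S.excess / 2 := by nlinarith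
  have hi' : S.s * S.gap i x ≤ S.s * (S.excess / 2) := mul_le_mul_of_nonneg_left hi.le hs.le
  have hi'' : S.t * S.gap i x ≤ S.t * (S.excess / 2) := mul_le_mul_of_nonneg_left hi.le ht.le
  have hj' : S.s * S.gap j x ≤ S.s * (S.excess / 2) := mul_le_mul_of_nonneg_left hj.le hs.le
  have hj'' : S.t * S.gap j x ≤ S.t * (S.excess / 2) := mul_le_mul_of_nonneg_left hj.le ht.le
  rcases i with ⟨_ | _, _ | _⟩ <;> rcases j with ⟨_ | _, _ | _⟩ <;> simp only [gap] at * <;>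
    first | rfl | (exfalso; linarith)

/-- The gluing of the octagon by its side pairings. -/
def gluing : Gluing ℍ where
  dom := S.oct
  G := insert 1 (Set.range S.pairing)
  finite := (Set.finite_range _).insert _
  one_mem := Set.mem_insert _ _
  inv_mem := by
    rintro g (rfl | ⟨i, rfl⟩)
    · exact Or.inl inv_one
    · exact Or.inr ⟨opp i, S.pairing_opp i⟩
  ε := Real.arsinh (S.excess / 2)
  ε_pos := Real.arsinh_pos_iff.2 (half_pos S.excess_pos)
  mul_mem := by
    rintro x hx y hy z hz g (rfl | ⟨i, rfl⟩) h hh h1 h2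
    · rwa [one_mul]
    rcases hh with rfl | ⟨j, rfl⟩
    · exact Or.inr ⟨i, (mul_one _).symm⟩
    -- The middle point is near the walls `opp i` and `j`, so they coincide and the two pairings
    -- cancel.
    have h1' := S.gap_lt_of_dist_lt (opp i) hy hx (by rwa [pairing_opp, dist_inv_apply])
    have h2' := S.gap_lt_of_dist_lt j hy hz h2
    rw [← S.eq_of_gap_lt hy h1' h2', pairing_opp, mul_inv_cancel]
    exact Or.inl rfl
  eq_one := by
    rintro z hz g (rfl | ⟨i, rfl⟩) h
    · rfl
    have h1 := S.gap_lt_of_dist_lt i hz hz h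
    have h2 := S.gap_lt_of_dist_lt (opp i) hz hz (by rwa [pairing_opp, dist_inv_apply])
    exact absurd (S.eq_of_gap_lt hz h2 h1) (opp_ne i)

/-- The hyperbolic one-holed torus of the given shape. -/
abbrev Surface : Type := S.gluing.Space

/-- To prove a property of all gluing isometries of all shapes it suffices to treat the
translation `trA`, if the property is symmetric. -/
theorem gluing_induction {P : Shape → ℍ → ℍ → (ℍ ≃ᵢ ℍ) → Prop}
    (one : ∀ S x y, x ∈ S.oct → y ∈ S.oct → P S x y 1)
    (trA : ∀ S x y, x ∈ S.oct → y ∈ S.oct → P S x y S.trA)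
    (inv : ∀ S x y g, P S x y g → P S y x g⁻¹)
    (swap : ∀ S x y, P S.swap (swapXY x) (swapXY y) S.swap.trA → P S x y S.trB)
    (S : Shape) {x y : ℍ} (hx : x ∈ S.oct) (hy : y ∈ S.oct) {g : ℍ ≃ᵢ ℍ} (hg : g ∈ S.gluing.G) :
    P S x y g := by
  have hB : ∀ S x y, x ∈ S.oct → y ∈ S.oct → P S x y S.trB := fun S x y hx hy =>
    swap S x y (trA _ _ _ (S.swapXY_mem_oct.2 hx) (S.swapXY_mem_oct.2 hy))
  rcases hg with rfl | ⟨⟨_ | _, _ | _⟩, rfl⟩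
  · exact one S x y hx hy
  · exact inv _ _ _ _ (trA S y x hy hx)
  · exact trA S x y hx hy
  · exact inv _ _ _ _ (hB S y x hy hx)
  · exact hB S x y hx hy

/-- A geodesic through a gluing isometry crosses the wall inside the octagon. -/
theorem exists_crossing {x y : ℍ} (hx : x ∈ S.oct) (hy : y ∈ S.oct) {g : ℍ ≃ᵢ ℍ}
    (hg : g ∈ S.gluing.G) : ∃ w ∈ S.oct, ∃ w' ∈ S.oct, w = g w' ∧
      dist x (g y) = dist x w + dist w' y := by
  refine gluing_induction (P := fun S x y g => ∃ w ∈ S.oct, ∃ w' ∈ S.oct, w = g w' ∧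
      dist x (g y) = dist x w + dist w' y) ?_ ?_ ?_ ?_ S hx hy hg
  · intro S x y hx hy
    exact ⟨x, hx, x, hx, rfl, by simp⟩
  · intro S x y hx hy
    obtain ⟨γ, h0, h1, hd, hc⟩ := exists_geodesic x (S.trA y)
    have hs := S.s_pos
    have ht := S.t_pos
    have hcont : ContinuousOn γ (Set.Icc 0 1) := by
      have : LipschitzOnWith (Real.toNNReal (dist x (S.trA y))) γ (Set.Icc 0 1) := by
        refine LipschitzOnWith.of_dist_le_mul fun σ hσ τ hτ => ?_
        rw [hd σ hσ τ hτ, Real.coe_toNNReal _ dist_nonneg, mul_comm, Real.dist_eq]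
      exact this.continuousOn
    have hgap : ContinuousOn (fun τ => S.s * cT (γ τ) - cX (γ τ)) (Set.Icc 0 1) :=
      ((continuous_const.mul continuous_cT).sub continuous_cX).comp_continuousOn hcont
    have hxX := abs_le.1 hx.1
    have hyX := abs_le.1 hy.1
    have e1 := S.cX_sub_trA y
    have e2 := S.cT_sub_trA y
    -- The end `x` is on the inner side of the right wall and `trA y` on its outer side.
    obtain ⟨τ, hτ, hw⟩ := intermediate_value_Icc' zero_le_one hgap
      (show (0 : ℝ) ∈ Set.Icc _ _ by
        simp only [h0, h1]
        exact ⟨by linarith, by linarith⟩)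
    obtain ⟨a, b, ha, hb, eT, eX, eY⟩ := hc τ hτ
    rw [cY_trA] at eY
    have hw' : cX (γ τ) = S.s * cT (γ τ) := by
      have : S.s * cT (γ τ) - cX (γ τ) = 0 := hw
      linarith
    have hY : |cY (γ τ)| ≤ a * |cY x| + b * |cY y| := by
      rw [eY]
      refine (abs_add_le _ _).trans (le_of_eq ?_)
      rw [abs_mul, abs_mul, abs_of_nonneg ha, abs_of_nonneg hb]
    have hT := cT_pos (γ τ)
    have hXpos : 0 ≤ cX (γ τ) := hw' ▸ (mul_pos hs hT).le
    -- The boundary inequality holds at `x`, and at `trA y` it is the one for `y` transported by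
    -- `e2`; nonnegative combinations preserve it.
    have hQ : S.s * |cX (γ τ)| + S.t * |cY (γ τ)| ≤ cT (γ τ) := by
      rw [abs_of_nonneg hXpos]
      have k1 := mul_le_mul_of_nonneg_left hx.2.2 ha
      have k2 := mul_le_mul_of_nonneg_left hy.2.2 hb
      have k3 := mul_le_mul_of_nonneg_left hY ht.le
      have k4 := mul_le_mul_of_nonneg_left (le_abs_self (cX x)) (mul_nonneg ha hs.le)
      have k5 := mul_le_mul_of_nonneg_left (neg_abs_le (cX y)) (mul_nonneg hb hs.le)
      rw [eX, eT]
      nlinarith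
    have hwX : |cX (γ τ)| ≤ S.s * cT (γ τ) := by rw [abs_of_nonneg hXpos, hw']
    have hwY : |cY (γ τ)| ≤ S.t * cT (γ τ) := by
      rw [abs_of_nonneg hXpos, hw'] at hQ
      have := S.one_lt_sq
      refine le_of_mul_le_mul_left ?_ ht
      nlinarith
    have hmem : γ τ ∈ S.oct := ⟨hwX, hwY, hQ⟩
    -- `trA` after `reflX` is the reflection in the right wall, so it fixes the crossing point.
    have hinv : γ τ = S.trA (reflX (γ τ)) := by
      refine ext_coords ?_ ?_
      · rw [trA, cX_boostX, cX_reflX, cT_reflX]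
        linear_combination (1 + Real.cosh (2 * S.p)) * hw' - cT (γ τ) * S.sinh_two_p
      · rw [cY_trA, cY_reflX]
    refine ⟨γ τ, hmem, reflX (γ τ), S.reflX_mem_oct.2 hmem, hinv, ?_⟩
    have d1 := hd 0 ⟨le_rfl, zero_le_one⟩ τ hτ
    have d2 := hd τ hτ 1 ⟨zero_le_one, le_rfl⟩
    rw [h0, zero_sub, abs_neg, abs_of_nonneg hτ.1] at d1
    rw [h1, abs_sub_comm, abs_of_nonneg (sub_nonneg.2 hτ.2), hinv, S.trA.dist_eq] at d2
    rw [d1, d2]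
    ring
  · rintro S x y g ⟨w, hw, w', hw', e, h⟩
    refine ⟨w', hw', w, hw, by rw [e, IsometryEquiv.inv_apply_self], ?_⟩
    rw [dist_inv_apply, h, dist_comm x w, dist_comm w' y, add_comm]
  · rintro S x y ⟨w, hw, w', hw', e, h⟩
    refine ⟨swapXY w, ?_, swapXY w', ?_, ?_, ?_⟩
    · rwa [← S.swapXY_mem_oct, swapXY_swapXY]
    · rwa [← S.swapXY_mem_oct, swapXY_swapXY]
    · rw [trB_apply, swapXY_swapXY, e]
    · rw [dist_trB, h, ← swapXY.dist_eq x, ← swapXY.dist_eq _ y, swapXY_swapXY, swapXY_swapXY]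

end Shape

/-! ### Folding -/

/-- The folding of the hyperbolic plane onto a quadrant. -/
def fold (z : ℍ) : ℍ := ofCoords |cX z| |cY z|

@[simp] theorem cX_fold (z : ℍ) : cX (fold z) = |cX z| := cX_ofCoords _ _
@[simp] theorem cY_fold (z : ℍ) : cY (fold z) = |cY z| := cY_ofCoords _ _
@[simp] theorem cT_fold (z : ℍ) : cT (fold z) = cT z :=
  cT_ofCoords (cT_pos z).le (by rw [sq_abs, sq_abs, cT_sq])

/-- Absolute values leave `cT` unchanged and can only increase the spacelike products, which enter
`cosh` of the distance with a minus sign. -/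
theorem dist_fold_le (z w : ℍ) : dist (fold z) (fold w) ≤ dist z w := by
  refine dist_le_dist_of_cosh ?_
  rw [cosh_dist_eq, cosh_dist_eq]
  simp only [cX_fold, cY_fold, cT_fold, ← abs_mul]
  linarith [le_abs_self (cX z * cX w), le_abs_self (cY z * cY w)]

theorem dist_fold_eq {z w : ℍ} (hX : 0 ≤ cX z * cX w) (hY : 0 ≤ cY z * cY w) :
    dist (fold z) (fold w) = dist z w := by
  have := dist_eq_of_cosh (z := fold z) (w := fold w) (a := dist z w) (by
    rw [cosh_dist_eq, cosh_dist_eq]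
    simp only [cX_fold, cY_fold, cT_fold, ← abs_mul, abs_of_nonneg hX, abs_of_nonneg hY])
  rwa [abs_of_nonneg dist_nonneg] at this

namespace Shape

variable (S : Shape)

/-- `trA y` is the mirror image of `reflX y` in the right wall, and `x` and `reflX y` are on the
same side of it. Hence `x` is at least as close to `reflX y`, which has the same fold as `y`. -/
theorem dist_fold_le_dist_gluing {x y : ℍ} (hx : x ∈ S.oct) (hy : y ∈ S.oct) {g : ℍ ≃ᵢ ℍ}
    (hg : g ∈ S.gluing.G) : dist (fold x) (fold y) ≤ dist x (g y) := by
  refine gluing_induction (P := fun _ x y g => dist (fold x) (fold y) ≤ dist x (g y))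
    ?_ ?_ ?_ ?_ S hx hy hg
  · intro S x y _ _
    exact dist_fold_le x y
  · intro S x y hx hy
    have h1 : dist (fold x) (fold y) ≤ dist x (reflX y) := by
      have : fold y = fold (reflX y) := ext_coords (by simp) (by simp)
      rw [this]
      exact dist_fold_le x _
    refine h1.trans (dist_le_dist_of_cosh ?_)
    rw [cosh_dist_eq, cosh_dist_eq, cX_reflX, cY_reflX, cT_reflX, cY_trA, trA, cX_boostX, cT_boostX]
    have h2 : 0 ≤ (1 + Real.cosh (2 * S.p)) * ((S.s * cT x - cX x) * (S.s * cT y + cX y)) := by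
      have := abs_le.1 hx.1
      have := abs_le.1 hy.1
      have := Real.cosh_pos (2 * S.p)
      exact mul_nonneg (by linarith) (mul_nonneg (by linarith) (by linarith))
    rw [← sub_nonneg]
    refine h2.trans (le_of_eq ?_)
    linear_combination (S.s * cT x * cT y - (cX x * cT y - cT x * cX y)) * (-S.sinh_two_p) -
      cT x * cT y * S.cosh_two_p
  · intro S x y g h
    rwa [dist_inv_apply, dist_comm]
  · intro S x y h
    rw [dist_trB]
    refine le_trans (le_of_eq ?_) h
    rw [← swapXY.dist_eq]
    congr 1 <;> exact ext_coords (by simp) (by simp)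

theorem dist_fold_le_dist_proj (x y : S.gluing.dom) :
    dist (fold x.1) (fold y.1) ≤ dist (S.gluing.proj x) (S.gluing.proj y) :=
  S.gluing.le_dist_proj (fun x y => dist (fold x.1) (fold y.1)) (fun _ _ _ => dist_triangle _ _ _)
    (fun x y _ hg => S.dist_fold_le_dist_gluing x.2 y.2 hg) x y

/-- Inside a quadrant of the octagon, the glued distance is the hyperbolic distance. -/
theorem dist_proj_eq {x y : S.gluing.dom} (hX : 0 ≤ cX x.1 * cX y.1) (hY : 0 ≤ cY x.1 * cY y.1) :
    dist (S.gluing.proj x) (S.gluing.proj y) = dist x.1 y.1 :=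
  le_antisymm (S.gluing.dist_proj_le_dist x y)
    ((dist_fold_eq hX hY).ge.trans (S.dist_fold_le_dist_proj x y))

/-! ### The length structure -/

theorem exists_path_of_oct (x y : S.gluing.dom) :
    ∃ γ : Path (S.gluing.proj x) (S.gluing.proj y),
      pathLength γ ≤ ENNReal.ofReal (dist x.1 y.1) := by
  obtain ⟨γ, h0, h1, hd, hm⟩ := S.exists_geodesic_oct x.2 y.2
  have hL : LipschitzWith (Real.toNNReal (dist x.1 y.1))
      fun τ : unitInterval => S.gluing.proj ⟨γ τ, hm τ τ.2⟩ := by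
    refine LipschitzWith.of_dist_le_mul fun σ τ => ?_
    refine (S.gluing.dist_proj_le_dist _ _).trans (le_of_eq ?_)
    rw [hd σ σ.2 τ τ.2, Real.coe_toNNReal _ dist_nonneg, mul_comm, Subtype.dist_eq, Real.dist_eq]
  refine ⟨⟨⟨_, hL.continuous⟩, ?_, ?_⟩, ?_⟩
  · simp [h0]
  · simp [h1]
  · have := hL.lipschitzOnWith (s := Set.univ)
    have h2 := this.comp_eVariationOn_le (g := fun τ : unitInterval => τ) (s := Set.univ)
      (Set.mapsTo_univ _ _)
    refine h2.trans ?_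
    have h3 : eVariationOn (fun τ : unitInterval => τ) Set.univ ≤ 1 := by
      have : eVariationOn (fun τ : unitInterval => τ) Set.univ
          = eVariationOn (fun τ : unitInterval => (τ : ℝ)) Set.univ := rfl
      rw [this]
      have hmono : MonotoneOn (fun τ : unitInterval => (τ : ℝ)) Set.univ := fun a _ b _ h => h
      have h4 := hmono.eVariationOn_eq (Set.mem_univ 0) (Set.mem_univ 1)
      have hu : (Set.univ : Set unitInterval) ∩ Set.Icc 0 1 = Set.univ :=
        Set.inter_eq_left.2 fun a _ => ⟨unitInterval.nonneg', unitInterval.le_one'⟩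
      rw [hu] at h4
      simpa using h4.le
    calc _ ≤ (Real.toNNReal (dist x.1 y.1) : ℝ≥0∞) * 1 := by gcongr
      _ = _ := by rw [mul_one]; rfl

theorem exists_path_of_gluing (x y : S.gluing.dom) (g : ℍ ≃ᵢ ℍ) (hg : g ∈ S.gluing.G) :
    ∃ γ : Path (S.gluing.proj x) (S.gluing.proj y),
      pathLength γ ≤ ENNReal.ofReal (dist x.1 (g y.1)) := by
  obtain ⟨w, hw, w', hw', e, h⟩ := S.exists_crossing x.2 y.2 hg
  obtain ⟨γ, hγ⟩ := S.exists_path_of_oct x ⟨w, hw⟩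
  obtain ⟨γ', hlen⟩ := S.exists_path_of_oct ⟨w', hw'⟩ y
  have he : S.gluing.proj ⟨w, hw⟩ = S.gluing.proj ⟨w', hw'⟩ :=
    S.gluing.proj_eq_iff.2 ⟨g, hg, e⟩
  refine ⟨γ.trans (γ'.cast he rfl), (pathLength_trans_le _ _).trans ?_⟩
  rw [h, ENNReal.ofReal_add dist_nonneg dist_nonneg]
  exact add_le_add hγ hlen

/-! ### The local structure -/

/-- The union of the octagon and its neighbours. -/
def star : Set ℍ := {u | ∃ g ∈ S.gluing.G, ∃ y ∈ S.gluing.dom, g y = u}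

/-- The quadrilateral bounded by the four boundary geodesics. -/
def diamond : Set ℍ := {z | S.s * |cX z| + S.t * |cY z| ≤ cT z}

theorem mem_star_iff (u : ℍ) : u ∈ S.star ↔ u ∈ S.oct ∨ ∃ i, (S.pairing i)⁻¹ u ∈ S.oct := by
  constructor
  · rintro ⟨g, rfl | ⟨i, rfl⟩, y, hy, rfl⟩
    · exact Or.inl hy
    · exact Or.inr ⟨i, by rwa [IsometryEquiv.inv_apply_self]⟩
  · rintro (h | ⟨i, h⟩)
    · exact ⟨1, Or.inl rfl, u, h, rfl⟩
    · exact ⟨_, Or.inr ⟨i, rfl⟩, _, h, IsometryEquiv.apply_inv_self _ _⟩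

theorem gap_nonpos {i : Bool × Bool} {u : ℍ} (h : (S.pairing i)⁻¹ u ∈ S.oct) : S.gap i u ≤ 0 := by
  have h1 := S.gap_pairing i ((S.pairing i)⁻¹ u)
  have h2 := S.gap_nonneg (opp i) h
  rw [IsometryEquiv.apply_inv_self] at h1
  linarith

theorem mem_oct_of_mem_star {u : ℍ} (hu : u ∈ S.star) (hX : |cX u| < S.s * cT u)
    (hY : |cY u| < S.t * cT u) : u ∈ S.oct := by
  rcases (S.mem_star_iff u).1 hu with h | ⟨i, h⟩
  · exact h
  · exfalso
    have h1 := S.gap_nonpos h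
    have := abs_lt.1 hX
    have := abs_lt.1 hY
    rcases i with ⟨_ | _, _ | _⟩ <;> simp only [gap] at h1 <;> linarith

theorem reflX_trA (z : ℍ) : reflX (S.trA (reflX z)) = S.trA⁻¹ z := by
  rw [trA, boostX_inv]
  refine ext_coords ?_ ?_
  · simp only [cX_reflX, cX_boostX, cT_reflX, Real.cosh_neg, Real.sinh_neg]
    ring
  · simp

theorem reflX_reflX (z : ℍ) : reflX (reflX z) = z := ext_coords (by simp) (by simp)

theorem reflX_trB (z : ℍ) : reflX (S.trB (reflX z)) = S.trB z := by
  rw [trB]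
  exact ext_coords (by simp) (by simp)

theorem trA_inv_reflX (z : ℍ) : S.trA⁻¹ (reflX z) = reflX (S.trA z) := by
  rw [← reflX_trA, reflX_reflX]

theorem trA_reflX (z : ℍ) : S.trA (reflX z) = reflX (S.trA⁻¹ z) := by
  rw [← reflX_trA, reflX_reflX]

theorem trB_inv_reflX (z : ℍ) : S.trB⁻¹ (reflX z) = reflX (S.trB⁻¹ z) := by
  apply S.trB.injective
  rw [IsometryEquiv.apply_inv_self]
  have := S.reflX_trB (S.trB⁻¹ z)
  rw [← reflX_reflX (S.trB _), this, IsometryEquiv.apply_inv_self]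

theorem trB_reflX (z : ℍ) : S.trB (reflX z) = reflX (S.trB z) := by
  rw [← reflX_trB, reflX_reflX]

theorem reflX_mem_star {u : ℍ} : reflX u ∈ S.star ↔ u ∈ S.star := by
  have h : ∀ u, u ∈ S.star → reflX u ∈ S.star := by
    intro u hu
    rw [mem_star_iff] at hu ⊢
    rcases hu with hu | ⟨⟨_ | _, _ | _⟩, hi⟩
    · exact Or.inl (S.reflX_mem_oct.2 hu)
    · refine Or.inr ⟨(false, true), ?_⟩
      simp only [pairing, inv_inv] at hi ⊢
      rwa [trA_inv_reflX, reflX_mem_oct]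
    · refine Or.inr ⟨(false, false), ?_⟩
      simp only [pairing, inv_inv] at hi ⊢
      rwa [trA_reflX, reflX_mem_oct]
    · refine Or.inr ⟨(true, false), ?_⟩
      simp only [pairing, inv_inv] at hi ⊢
      rwa [trB_reflX, reflX_mem_oct]
    · refine Or.inr ⟨(true, true), ?_⟩
      simp only [pairing] at hi ⊢
      rwa [trB_inv_reflX, reflX_mem_oct]
  refine ⟨fun hu => ?_, h u⟩
  rw [← reflX_reflX u]
  exact h _ hu

theorem swap_swap : S.swap.swap = S := rfl

theorem swapXY_mem_star {u : ℍ} : swapXY u ∈ S.swap.star ↔ u ∈ S.star := by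
  have h : ∀ S : Shape, ∀ u, u ∈ S.star → swapXY u ∈ S.swap.star := by
    rintro S u ⟨g, hg, y, hy, rfl⟩
    have key : ∃ g' ∈ S.swap.gluing.G, ∀ z, swapXY (g z) = g' (swapXY z) := by
      have eA : ∀ z, swapXY (S.trA z) = S.swap.trB (swapXY z) := fun z => by
        rw [trB_apply, swapXY_swapXY]
        rfl
      have eB : ∀ z, swapXY (S.trB z) = S.swap.trA (swapXY z) := fun z => by
        rw [trB_apply, swapXY_swapXY]
      rcases hg with rfl | ⟨⟨_ | _, _ | _⟩, rfl⟩
      · exact ⟨1, Or.inl rfl, fun z => rfl⟩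
      · refine ⟨_, Or.inr ⟨(true, false), rfl⟩, fun z => ?_⟩
        apply S.swap.trB.injective
        simp only [pairing]
        rw [IsometryEquiv.apply_inv_self, ← eA, IsometryEquiv.apply_inv_self]
      · exact ⟨_, Or.inr ⟨(true, true), rfl⟩, eA⟩
      · refine ⟨_, Or.inr ⟨(false, false), rfl⟩, fun z => ?_⟩
        apply S.swap.trA.injective
        simp only [pairing]
        rw [IsometryEquiv.apply_inv_self, ← eB, IsometryEquiv.apply_inv_self]
      · exact ⟨_, Or.inr ⟨(false, true), rfl⟩, eB⟩
    obtain ⟨g', hg', e⟩ := key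
    exact ⟨g', hg', swapXY y, S.swapXY_mem_oct.2 hy, (e y).symm⟩
  refine ⟨fun hu => ?_, h S u⟩
  have := h S.swap _ hu
  rwa [swapXY_swapXY, swap_swap] at this

theorem reflX_mem_diamond {u : ℍ} : reflX u ∈ S.diamond ↔ u ∈ S.diamond := by
  simp [diamond]

theorem swapXY_mem_diamond {u : ℍ} : swapXY u ∈ S.swap.diamond ↔ u ∈ S.diamond := by
  simp only [diamond, Set.mem_ofPred_eq, cX_swapXY, cY_swapXY, cT_swapXY, swap_s, swap_t]
  rw [add_comm]

/-- On a vertical wall the boundary inequality leaves `t * |cY| ≤ (1 - s ^ 2) * cT < t ^ 2 * cT`. -/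
theorem wall_lt {x : ℍ} (hx : x ∈ S.oct) (h : |cX x| = S.s * cT x) : |cY x| < S.t * cT x := by
  have h3 := hx.2.2
  rw [h] at h3
  have := S.one_lt_sq
  have ht := S.t_pos
  have hT := cT_pos x
  refine lt_of_mul_lt_mul_left ?_ ht.le
  nlinarith

/-- Near a point of the right wall only the octagon and its translate by `trA` occur. They lie on
the two sides of the wall and share the boundary inequality, so the wall leaves no trace in their
union. -/
theorem eventually_mem_star_right {x : ℍ} (hx : x ∈ S.oct) (h : cX x = S.s * cT x) :
    ∀ᶠ u in nhds x, (u ∈ S.star ↔ u ∈ S.diamond) := by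
  have hs := S.s_pos
  have ht := S.t_pos
  have hTx := cT_pos x
  have hXx : 0 < cX x := h ▸ mul_pos hs hTx
  have hYx := S.wall_lt hx (by rw [abs_of_pos hXx, h])
  have hcA : Continuous fun u => S.trA⁻¹ u := S.trA⁻¹.continuous
  have hinv : S.trA⁻¹ x = reflX x := by
    apply S.trA.injective
    rw [IsometryEquiv.apply_inv_self]
    refine ext_coords ?_ ?_
    · rw [trA, cX_boostX, cX_reflX, cT_reflX]
      linear_combination (1 + Real.cosh (2 * S.p)) * h - cT x * S.sinh_two_p
    · rw [cY_trA, cY_reflX]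
  have c1 : ∀ᶠ u in nhds x, 0 < cX u := continuous_cX.continuousAt.eventually (lt_mem_nhds hXx)
  have c2 : ∀ᶠ u in nhds x, |cY u| < S.t * cT u :=
    (continuous_cY.abs.continuousAt.eventually_lt
      (continuous_const.mul continuous_cT).continuousAt hYx)
  have c3 : ∀ᶠ u in nhds x, cX (S.trA⁻¹ u) < 0 := by
    refine (continuous_cX.comp hcA).continuousAt.eventually (gt_mem_nhds ?_)
    simp only [Function.comp_apply, hinv, cX_reflX]
    linarith
  have c4 : ∀ᶠ u in nhds x, |cY (S.trA⁻¹ u)| < S.t * cT (S.trA⁻¹ u) := by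
    refine (continuous_cY.comp hcA).abs.continuousAt.eventually_lt
      (continuous_const.mul (continuous_cT.comp hcA)).continuousAt ?_
    simpa only [Function.comp_apply, hinv, cY_reflX, cT_reflX] using hYx
  filter_upwards [c1, c2, c3, c4] with u h1 h2 h3 h4
  have e1 := S.cX_sub_trA (S.trA⁻¹ u)
  have e2 := S.cT_sub_trA (S.trA⁻¹ u)
  have e3 := S.cY_trA (S.trA⁻¹ u)
  rw [IsometryEquiv.apply_inv_self] at e1 e2 e3
  constructor
  · intro hu
    have h2' := abs_lt.1 h2
    rcases (S.mem_star_iff u).1 hu with h | ⟨⟨_ | _, _ | _⟩, hi⟩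
    · exact h.2.2
    · have := S.gap_nonpos hi
      simp only [gap] at this
      linarith [mul_pos hs (cT_pos u)]
    · have k := hi.2.2
      simp only [pairing] at k
      rw [← e3, abs_of_neg h3] at k
      show S.s * |cX u| + S.t * |cY u| ≤ cT u
      rw [abs_of_pos h1]
      linarith
    · have := S.gap_nonpos hi
      simp only [gap] at this
      linarith
    · have := S.gap_nonpos hi
      simp only [gap] at this
      linarith
  · intro hu
    have hu' : S.s * |cX u| + S.t * |cY u| ≤ cT u := hu
    rw [mem_star_iff]
    rcases le_or_gt (cX u) (S.s * cT u) with hle | hgt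
    · exact Or.inl ⟨by rwa [abs_of_pos h1], h2.le, hu'⟩
    · refine Or.inr ⟨(false, true), ?_, h4.le, ?_⟩
      · simp only [pairing]
        rw [abs_of_neg h3]
        linarith
      · simp only [pairing]
        rw [← e3, abs_of_neg h3]
        rw [abs_of_pos h1] at hu'
        linarith

theorem eventually_mem_star_of_abs_cX_eq {x : ℍ} (hx : x ∈ S.oct) (h : |cX x| = S.s * cT x) :
    ∀ᶠ u in nhds x, (u ∈ S.star ↔ u ∈ S.diamond) := by
  rcases abs_cases (cX x) with ⟨h1, -⟩ | ⟨h1, -⟩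
  · exact S.eventually_mem_star_right hx (h1 ▸ h)
  · have := S.eventually_mem_star_right (S.reflX_mem_oct.2 hx) (by
      rw [cX_reflX, cT_reflX, ← h, h1])
    have hc : Filter.Tendsto (fun u => reflX u) (nhds x) (nhds (reflX x)) :=
      reflX.continuous.continuousAt
    filter_upwards [hc.eventually this] with u hu
    rwa [reflX_mem_star, reflX_mem_diamond] at hu

/-- Locally only the boundary geodesics bound the glued surface; the octagon's vertices become
ordinary boundary points. -/
theorem eventually_mem_star {x : ℍ} (hx : x ∈ S.oct) :
    ∀ᶠ u in nhds x, (u ∈ S.star ↔ u ∈ S.diamond) := by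
  rcases eq_or_lt_of_le hx.1 with h | h
  · exact S.eventually_mem_star_of_abs_cX_eq hx h
  rcases eq_or_lt_of_le hx.2.1 with h' | h'
  · have := S.swap.eventually_mem_star_of_abs_cX_eq (S.swapXY_mem_oct.2 hx)
      (by rw [cX_swapXY, cT_swapXY, h', swap_s])
    have hc : Filter.Tendsto (fun u => swapXY u) (nhds x) (nhds (swapXY x)) :=
      swapXY.continuous.continuousAt
    filter_upwards [hc.eventually this] with u hu
    rwa [swapXY_mem_star, swapXY_mem_diamond] at hu
  · have c1 : ∀ᶠ u in nhds x, |cX u| < S.s * cT u :=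
      continuous_cX.abs.continuousAt.eventually_lt
        (continuous_const.mul continuous_cT).continuousAt h
    have c2 : ∀ᶠ u in nhds x, |cY u| < S.t * cT u :=
      continuous_cY.abs.continuousAt.eventually_lt
        (continuous_const.mul continuous_cT).continuousAt h'
    filter_upwards [c1, c2] with u h1 h2
    exact ⟨fun hu => (S.mem_oct_of_mem_star hu h1 h2).2.2,
      fun hu => (S.mem_star_iff u).2 (Or.inl ⟨h1.le, h2.le, hu⟩)⟩

theorem isModeledAt_proj (x : S.gluing.dom) {M : Set ℍ} (k : ℍ ≃ᵢ ℍ)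
    (hk : k x.1 = UpperHalfPlane.I)
    (hM : ∀ᶠ u in nhds x.1, (u ∈ S.diamond ↔ k u ∈ M)) : IsModeledAt M (S.gluing.proj x) := by
  obtain ⟨r₀, hr₀, hr⟩ := Metric.eventually_nhds_iff_ball.1 ((S.eventually_mem_star x.2).and hM)
  have hε := S.gluing.ε_pos
  set r := min r₀ (S.gluing.ε / 4)
  have hr1 : r ≤ r₀ := min_le_left _ _
  have hr2 : r ≤ S.gluing.ε / 4 := min_le_right _ _
  have hrpos : 0 < r := lt_min hr₀ (by linarith)
  obtain ⟨φ, h0, hiso, him⟩ := S.gluing.exists_chart x (r := r) (by linarith) hrpos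
  refine ⟨r, hrpos, fun y => k (φ y), by simp only [h0, hk], fun y hy z hz => ?_, ?_⟩
  · rw [k.dist_eq, hiso y hy z hz]
  · rw [← Set.image_image k φ, him]
    ext v
    obtain ⟨u, rfl⟩ := k.surjective v
    rw [k.injective.mem_set_image, ← hk]
    have hb : k u ∈ Metric.ball (k x.1) r ↔ u ∈ Metric.ball x.1 r := by
      rw [Metric.mem_ball, Metric.mem_ball, k.dist_eq]
    rw [Set.mem_inter_iff, Set.mem_inter_iff, hb]
    refine and_congr_right fun hu => ?_
    have := hr u (Metric.ball_subset_ball hr1 hu)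
    exact this.1.trans this.2

/-! ### Moving points and geodesics to standard position -/

theorem boostY_eq_I {z : ℍ} (hz : cX z = 0) :
    boostY (-Real.arsinh (cY z)) z = UpperHalfPlane.I := by
  have h := cT_sq z
  rw [hz, zero_pow two_ne_zero, add_zero] at h
  refine ext_coords (by simp [hz]) ?_
  rw [cY_boostY, cY_I, Real.cosh_neg, Real.sinh_neg, Real.cosh_arsinh, Real.sinh_arsinh, ← h,
    Real.sqrt_sq (cT_pos z).le]
  ring

theorem exists_apply_eq_I (z : ℍ) : ∃ k : ℍ ≃ᵢ ℍ, k z = UpperHalfPlane.I := by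
  have h1 : cX z / cT z ∈ Set.Ioo (-1 : ℝ) 1 := by
    have := abs_lt.1 (abs_cX_lt_cT z)
    have hT := cT_pos z
    exact ⟨by rw [lt_div_iff₀ hT]; linarith, by rw [div_lt_iff₀ hT]; linarith⟩
  set a := Real.artanh (cX z / cT z)
  have ha : Real.sinh a * cT z = Real.cosh a * cX z := by
    have := Real.tanh_artanh h1
    rw [Real.tanh_eq_sinh_div_cosh, div_eq_div_iff (Real.cosh_pos _).ne' (cT_pos z).ne'] at this
    linarith
  have h0 : cX (boostX (-a) z) = 0 := by
    rw [cX_boostX, Real.cosh_neg, Real.sinh_neg]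
    linarith
  refine ⟨(boostX (-a)).trans (boostY (-Real.arsinh (cY (boostX (-a) z)))), ?_⟩
  rw [IsometryEquiv.trans_apply, boostY_eq_I h0]

/-- Rotate the direction `(s, t)` to the first axis, where the geodesic becomes `R * cX = cT` with
`R > 1`, and translate by `artanh (1 / R)` to bring it to `cX = 0`. Slide the point to `i`, then
turn by a right angle so that the correct side becomes `halfPlane`. -/
theorem exists_apply_eq_I_halfPlane {z : ℍ} (hz : S.s * cX z + S.t * cY z = cT z) :
    ∃ k : ℍ ≃ᵢ ℍ, k z = UpperHalfPlane.I ∧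
      ∀ u, k u ∈ halfPlane ↔ S.s * cX u + S.t * cY u ≤ cT u := by
  let w : ℂ := ⟨S.s, S.t⟩
  have hw0 : w ≠ 0 := fun h => S.s_pos.ne' (congrArg Complex.re h)
  set R := ‖w‖
  have hR2 : R ^ 2 = S.s ^ 2 + S.t ^ 2 := by
    rw [Complex.sq_norm, Complex.normSq_apply]
    simp only [w]
    ring
  have hR : 1 < R := by
    have := S.one_lt_sq
    nlinarith [norm_nonneg w]
  have hcos : Real.cos w.arg = S.s / R := Complex.cos_arg hw0
  have hsin : Real.sin w.arg = S.t / R := Complex.sin_arg w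
  have h1 : 1 / R ∈ Set.Ioo (-1 : ℝ) 1 :=
    ⟨by have : 0 < 1 / R := by positivity
        linarith, by rw [div_lt_one (by linarith)]; exact hR⟩
  set a := Real.artanh (1 / R)
  have hc := Real.cosh_pos a
  have ha : Real.sinh a = Real.cosh a / R := by
    have := Real.tanh_artanh h1
    rw [Real.tanh_eq_sinh_div_cosh, div_eq_iff hc.ne'] at this
    rw [this]
    ring
  have hR0 : R ≠ 0 := by positivity
  obtain ⟨k₀, hk₀⟩ : ∃ k₀ : ℍ ≃ᵢ ℍ, ∀ u, cX (k₀ u) =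
      Real.cosh a / R * (S.s * cX u + S.t * cY u - cT u) := by
    refine ⟨(rotXY (-w.arg)).trans (boostX (-a)), fun u => ?_⟩
    rw [IsometryEquiv.trans_apply, cX_boostX, cX_rotXY, cT_rotXY, Real.cos_neg, Real.sin_neg,
      Real.cosh_neg, Real.sinh_neg,
      hcos, hsin, ha]
    field_simp
    ring
  have hz0 : cX (k₀ z) = 0 := by rw [hk₀, hz, sub_self, mul_zero]
  refine ⟨(k₀.trans (boostY (-Real.arsinh (cY (k₀ z))))).trans (rotXY (-(Real.pi / 2))), ?_, ?_⟩
  · rw [IsometryEquiv.trans_apply, IsometryEquiv.trans_apply, boostY_eq_I hz0]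
    exact ext_coords (by simp) (by simp)
  · intro u
    rw [IsometryEquiv.trans_apply, IsometryEquiv.trans_apply, mem_halfPlane_iff,
      cY_rotXY, cX_boostY, Real.sin_neg, Real.cos_neg, Real.sin_pi_div_two,
      Real.cos_pi_div_two, hk₀]
    have : 0 < Real.cosh a / R := by positivity
    rw [zero_mul, add_zero, neg_one_mul, neg_nonneg]
    rw [← sub_nonpos (a := S.s * cX u + S.t * cY u)]
    constructor
    · intro h
      by_contra h'
      linarith [mul_pos this (not_le.1 h')]
    · exact fun h => mul_nonpos_of_nonneg_of_nonpos this.le h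

theorem isModeledAt_of_lt (x : S.gluing.dom)
    (hx : S.s * |cX x.1| + S.t * |cY x.1| < cT x.1) : IsModeledAt Set.univ (S.gluing.proj x) := by
  obtain ⟨k, hk⟩ := exists_apply_eq_I x.1
  refine S.isModeledAt_proj x k hk ?_
  have : ∀ᶠ u in nhds x.1, S.s * |cX u| + S.t * |cY u| < cT u :=
    ((continuous_const.mul continuous_cX.abs).add
      (continuous_const.mul continuous_cY.abs)).continuousAt.eventually_lt
      continuous_cT.continuousAt hx
  filter_upwards [this] with u hu
  exact ⟨fun _ => Set.mem_univ _, fun _ => hu.le⟩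

/-- An isometry composed of reflections in the axes that moves a point into the first quadrant. -/
theorem exists_reflection (z : ℍ) : ∃ k : ℍ ≃ᵢ ℍ, ∃ a b : ℝ, |a| = 1 ∧ |b| = 1 ∧
    (∀ u, cX (k u) = a * cX u) ∧ (∀ u, cY (k u) = b * cY u) ∧ (∀ u, cT (k u) = cT u) ∧
    a * cX z = |cX z| ∧ b * cY z = |cY z| := by
  rcases abs_cases (cX z) with ⟨h1, -⟩ | ⟨h1, -⟩ <;> rcases abs_cases (cY z) with ⟨h2, -⟩ | ⟨h2, -⟩
  · exact ⟨1, 1, 1, by simp, by simp, by simp, by simp, by simp, by simp [h1], by simp [h2]⟩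
  · exact ⟨reflY, 1, -1, by simp, by simp, by simp, by simp, by simp, by simp [h1], by simp [h2]⟩
  · exact ⟨reflX, -1, 1, by simp, by simp, by simp, by simp, by simp, by simp [h1], by simp [h2]⟩
  · exact ⟨reflX * reflY, -1, -1, by simp, by simp, by simp, by simp, by simp, by simp [h1],
      by simp [h2]⟩

theorem isModeledAt_of_eq (x : S.gluing.dom)
    (hx : S.s * |cX x.1| + S.t * |cY x.1| = cT x.1) : IsModeledAt halfPlane (S.gluing.proj x) := by
  obtain ⟨k, a, b, ha, hb, hX, hY, hT, hax, hby⟩ := exists_reflection x.1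
  obtain ⟨k', hk', hh⟩ := S.exists_apply_eq_I_halfPlane (z := k x.1) (by
    rw [hX, hY, hT, hax, hby, hx])
  have hs := S.s_pos
  have ht := S.t_pos
  have hT0 := cT_pos x.1
  have hmem := x.2
  -- A boundary point cannot lie on an axis: there the left side of `hx` would be at most `t ^ 2 *
  -- cT < cT`. So the absolute values have constant signs nearby.
  have hX0 : 0 < a * cX x.1 := by
    rw [hax]
    have h1 : |cY x.1| ≤ S.t * cT x.1 := hmem.2.1
    have := S.t_lt_one
    by_contra h0
    have h0' : |cX x.1| ≤ 0 := not_lt.1 h0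
    have h2 : S.t * |cY x.1| ≤ S.t * (S.t * cT x.1) := mul_le_mul_of_nonneg_left h1 ht.le
    have h3 : S.s * |cX x.1| ≤ 0 := mul_nonpos_of_nonneg_of_nonpos hs.le h0'
    have h4 : S.t * S.t < 1 := by nlinarith
    nlinarith
  have hY0 : 0 < b * cY x.1 := by
    rw [hby]
    have h1 : |cX x.1| ≤ S.s * cT x.1 := hmem.1
    have := S.s_lt_one
    by_contra h0
    have h0' : |cY x.1| ≤ 0 := not_lt.1 h0
    have h2 : S.s * |cX x.1| ≤ S.s * (S.s * cT x.1) := mul_le_mul_of_nonneg_left h1 hs.le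
    have h3 : S.t * |cY x.1| ≤ 0 := mul_nonpos_of_nonneg_of_nonpos ht.le h0'
    have h4 : S.s * S.s < 1 := by nlinarith
    nlinarith
  refine S.isModeledAt_proj x (k.trans k') hk' ?_
  have c1 : ∀ᶠ u in nhds x.1, 0 < a * cX u :=
    (continuous_const.mul continuous_cX).continuousAt.eventually (lt_mem_nhds hX0)
  have c2 : ∀ᶠ u in nhds x.1, 0 < b * cY u :=
    (continuous_const.mul continuous_cY).continuousAt.eventually (lt_mem_nhds hY0)
  filter_upwards [c1, c2] with u h1 h2
  have e1 : |cX u| = a * cX u := by rw [← abs_of_pos h1, abs_mul, ha, one_mul]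
  have e2 : |cY u| = b * cY u := by rw [← abs_of_pos h2, abs_mul, hb, one_mul]
  show _ ↔ k' (k u) ∈ halfPlane
  rw [hh, hX, hY, hT, ← e1, ← e2]
  rfl

end Shape

/-! ### Klein coordinates -/

/-- The point of the upper half-plane with given coordinates in the Klein model. -/
def klein (v : ℝ × ℝ) : ℍ :=
  ofCoords (v.1 / √(1 - v.1 ^ 2 - v.2 ^ 2)) (v.2 / √(1 - v.1 ^ 2 - v.2 ^ 2))

theorem cT_klein {v : ℝ × ℝ} (h : v.1 ^ 2 + v.2 ^ 2 < 1) :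
    cT (klein v) = 1 / √(1 - v.1 ^ 2 - v.2 ^ 2) := by
  have h0 : 0 < 1 - v.1 ^ 2 - v.2 ^ 2 := by linarith
  refine cT_ofCoords (by positivity) ?_
  rw [div_pow, div_pow, div_pow, Real.sq_sqrt h0.le]
  field_simp
  ring

theorem cX_klein {v : ℝ × ℝ} (h : v.1 ^ 2 + v.2 ^ 2 < 1) :
    cX (klein v) = v.1 * cT (klein v) := by
  rw [cT_klein h, klein, cX_ofCoords]
  ring

theorem cY_klein {v : ℝ × ℝ} (h : v.1 ^ 2 + v.2 ^ 2 < 1) :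
    cY (klein v) = v.2 * cT (klein v) := by
  rw [cT_klein h, klein, cY_ofCoords]
  ring

theorem klein_coords (z : ℍ) : klein (cX z / cT z, cY z / cT z) = z := by
  have hT := cT_pos z
  have h : 1 - (cX z / cT z) ^ 2 - (cY z / cT z) ^ 2 = (1 / cT z) ^ 2 := by
    field_simp
    linear_combination cT_sq z
  refine ext_coords ?_ ?_
  · rw [klein, cX_ofCoords]
    simp only [h]
    rw [Real.sqrt_sq (by positivity)]
    field_simp
  · rw [klein, cY_ofCoords]
    simp only [h]
    rw [Real.sqrt_sq (by positivity)]
    field_simp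

theorem continuousOn_klein : ContinuousOn klein {v | v.1 ^ 2 + v.2 ^ 2 < 1} := by
  have h : ContinuousOn (fun v : ℝ × ℝ => √(1 - v.1 ^ 2 - v.2 ^ 2)) {v | v.1 ^ 2 + v.2 ^ 2 < 1} := by
    fun_prop
  have h0 : ∀ v ∈ {v : ℝ × ℝ | v.1 ^ 2 + v.2 ^ 2 < 1}, √(1 - v.1 ^ 2 - v.2 ^ 2) ≠ 0 := by
    intro v hv
    have hv' : v.1 ^ 2 + v.2 ^ 2 < 1 := hv
    exact (Real.sqrt_pos.2 (by linarith)).ne'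
  exact continuous_ofCoords.comp_continuousOn
    ((continuous_fst.continuousOn.div h h0).prodMk (continuous_snd.continuousOn.div h h0))

theorem klein_injOn : Set.InjOn klein {v | v.1 ^ 2 + v.2 ^ 2 < 1} := by
  intro v hv w hw h
  have h1 := cX_klein hv
  have h2 := cY_klein hv
  rw [h, cX_klein hw] at h1
  rw [h, cY_klein hw] at h2
  have hT := (cT_pos (klein w)).ne'
  exact Prod.ext (mul_right_cancel₀ hT h1).symm (mul_right_cancel₀ hT h2).symm

theorem reflX_klein {v : ℝ × ℝ} : reflX (klein v) = klein (-v.1, v.2) := by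
  refine ext_coords ?_ ?_
  · simp [klein, neg_div]
  · simp [klein]

theorem reflY_klein {v : ℝ × ℝ} : reflY (klein v) = klein (v.1, -v.2) := by
  refine ext_coords ?_ ?_
  · simp [klein]
  · simp [klein, neg_div]

namespace Shape

variable (S : Shape)

/-- The octagon in Klein coordinates. -/
def kleinOct : Set (ℝ × ℝ) :=
  {v | |v.1| ≤ S.s ∧ |v.2| ≤ S.t ∧ S.s * |v.1| + S.t * |v.2| ≤ 1}

/-- For `0 < |x| < s` one has `x ^ 2 + y ^ 2 < s * |x| + t * |y| ≤ 1`. If `|x| = s`, then `t * |y| ≤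
1 - s ^ 2 < t ^ 2` gives `y ^ 2 < 1 - s ^ 2`. -/
theorem kleinOct_lt_one {v : ℝ × ℝ} (hv : v ∈ S.kleinOct) : v.1 ^ 2 + v.2 ^ 2 < 1 := by
  obtain ⟨h1, h2, h3⟩ := hv
  have hs := S.s_pos
  have ht := S.t_pos
  have hs1 := S.s_lt_one
  have ht1 := S.t_lt_one
  have hst := S.one_lt_sq
  rw [← sq_abs v.1, ← sq_abs v.2]
  have hx := abs_nonneg v.1
  have hy := abs_nonneg v.2
  generalize |v.1| = x at *
  generalize |v.2| = y at *
  rcases eq_or_lt_of_le h1 with rfl | h1'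
  · have e1 : S.t * y ≤ 1 - S.s ^ 2 := by linarith
    have e2 : 0 < 1 - S.s ^ 2 := by nlinarith
    have e3 : 1 - S.s ^ 2 < S.t ^ 2 := by linarith
    have e4 : (S.t * y) ^ 2 ≤ (1 - S.s ^ 2) ^ 2 := pow_le_pow_left₀ (by positivity) e1 2
    have e5 : S.t ^ 2 * y ^ 2 < S.t ^ 2 * (1 - S.s ^ 2) := by nlinarith
    have := lt_of_mul_lt_mul_left e5 (by positivity)
    linarith
  · rcases eq_or_lt_of_le hx with rfl | hx'
    · nlinarith
    · nlinarith [mul_lt_mul_of_pos_right h1' hx', mul_le_mul_of_nonneg_right h2 hy]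

theorem klein_mem_oct {v : ℝ × ℝ} (hv : v ∈ S.kleinOct) : klein v ∈ S.oct := by
  have h := S.kleinOct_lt_one hv
  have hT := cT_pos (klein v)
  have eX : |cX (klein v)| = |v.1| * cT (klein v) := by
    rw [cX_klein h, abs_mul, abs_of_pos hT]
  have eY : |cY (klein v)| = |v.2| * cT (klein v) := by
    rw [cY_klein h, abs_mul, abs_of_pos hT]
  obtain ⟨h1, h2, h3⟩ := hv
  refine ⟨?_, ?_, ?_⟩
  · rw [eX]
    exact mul_le_mul_of_nonneg_right h1 hT.le
  · rw [eY]
    exact mul_le_mul_of_nonneg_right h2 hT.le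
  · rw [eX, eY]
    nlinarith

theorem coords_mem_kleinOct {z : ℍ} (hz : z ∈ S.oct) : (cX z / cT z, cY z / cT z) ∈ S.kleinOct := by
  have hT := cT_pos z
  obtain ⟨h1, h2, h3⟩ := hz
  refine ⟨?_, ?_, ?_⟩ <;> simp only [abs_div, abs_of_pos hT]
  · rwa [div_le_iff₀ hT]
  · rwa [div_le_iff₀ hT]
  · rw [← mul_div_assoc, ← mul_div_assoc, ← add_div, div_le_one hT]
    exact h3

/-- The parametrization of the octagon by Klein coordinates. -/
def kleinPt (v : S.kleinOct) : S.gluing.dom := ⟨klein v.1, S.klein_mem_oct v.2⟩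

theorem continuous_kleinPt : Continuous S.kleinPt :=
  Continuous.subtype_mk (continuousOn_klein.comp_continuous continuous_subtype_val
    fun v => S.kleinOct_lt_one v.2) _

theorem kleinPt_surjective : Function.Surjective S.kleinPt := fun z =>
  ⟨⟨_, S.coords_mem_kleinOct z.2⟩, Subtype.ext (klein_coords z.1)⟩

theorem trA_reflX_eq {z : ℍ} (h : cX z = S.s * cT z) : S.trA (reflX z) = z := by
  refine ext_coords ?_ ?_
  · rw [trA, cX_boostX, cX_reflX, cT_reflX]
    linear_combination -(1 + Real.cosh (2 * S.p)) * h + cT z * S.sinh_two_p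
  · rw [cY_trA, cY_reflX]

/-- If `z = trA z'` with both points in the octagon, then `z` is on both sides of the right wall,
hence on it, where `trA` inverts `reflX`. -/
theorem eq_of_eq_gluing {z z' : ℍ} (hz : z ∈ S.oct) (hz' : z' ∈ S.oct) {g : ℍ ≃ᵢ ℍ}
    (hg : g ∈ S.gluing.G) : z = g z' → z = z' ∨ (|cX z| = S.s * cT z ∧ z' = reflX z) ∨
      (|cY z| = S.t * cT z ∧ z' = reflY z) := by
  refine gluing_induction (P := fun S z z' g => z = g z' → z = z' ∨
    (|cX z| = S.s * cT z ∧ z' = reflX z) ∨ (|cY z| = S.t * cT z ∧ z' = reflY z))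
    ?_ ?_ ?_ ?_ S hz hz' hg
  · intro S x y _ _ h
    exact Or.inl h
  · intro S x y hx hy h
    have h1 := S.cX_sub_trA y
    rw [← h] at h1
    have hX := abs_le.1 hx.1
    have hY := abs_le.1 hy.1
    have e1 : cX x = S.s * cT x := by linarith
    have e2 : 0 ≤ S.s * cT x := (mul_pos S.s_pos (cT_pos x)).le
    refine Or.inr (Or.inl ⟨by rw [e1, abs_of_nonneg e2], ?_⟩)
    apply S.trA.injective
    rw [S.trA_reflX_eq e1, ← h]
  · intro S x y g h e
    have : x = g y := by rw [e, IsometryEquiv.apply_inv_self]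
    rcases h this with h | ⟨h, h'⟩ | ⟨h, h'⟩
    · exact Or.inl h.symm
    · exact Or.inr (Or.inl ⟨by rw [h', cX_reflX, abs_neg, cT_reflX, h], by rw [h', reflX_reflX]⟩)
    · refine Or.inr (Or.inr ⟨by rw [h', cY_reflY, abs_neg, cT_reflY, h], ?_⟩)
      rw [h']
      exact ext_coords (by simp) (by simp)
  · intro S x y h e
    have e' : swapXY x = S.swap.trA (swapXY y) := by rw [e, trB_apply, swapXY_swapXY]
    rcases h e' with h | ⟨h, h'⟩ | ⟨h, h'⟩
    · exact Or.inl (swapXY.injective h)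
    · refine Or.inr (Or.inr ⟨by simpa [swap_s, swap_t] using h, swapXY.injective ?_⟩)
      rw [h']
      exact ext_coords (by simp) (by simp)
    · refine Or.inr (Or.inl ⟨by simpa [swap_s, swap_t] using h, swapXY.injective ?_⟩)
      rw [h']
      exact ext_coords (by simp) (by simp)

theorem exists_gluing_reflX {z : ℍ} (h : |cX z| = S.s * cT z) :
    ∃ g ∈ S.gluing.G, z = g (reflX z) := by
  rcases abs_cases (cX z) with ⟨h1, -⟩ | ⟨h1, -⟩
  · exact ⟨_, Or.inr ⟨(false, true), rfl⟩, (S.trA_reflX_eq (h1 ▸ h)).symm⟩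
  · refine ⟨_, Or.inr ⟨(false, false), rfl⟩, ?_⟩
    have := S.trA_reflX_eq (z := reflX z) (by rw [cX_reflX, cT_reflX, ← h, h1])
    rw [reflX_reflX] at this
    simp only [pairing]
    rw [← this, IsometryEquiv.inv_apply_self]

theorem exists_gluing_reflY {z : ℍ} (h : |cY z| = S.t * cT z) :
    ∃ g ∈ S.gluing.G, z = g (reflY z) := by
  have e : ∀ w, swapXY (reflX (swapXY w)) = reflY w := fun w => ext_coords (by simp) (by simp)
  have key : ∀ w, cY w = S.t * cT w → S.trB (reflY w) = w := fun w hw => by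
    rw [trB_apply, ← e w, swapXY_swapXY, S.swap.trA_reflX_eq (by simpa [swap_s] using hw),
      swapXY_swapXY]
  rcases abs_cases (cY z) with ⟨h1, -⟩ | ⟨h1, -⟩
  · exact ⟨_, Or.inr ⟨(true, true), rfl⟩, (key z (h1 ▸ h)).symm⟩
  · refine ⟨_, Or.inr ⟨(true, false), rfl⟩, ?_⟩
    have := key (reflY z) (by rw [cY_reflY, cT_reflY, ← h, h1])
    rw [show reflY (reflY z) = z from ext_coords (by simp) (by simp)] at this
    simp only [pairing]
    rw [← this, IsometryEquiv.inv_apply_self]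

/-- Opposite sides of the octagon are glued, and nothing else. -/
theorem proj_kleinPt_eq_iff (v w : S.kleinOct) :
    S.gluing.proj (S.kleinPt v) = S.gluing.proj (S.kleinPt w) ↔ v.1 = w.1 ∨
      (|v.1.1| = S.s ∧ w.1 = (-v.1.1, v.1.2)) ∨ (|v.1.2| = S.t ∧ w.1 = (v.1.1, -v.1.2)) := by
  have hv := S.kleinOct_lt_one v.2
  have hw := S.kleinOct_lt_one w.2
  have hT := cT_pos (klein v.1)
  have hX : |cX (klein v.1)| = S.s * cT (klein v.1) ↔ |v.1.1| = S.s := by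
    rw [cX_klein hv, abs_mul, abs_of_pos hT, mul_left_inj' hT.ne']
  have hY : |cY (klein v.1)| = S.t * cT (klein v.1) ↔ |v.1.2| = S.t := by
    rw [cY_klein hv, abs_mul, abs_of_pos hT, mul_left_inj' hT.ne']
  rw [S.gluing.proj_eq_iff]
  constructor
  · rintro ⟨g, hg, e⟩
    rcases S.eq_of_eq_gluing (S.kleinPt v).2 (S.kleinPt w).2 hg e with h | ⟨h, h'⟩ | ⟨h, h'⟩
    · exact Or.inl (klein_injOn hv hw h)
    · refine Or.inr (Or.inl ⟨hX.1 h, klein_injOn hw ?_ ?_⟩)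
      · simpa using hv
      · rw [← reflX_klein]; exact h'
    · refine Or.inr (Or.inr ⟨hY.1 h, klein_injOn hw ?_ ?_⟩)
      · simpa using hv
      · rw [← reflY_klein]; exact h'
  · rintro (h | ⟨h, h'⟩ | ⟨h, h'⟩)
    · exact ⟨1, S.gluing.one_mem, congrArg klein h⟩
    · obtain ⟨g, hg, e⟩ := S.exists_gluing_reflX (hX.2 h)
      refine ⟨g, hg, ?_⟩
      rw [reflX_klein, ← h'] at e
      exact e
    · obtain ⟨g, hg, e⟩ := S.exists_gluing_reflY (hY.2 h)
      refine ⟨g, hg, ?_⟩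
      rw [reflY_klein, ← h'] at e
      exact e

end Shape

/-! ### The profile function -/

/-- The clamp of a real number to `[-1/4, 1/4]`. -/
def clamp (u : ℝ) : ℝ := max (-(1 / 4)) (min (1 / 4) u)

/-- An odd increasing function on `[-1/2, 1/2]`, linear on `[-1/4, 1/4]` and quadratic outside. -/
def profile (a b u : ℝ) : ℝ :=
  4 * a * clamp u + b * (8 * (u - clamp u) - 16 * ((u - clamp u) * |u - clamp u|))

theorem continuous_profile (a b : ℝ) : Continuous (profile a b) := by
  unfold profile clamp
  fun_prop

theorem clamp_neg (u : ℝ) : clamp (-u) = -clamp u := by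
  unfold clamp
  rw [min_def, min_def, max_def, max_def]
  split_ifs <;> linarith

theorem profile_neg (a b u : ℝ) : profile a b (-u) = -profile a b u := by
  have : -u - clamp (-u) = -(u - clamp u) := by rw [clamp_neg]; ring
  rw [profile, this, abs_neg, clamp_neg, profile]
  ring

theorem profile_of_le {a b u : ℝ} (h0 : 0 ≤ u) (h : u ≤ 1 / 4) : profile a b u = 4 * a * u := by
  have : clamp u = u := by
    rw [clamp, min_eq_right h, max_eq_right (by linarith)]
  rw [profile, this]
  simp

theorem profile_of_ge {a b u : ℝ} (h : 1 / 4 ≤ u) :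
    profile a b u = a + b * (1 - 16 * (1 / 2 - u) ^ 2) := by
  have : clamp u = 1 / 4 := by
    rw [clamp, min_eq_left h, max_eq_right (by norm_num)]
  rw [profile, this, abs_of_nonneg (by linarith)]
  ring

theorem profile_half (a b : ℝ) : profile a b (1 / 2) = a + b := by
  rw [profile_of_ge (by norm_num)]
  ring

theorem profile_strictMonoOn {a b : ℝ} (ha : 0 < a) (hb : 0 < b) :
    StrictMonoOn (profile a b) (Set.Icc (-(1 / 2)) (1 / 2)) := by
  have hpos : StrictMonoOn (profile a b) (Set.Icc 0 (1 / 2)) := by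
    intro u hu w hw huw
    rcases le_total w (1 / 4) with h | h
    · rw [profile_of_le hu.1 (huw.le.trans h), profile_of_le hw.1 h]
      nlinarith
    · rw [profile_of_ge h]
      rcases le_total u (1 / 4) with h' | h'
      · rw [profile_of_le hu.1 h']
        have e1 : (1 / 2 - w) ^ 2 ≤ 1 / 16 := by nlinarith [hw.2]
        rcases eq_or_lt_of_le h' with rfl | h''
        · have e2 : (1 / 2 - w) ^ 2 < 1 / 16 := by nlinarith [hw.2]
          nlinarith
        · nlinarith
      · rw [profile_of_ge h']
        have : (1 / 2 - w) ^ 2 < (1 / 2 - u) ^ 2 := by nlinarith [hw.2]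
        nlinarith
  have hnn : ∀ u ∈ Set.Icc (0 : ℝ) (1 / 2), 0 ≤ profile a b u := by
    intro u hu
    have h0 : profile a b 0 = 0 := by rw [profile_of_le le_rfl (by norm_num), mul_zero]
    rw [← h0]
    exact hpos.monotoneOn ⟨le_rfl, by norm_num⟩ hu hu.1
  intro u hu w hw huw
  rcases le_or_gt 0 u with h | h
  · exact hpos ⟨h, hu.2⟩ ⟨h.trans huw.le, hw.2⟩ huw
  · have hu' : -u ∈ Set.Icc (0 : ℝ) (1 / 2) := ⟨by linarith, by linarith [hu.1]⟩
    have e : profile a b u = -profile a b (-u) := by rw [profile_neg, neg_neg]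
    rcases le_or_gt 0 w with h' | h'
    · have h1 := hnn w ⟨h', hw.2⟩
      have h2 : 0 < profile a b (-u) := by
        have h0 : profile a b 0 = 0 := by rw [profile_of_le le_rfl (by norm_num), mul_zero]
        rw [← h0]
        exact hpos ⟨le_rfl, by norm_num⟩ hu' (by linarith)
      linarith
    · have e' : profile a b w = -profile a b (-w) := by rw [profile_neg, neg_neg]
      have := hpos (a := -w) ⟨by linarith, by linarith [hw.1]⟩ hu' (by linarith)
      linarith

theorem profile_abs {a b : ℝ} (ha : 0 < a) (hb : 0 < b) {u : ℝ} (hu : |u| ≤ 1 / 2) :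
    |profile a b u| = profile a b |u| := by
  have h0 : profile a b 0 = 0 := by rw [profile_of_le le_rfl (by norm_num), mul_zero]
  have hnn : 0 ≤ profile a b |u| := by
    rw [← h0]
    exact (profile_strictMonoOn ha hb).monotoneOn ⟨by norm_num, by norm_num⟩
      ⟨by linarith [abs_nonneg u], hu⟩ (abs_nonneg u)
  rcases abs_cases u with ⟨h, -⟩ | ⟨h, -⟩
  · rw [h] at hnn ⊢
    exact abs_of_nonneg hnn
  · rw [h] at hnn ⊢
    rw [← abs_of_nonneg hnn, profile_neg, abs_neg]

theorem profile_surjOn {a b : ℝ} :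
    Set.SurjOn (profile a b) (Set.Icc (-(1 / 2)) (1 / 2)) (Set.Icc (-(a + b)) (a + b)) := by
  have := intermediate_value_Icc (show (-(1 / 2) : ℝ) ≤ 1 / 2 by norm_num)
    (continuous_profile a b).continuousOn
  rwa [profile_neg, profile_half] at this

/-! ### The one-holed torus as a quotient of a cut square -/

/-- A square with the four quarter discs about its corners removed. -/
def cutSquare : Set (ℝ × ℝ) :=
  {v | |v.1| ≤ 1 / 2 ∧ |v.2| ≤ 1 / 2 ∧
    (1 / 4 : ℝ) ^ 2 ≤ (1 / 2 - |v.1|) ^ 2 + (1 / 2 - |v.2|) ^ 2}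

/-- The shift by `1 / 2` moves the removed disc from the origin to the corners of the square. -/
theorem norm_coe_add_half {u : ℝ} (hu : |u| ≤ 1 / 2) :
    ‖((u + 1 / 2 : ℝ) : UnitAddCircle)‖ = 1 / 2 - |u| := by
  rcases abs_cases u with ⟨h, h0⟩ | ⟨h, h0⟩
  · have e : ((u + 1 / 2 : ℝ) : UnitAddCircle) = ((u - 1 / 2 : ℝ) : UnitAddCircle) := by
      rw [← AddCircle.coe_add_period (1 : ℝ) (u - 1 / 2)]
      congr 1
      ring
    rw [h] at hu ⊢
    have h1 : |u - 1 / 2| = 1 / 2 - u := by rw [abs_of_nonpos (by linarith)]; ring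
    rw [e, (AddCircle.norm_coe_eq_abs_iff (1 : ℝ) one_ne_zero).2, h1]
    rw [h1, abs_one]
    linarith
  · rw [h] at hu ⊢
    have h1 : |u + 1 / 2| = 1 / 2 - -u := by rw [abs_of_nonneg (by linarith)]; ring
    rw [(AddCircle.norm_coe_eq_abs_iff (1 : ℝ) one_ne_zero).2, h1]
    rw [h1, abs_one]
    linarith

/-- The map from the cut square to the one-holed torus that glues opposite sides. -/
def wrap (v : cutSquare) : OneHoledTorus :=
  ⟨(((v.1.1 + 1 / 2 : ℝ) : UnitAddCircle), ((v.1.2 + 1 / 2 : ℝ) : UnitAddCircle)), by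
    rw [norm_coe_add_half v.2.1, norm_coe_add_half v.2.2.1]
    exact v.2.2.2⟩

theorem continuous_wrap : Continuous wrap := by
  refine Continuous.subtype_mk (Continuous.prodMk ?_ ?_) _
  · exact (AddCircle.continuous_mk' (1 : ℝ)).comp (by fun_prop)
  · exact (AddCircle.continuous_mk' (1 : ℝ)).comp (by fun_prop)

theorem wrap_mem_bdry_iff (v : cutSquare) :
    wrap v ∈ bdry ↔ (1 / 2 - |v.1.1|) ^ 2 + (1 / 2 - |v.1.2|) ^ 2 = (1 / 4 : ℝ) ^ 2 := by
  rw [← norm_coe_add_half v.2.1, ← norm_coe_add_half v.2.2.1]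
  rfl

theorem exists_coe_add_half (x : UnitAddCircle) :
    ∃ u : ℝ, |u| ≤ 1 / 2 ∧ ((u + 1 / 2 : ℝ) : UnitAddCircle) = x := by
  have : Fact ((0 : ℝ) < 1) := ⟨one_pos⟩
  obtain ⟨y, hy, rfl⟩ := AddCircle.coe_image_Ico_eq (1 : ℝ) 0 ▸ Set.mem_univ x
  refine ⟨y - 1 / 2, abs_le.2 ⟨by linarith [hy.1], by linarith [hy.2]⟩, by congr 1; ring⟩

theorem wrap_surjective : Function.Surjective wrap := by
  rintro ⟨⟨x, y⟩, h⟩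
  obtain ⟨u, hu, rfl⟩ := exists_coe_add_half x
  obtain ⟨v, hv, rfl⟩ := exists_coe_add_half y
  simp only [norm_coe_add_half hu, norm_coe_add_half hv] at h
  exact ⟨⟨(u, v), hu, hv, h⟩, rfl⟩

theorem coe_add_half_eq_iff {u w : ℝ} (hu : |u| ≤ 1 / 2) (hw : |w| ≤ 1 / 2) :
    ((u + 1 / 2 : ℝ) : UnitAddCircle) = ((w + 1 / 2 : ℝ) : UnitAddCircle) ↔
      u = w ∨ (|u| = 1 / 2 ∧ w = -u) := by
  have hu' := abs_le.1 hu
  have hw' := abs_le.1 hw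
  rw [← sub_eq_zero, ← AddCircle.coe_sub, AddCircle.coe_eq_zero_iff]
  constructor
  · rintro ⟨n, hn⟩
    rw [zsmul_eq_mul, mul_one] at hn
    have h1 : n ≤ 1 := by
      have : (n : ℝ) < 2 := by linarith
      exact Int.lt_add_one_iff.1 (by exact_mod_cast this)
    have h2 : -1 ≤ n := by
      have : (-2 : ℝ) < n := by linarith
      have : (-2 : ℤ) < n := by exact_mod_cast this
      lia
    obtain rfl | rfl | rfl : n = -1 ∨ n = 0 ∨ n = 1 := by lia
    · push_cast at hn
      have e : u = -(1 / 2) := by linarith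
      exact Or.inr ⟨by rw [e]; norm_num, by linarith⟩
    · push_cast at hn
      exact Or.inl (by linarith)
    · push_cast at hn
      have e : u = 1 / 2 := by linarith
      exact Or.inr ⟨by rw [e]; norm_num, by linarith⟩
  · rintro (rfl | ⟨h, rfl⟩)
    · exact ⟨0, by simp⟩
    · rcases abs_cases u with ⟨h1, -⟩ | ⟨h1, -⟩
      · exact ⟨1, by simp only [one_zsmul]; linarith⟩
      · exact ⟨-1, by simp only [neg_smul, one_zsmul]; linarith⟩

theorem wrap_eq_iff (v w : cutSquare) : wrap v = wrap w ↔ v.1 = w.1 ∨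
    (|v.1.1| = 1 / 2 ∧ w.1 = (-v.1.1, v.1.2)) ∨ (|v.1.2| = 1 / 2 ∧ w.1 = (v.1.1, -v.1.2)) := by
  have h : wrap v = wrap w ↔
      ((v.1.1 + 1 / 2 : ℝ) : UnitAddCircle) = ((w.1.1 + 1 / 2 : ℝ) : UnitAddCircle) ∧
      ((v.1.2 + 1 / 2 : ℝ) : UnitAddCircle) = ((w.1.2 + 1 / 2 : ℝ) : UnitAddCircle) :=
    Subtype.ext_iff.trans Prod.ext_iff
  rw [h, coe_add_half_eq_iff v.2.1 w.2.1, coe_add_half_eq_iff v.2.2.1 w.2.2.1]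
  constructor
  · rintro ⟨h1 | ⟨h1, h1'⟩, h2 | ⟨h2, h2'⟩⟩
    · exact Or.inl (Prod.ext h1 h2)
    · exact Or.inr (Or.inr ⟨h2, Prod.ext h1.symm h2'⟩)
    · exact Or.inr (Or.inl ⟨h1, Prod.ext h1' h2.symm⟩)
    -- Both coordinates of modulus `1 / 2` would be a corner, which has been removed.
    · exfalso
      have := v.2.2.2
      rw [h1, h2] at this
      norm_num at this
  · rintro (h | ⟨h, h'⟩ | ⟨h, h'⟩)
    · exact ⟨Or.inl (congrArg Prod.fst h), Or.inl (congrArg Prod.snd h)⟩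
    · exact ⟨Or.inr ⟨h, congrArg Prod.fst h'⟩, Or.inl (congrArg Prod.snd h').symm⟩
    · exact ⟨Or.inl (congrArg Prod.fst h').symm, Or.inr ⟨h, congrArg Prod.snd h'⟩⟩

theorem isCompact_cutSquare : IsCompact cutSquare := by
  refine (isCompact_Icc (a := ((-(1 / 2), -(1 / 2)) : ℝ × ℝ))
    (b := (1 / 2, 1 / 2))).of_isClosed_subset ?_ ?_
  · have h1 : IsClosed {v : ℝ × ℝ | |v.1| ≤ 1 / 2} := isClosed_le (by fun_prop) (by fun_prop)
    have h2 : IsClosed {v : ℝ × ℝ | |v.2| ≤ 1 / 2} := isClosed_le (by fun_prop) (by fun_prop)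
    have h3 : IsClosed {v : ℝ × ℝ | (1 / 4 : ℝ) ^ 2 ≤ (1 / 2 - |v.1|) ^ 2 + (1 / 2 - |v.2|) ^ 2} :=
      isClosed_le (by fun_prop) (by fun_prop)
    exact h1.inter (h2.inter h3)
  · rintro ⟨u, v⟩ ⟨h1, h2, -⟩
    have h1' := abs_le.1 h1
    have h2' := abs_le.1 h2
    exact ⟨⟨h1'.1, h2'.1⟩, ⟨h1'.2, h2'.2⟩⟩

instance : CompactSpace cutSquare := isCompact_iff_compactSpace.1 isCompact_cutSquare

instance : T2Space OneHoledTorus :=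
  inferInstanceAs (T2Space
    {p : UnitAddCircle × UnitAddCircle // (1 / 4 : ℝ) ^ 2 ≤ ‖p.1‖ ^ 2 + ‖p.2‖ ^ 2})

instance : CompactSpace OneHoledTorus :=
  ⟨wrap_surjective.range_eq ▸ isCompact_range continuous_wrap⟩

theorem isQuotientMap_wrap : Topology.IsQuotientMap wrap :=
  continuous_wrap.isClosedMap.isQuotientMap continuous_wrap wrap_surjective

namespace Shape

variable (S : Shape)

/-! ### The marking -/

/-- The first Klein coordinate as a function of the first coordinate of the cut square. -/
def px (u : ℝ) : ℝ := profile ((1 - S.t ^ 2) / S.s) (S.excess / S.s) u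

/-- The second Klein coordinate as a function of the second coordinate of the cut square. -/
def py (u : ℝ) : ℝ := profile ((1 - S.s ^ 2) / S.t) (S.excess / S.t) u

theorem excess_swap : S.swap.excess = S.excess := by
  unfold excess
  rw [swap_s, swap_t, add_comm]

theorem py_eq (u : ℝ) : S.py u = S.swap.px u := by
  rw [px, excess_swap]
  rfl

theorem px_coeff_pos : 0 < (1 - S.t ^ 2) / S.s :=
  div_pos (by nlinarith [S.t_pos, S.t_lt_one]) S.s_pos

theorem px_coeff'_pos : 0 < S.excess / S.s := div_pos S.excess_pos S.s_pos

theorem px_coeff_add : (1 - S.t ^ 2) / S.s + S.excess / S.s = S.s := by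
  have := S.s_pos.ne'
  unfold excess
  field_simp
  ring

theorem continuous_px : Continuous S.px := continuous_profile _ _

theorem continuous_py : Continuous S.py := continuous_profile _ _

theorem px_neg (u : ℝ) : S.px (-u) = -S.px u := profile_neg _ _ _

theorem py_neg (u : ℝ) : S.py (-u) = -S.py u := profile_neg _ _ _

theorem px_half : S.px (1 / 2) = S.s := by
  rw [px, profile_half, px_coeff_add]

theorem py_half : S.py (1 / 2) = S.t := by
  rw [py_eq, px_half, swap_s]

theorem px_strictMonoOn : StrictMonoOn S.px (Set.Icc (-(1 / 2)) (1 / 2)) :=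
  profile_strictMonoOn S.px_coeff_pos S.px_coeff'_pos

theorem px_injOn {u w : ℝ} (hu : |u| ≤ 1 / 2) (hw : |w| ≤ 1 / 2) (h : S.px u = S.px w) : u = w :=
  S.px_strictMonoOn.injOn (abs_le.1 hu) (abs_le.1 hw) h

theorem py_injOn {u w : ℝ} (hu : |u| ≤ 1 / 2) (hw : |w| ≤ 1 / 2) (h : S.py u = S.py w) :
    u = w := by
  rw [py_eq, py_eq] at h
  exact S.swap.px_injOn hu hw h

theorem abs_px {u : ℝ} (hu : |u| ≤ 1 / 2) : |S.px u| = S.px |u| :=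
  profile_abs S.px_coeff_pos S.px_coeff'_pos hu

theorem abs_py {u : ℝ} (hu : |u| ≤ 1 / 2) : |S.py u| = S.py |u| := by
  rw [py_eq, py_eq, S.swap.abs_px hu]

theorem abs_px_le {u : ℝ} (hu : |u| ≤ 1 / 2) : |S.px u| ≤ S.s := by
  rw [S.abs_px hu, ← S.px_half]
  exact S.px_strictMonoOn.monotoneOn ⟨by linarith [abs_nonneg u], hu⟩ ⟨by norm_num, le_rfl⟩ hu

theorem abs_py_le {u : ℝ} (hu : |u| ≤ 1 / 2) : |S.py u| ≤ S.t := by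
  rw [py_eq]
  exact S.swap.abs_px_le hu

theorem abs_px_eq_iff {u : ℝ} (hu : |u| ≤ 1 / 2) : |S.px u| = S.s ↔ |u| = 1 / 2 := by
  rw [S.abs_px hu, ← S.px_half]
  refine ⟨fun h => S.px_injOn (by rwa [abs_abs]) (by norm_num) h, fun h => by rw [h]⟩

theorem abs_py_eq_iff {u : ℝ} (hu : |u| ≤ 1 / 2) : |S.py u| = S.t ↔ |u| = 1 / 2 := by
  rw [py_eq]
  exact S.swap.abs_px_eq_iff hu

theorem exists_px_eq {x : ℝ} (hx : |x| ≤ S.s) : ∃ u, |u| ≤ 1 / 2 ∧ S.px u = x := by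
  have := profile_surjOn (a := (1 - S.t ^ 2) / S.s) (b := S.excess / S.s)
  rw [px_coeff_add] at this
  obtain ⟨u, hu, e⟩ := this (abs_le.1 hx)
  exact ⟨u, abs_le.2 hu, e⟩

theorem exists_py_eq {x : ℝ} (hx : |x| ≤ S.t) : ∃ u, |u| ≤ 1 / 2 ∧ S.py u = x := by
  simp only [py_eq]
  exact S.swap.exists_px_eq hx

/-- The reason for the quadratic profile: `s * px + t * py` becomes affine in the squared distance
to the corner, so the circular arc of the cut square goes to the straight boundary edge in the Klein
model. -/
theorem s_mul_px_of_ge {u : ℝ} (h : 1 / 4 ≤ u) :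
    S.s * S.px u = S.s ^ 2 - S.excess * (16 * (1 / 2 - u) ^ 2) := by
  have := S.s_pos.ne'
  rw [px, profile_of_ge h]
  unfold excess
  field_simp
  ring

theorem s_mul_px_of_lt {u : ℝ} (h0 : 0 ≤ u) (h : u < 1 / 4) : S.s * S.px u < 1 - S.t ^ 2 := by
  have := S.s_pos
  rw [px, profile_of_le h0 h.le]
  have e : S.s * (4 * ((1 - S.t ^ 2) / S.s) * u) = (1 - S.t ^ 2) * (4 * u) := by field_simp
  rw [e]
  have : 0 < 1 - S.t ^ 2 := by nlinarith [S.t_pos, S.t_lt_one]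
  nlinarith

/-- The octagon condition in Klein coordinates corresponds to the condition defining the cut
square. -/
theorem boundary_comparison {u v : ℝ} (hu : |u| ≤ 1 / 2) (hv : |v| ≤ 1 / 2) :
    (S.s * |S.px u| + S.t * |S.py v| - 1 =
      16 * S.excess * ((1 / 4) ^ 2 - ((1 / 2 - |u|) ^ 2 + (1 / 2 - |v|) ^ 2))) ∨
    (S.s * |S.px u| + S.t * |S.py v| < 1 ∧
      (1 / 4 : ℝ) ^ 2 < (1 / 2 - |u|) ^ 2 + (1 / 2 - |v|) ^ 2) := by
  have hX := S.abs_px_le hu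
  have hY := S.abs_py_le hv
  have hs := S.s_pos
  have ht := S.t_pos
  have hsX := mul_le_mul_of_nonneg_left hX hs.le
  have htY := mul_le_mul_of_nonneg_left hY ht.le
  rw [S.abs_px hu, S.abs_py hv] at *
  have h0 := abs_nonneg u
  have h0' := abs_nonneg v
  generalize |u| = a at *
  generalize |v| = c at *
  rcases lt_or_ge a (1 / 4) with h | h
  · right
    have := S.s_mul_px_of_lt h0 h
    exact ⟨by nlinarith, by nlinarith [sq_nonneg (1 / 2 - c)]⟩
  rcases lt_or_ge c (1 / 4) with h' | h'
  · right
    have := S.swap.s_mul_px_of_lt h0' h'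
    rw [← py_eq, swap_s, swap_t] at this
    exact ⟨by nlinarith, by nlinarith [sq_nonneg (1 / 2 - a)]⟩
  · left
    have h1 := S.s_mul_px_of_ge h
    have h2 := S.swap.s_mul_px_of_ge h'
    rw [← py_eq, swap_s, excess_swap] at h2
    have h3 : S.excess = S.s ^ 2 + S.t ^ 2 - 1 := rfl
    linear_combination h1 + h2 - h3

theorem boundary_le_iff {u v : ℝ} (hu : |u| ≤ 1 / 2) (hv : |v| ≤ 1 / 2) :
    S.s * |S.px u| + S.t * |S.py v| ≤ 1 ↔
      (1 / 4 : ℝ) ^ 2 ≤ (1 / 2 - |u|) ^ 2 + (1 / 2 - |v|) ^ 2 := by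
  have he := S.excess_pos
  rcases S.boundary_comparison hu hv with h | ⟨h1, h2⟩
  · constructor
    · intro h1
      nlinarith
    · intro h1
      nlinarith
  · exact ⟨fun _ => h2.le, fun _ => h1.le⟩

theorem boundary_eq_iff {u v : ℝ} (hu : |u| ≤ 1 / 2) (hv : |v| ≤ 1 / 2) :
    S.s * |S.px u| + S.t * |S.py v| = 1 ↔
      (1 / 2 - |u|) ^ 2 + (1 / 2 - |v|) ^ 2 = (1 / 4 : ℝ) ^ 2 := by
  have he := S.excess_pos
  rcases S.boundary_comparison hu hv with h | ⟨h1, h2⟩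
  · constructor
    · intro h1
      have h3 : 16 * S.excess *
          ((1 / 4) ^ 2 - ((1 / 2 - |u|) ^ 2 + (1 / 2 - |v|) ^ 2)) = 0 := by rw [← h]; linarith
      have := (mul_eq_zero.1 h3).resolve_left (by positivity)
      linarith
    · intro h1
      rw [h1, sub_self, mul_zero] at h
      linarith
  · exact ⟨fun h => absurd h h1.ne, fun h => absurd h h2.ne.symm⟩

/-- The map from the cut square to the octagon in Klein coordinates. -/
def toKlein (v : cutSquare) : S.kleinOct :=
  ⟨(S.px v.1.1, S.py v.1.2), S.abs_px_le v.2.1, S.abs_py_le v.2.2.1,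
    (S.boundary_le_iff v.2.1 v.2.2.1).2 v.2.2.2⟩

theorem continuous_toKlein : Continuous S.toKlein := by
  refine Continuous.subtype_mk (Continuous.prodMk ?_ ?_) _
  · exact S.continuous_px.comp (by fun_prop)
  · exact S.continuous_py.comp (by fun_prop)

theorem toKlein_surjective : Function.Surjective S.toKlein := by
  rintro ⟨⟨x, y⟩, h1, h2, h3⟩
  obtain ⟨u, hu, rfl⟩ := S.exists_px_eq h1
  obtain ⟨v, hv, rfl⟩ := S.exists_py_eq h2
  exact ⟨⟨(u, v), hu, hv, (S.boundary_le_iff hu hv).1 h3⟩, rfl⟩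

/-- The projection of the octagon in Klein coordinates to the surface. -/
def kproj (v : S.kleinOct) : S.Surface := S.gluing.proj (S.kleinPt v)

theorem continuous_kproj : Continuous S.kproj := S.gluing.continuous_proj.comp S.continuous_kleinPt

theorem kproj_surjective : Function.Surjective S.kproj :=
  S.gluing.proj_surjective.comp S.kleinPt_surjective

/-- Both quotients identify opposite sides by changing the sign of one coordinate, and `px`, `py`
are odd, injective and extremal exactly at the sides. -/
theorem kproj_toKlein_eq_iff (v w : cutSquare) :
    S.kproj (S.toKlein v) = S.kproj (S.toKlein w) ↔ wrap v = wrap w := by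
  rw [kproj, kproj, proj_kleinPt_eq_iff, wrap_eq_iff]
  simp only [toKlein, S.abs_px_eq_iff v.2.1, S.abs_py_eq_iff v.2.2.1, Prod.ext_iff, ← px_neg,
    ← py_neg]
  have hx : ∀ {u w : ℝ}, |u| ≤ 1 / 2 → |w| ≤ 1 / 2 → (S.px u = S.px w ↔ u = w) := fun hu hw =>
    ⟨S.px_injOn hu hw, fun h => by rw [h]⟩
  have hy : ∀ {u w : ℝ}, |u| ≤ 1 / 2 → |w| ≤ 1 / 2 → (S.py u = S.py w ↔ u = w) := fun hu hw =>
    ⟨S.py_injOn hu hw, fun h => by rw [h]⟩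
  have n1 : |-v.1.1| ≤ 1 / 2 := by rw [abs_neg]; exact v.2.1
  have n2 : |-v.1.2| ≤ 1 / 2 := by rw [abs_neg]; exact v.2.2.1
  rw [hx v.2.1 w.2.1, hy v.2.2.1 w.2.2.1, hx w.2.1 n1, hy w.2.2.1 v.2.2.1, hx w.2.1 v.2.1,
    hy w.2.2.1 n2]

/-- The map from the one-holed torus to the surface. -/
def mark (p : OneHoledTorus) : S.Surface :=
  S.kproj (S.toKlein (Function.surjInv wrap_surjective p))

theorem mark_wrap (v : cutSquare) : S.mark (wrap v) = S.kproj (S.toKlein v) :=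
  (S.kproj_toKlein_eq_iff _ _).2 (Function.surjInv_eq wrap_surjective _)

theorem continuous_mark : Continuous S.mark := by
  rw [isQuotientMap_wrap.continuous_iff]
  have : S.mark ∘ wrap = S.kproj ∘ S.toKlein := funext S.mark_wrap
  rw [this]
  exact S.continuous_kproj.comp S.continuous_toKlein

theorem mark_bijective : Function.Bijective S.mark := by
  constructor
  · intro p p' h
    obtain ⟨v, rfl⟩ := wrap_surjective p
    obtain ⟨v', rfl⟩ := wrap_surjective p'
    rw [mark_wrap, mark_wrap] at h
    exact (S.kproj_toKlein_eq_iff _ _).1 h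
  · intro x
    obtain ⟨k, rfl⟩ := S.kproj_surjective x
    obtain ⟨v, rfl⟩ := S.toKlein_surjective k
    exact ⟨wrap v, S.mark_wrap v⟩

/-- The marking of the surface. -/
def markHomeo : OneHoledTorus ≃ₜ S.Surface :=
  Continuous.homeoOfEquivCompactToT2 (f := Equiv.ofBijective S.mark S.mark_bijective)
    S.continuous_mark

theorem markHomeo_apply (p : OneHoledTorus) : S.markHomeo p = S.mark p := rfl

theorem klein_boundary_iff {v : ℝ × ℝ} (hv : v ∈ S.kleinOct) :
    S.s * |cX (klein v)| + S.t * |cY (klein v)| = cT (klein v) ↔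
      S.s * |v.1| + S.t * |v.2| = 1 := by
  have h := S.kleinOct_lt_one hv
  have hT := cT_pos (klein v)
  rw [cX_klein h, cY_klein h, abs_mul, abs_mul, abs_of_pos hT, ← mul_assoc, ← mul_assoc, ← add_mul,
    mul_eq_right₀ hT.ne']

theorem wrap_mem_bdry_iff_klein (v : cutSquare) : wrap v ∈ bdry ↔
    S.s * |cX (klein (S.toKlein v).1)| + S.t * |cY (klein (S.toKlein v).1)|
      = cT (klein (S.toKlein v).1) := by
  rw [wrap_mem_bdry_iff, S.klein_boundary_iff (S.toKlein v).2, ← S.boundary_eq_iff v.2.1 v.2.2.1]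
  rfl

end Shape

/-! ### The length of the boundary -/

theorem eVariationOn_congr_edist {α E F : Type*} [LinearOrder α] [PseudoEMetricSpace E]
    [PseudoEMetricSpace F] {f : α → E} {g : α → F} {s : Set α}
    (h : ∀ x ∈ s, ∀ y ∈ s, edist (f x) (f y) = edist (g x) (g y)) :
    eVariationOn f s = eVariationOn g s := by
  unfold eVariationOn
  refine iSup_congr fun p => Finset.sum_congr rfl fun i _ => ?_
  exact h _ (p.2.2.2 _) _ (p.2.2.2 _)

theorem eVariationOn_of_monotone_or_antitone {f : ℝ → ℝ} {a b : ℝ} (hab : a ≤ b)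
    (h : MonotoneOn f (Set.Icc a b) ∨ AntitoneOn f (Set.Icc a b)) :
    eVariationOn f (Set.Icc a b) = ENNReal.ofReal |f a - f b| := by
  have hm : ∀ f : ℝ → ℝ, MonotoneOn f (Set.Icc a b) →
      eVariationOn f (Set.Icc a b) = ENNReal.ofReal |f a - f b| := by
    intro f hf
    have ha : a ∈ Set.Icc a b := ⟨le_rfl, hab⟩
    have hb : b ∈ Set.Icc a b := ⟨hab, le_rfl⟩
    have := hf.eVariationOn_eq ha hb
    rw [Set.inter_self] at this
    rw [this, abs_sub_comm, abs_of_nonneg (sub_nonneg.2 (hf ha hb hab))]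
  rcases h with h | h
  · exact hm f h
  · have := hm (fun x => -f x) h.neg
    rw [neg_sub_neg, abs_sub_comm] at this
    rw [← this]
    refine eVariationOn_congr_edist fun x _ y _ => ?_
    rw [edist_neg_neg]

namespace Shape

variable (S : Shape)

/-- The position along the boundary geodesic `s X + t Y = T`. -/
def edgePos (z : ℍ) : ℝ :=
  Real.arsinh ((S.s * cY z - S.t * cX z) / √(S.s ^ 2 + S.t ^ 2))

theorem cosh_edgePos {z : ℍ} (hz : S.s * cX z + S.t * cY z = cT z) :
    Real.cosh (S.edgePos z) = √S.excess * cT z / √(S.s ^ 2 + S.t ^ 2) := by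
  have he := S.excess_pos
  have hR : 0 < S.s ^ 2 + S.t ^ 2 := by have := S.s_pos; positivity
  have hT := cT_pos z
  rw [edgePos, Real.cosh_arsinh, ← Real.sqrt_sq (by positivity : 0 ≤ √S.excess * cT z /
    √(S.s ^ 2 + S.t ^ 2))]
  congr 1
  rw [div_pow, div_pow, mul_pow, Real.sq_sqrt hR.le, Real.sq_sqrt he.le]
  field_simp
  have h3 : S.excess = S.s ^ 2 + S.t ^ 2 - 1 := rfl
  rw [h3]
  linear_combination (-(S.s * cX z + S.t * cY z) - cT z) * hz - (S.s ^ 2 + S.t ^ 2) * cT_sq z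

/-- `edgePos` is arc length: its `sinh` and `cosh` are the coordinates along the geodesic, and the
addition formula for `cosh` reproduces the Lorentz form. -/
theorem dist_eq_edgePos {z w : ℍ} (hz : S.s * cX z + S.t * cY z = cT z)
    (hw : S.s * cX w + S.t * cY w = cT w) : dist z w = |S.edgePos z - S.edgePos w| := by
  refine dist_eq_of_cosh ?_
  have he := S.excess_pos
  have hR : 0 < S.s ^ 2 + S.t ^ 2 := by have := S.s_pos; positivity
  rw [Real.cosh_sub, S.cosh_edgePos hz, S.cosh_edgePos hw, edgePos, edgePos, Real.sinh_arsinh,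
    Real.sinh_arsinh, cosh_dist_eq]
  have h1 : √S.excess * cT z / √(S.s ^ 2 + S.t ^ 2) * (√S.excess * cT w / √(S.s ^ 2 + S.t ^ 2))
      = S.excess * cT z * cT w / (S.s ^ 2 + S.t ^ 2) := by
    rw [div_mul_div_comm, Real.mul_self_sqrt hR.le]
    congr 1
    rw [mul_mul_mul_comm, Real.mul_self_sqrt he.le]
    ring
  have h3 : S.excess = S.s ^ 2 + S.t ^ 2 - 1 := rfl
  rw [h1, div_mul_div_comm, Real.mul_self_sqrt hR.le, h3]
  field_simp
  linear_combination -cT w * hz - (S.s * cX z + S.t * cY z) * hw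

/-- On the edge, `tanh` of the arc length is the Klein coordinate divided by `√excess`. -/
theorem edgePos_le {z w : ℍ} (hz : S.s * cX z + S.t * cY z = cT z)
    (hw : S.s * cX w + S.t * cY w = cT w)
    (h : (S.s * cY z - S.t * cX z) / cT z ≤ (S.s * cY w - S.t * cX w) / cT w) :
    S.edgePos z ≤ S.edgePos w := by
  have he := S.excess_pos
  have key : ∀ z, S.s * cX z + S.t * cY z = cT z →
      Real.tanh (S.edgePos z) = (S.s * cY z - S.t * cX z) / cT z / √S.excess := by
    intro z hz
    have hR : 0 < S.s ^ 2 + S.t ^ 2 := by have := S.s_pos; positivity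
    have hT := cT_pos z
    rw [Real.tanh_eq_sinh_div_cosh, S.cosh_edgePos hz, edgePos, Real.sinh_arsinh]
    field_simp
  rw [← Real.artanh_tanh (S.edgePos z), ← Real.artanh_tanh (S.edgePos w)]
  refine Real.artanh_le_artanh (Real.neg_one_lt_tanh _) (Real.tanh_lt_one _) ?_
  rw [key z hz, key w hw]
  exact div_le_div_of_nonneg_right h (Real.sqrt_nonneg _)

/-- The boundary edge of the octagon in the first quadrant, in Klein coordinates. -/
def edge (κ : ℝ) : ℝ × ℝ := (S.s - S.excess * κ / S.s, S.t - S.excess * (1 - κ) / S.t)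

theorem edge_nonneg {κ : ℝ} (h1 : κ ≤ 1) : 0 ≤ (S.edge κ).1 := by
  have hs := S.s_pos
  have he := S.excess_pos
  have h3 : S.excess = S.s ^ 2 + S.t ^ 2 - 1 := rfl
  simp only [edge]
  rw [sub_nonneg, div_le_iff₀ hs]
  nlinarith [S.t_pos, S.t_lt_one]

theorem edge_nonneg' {κ : ℝ} (h0 : 0 ≤ κ) : 0 ≤ (S.edge κ).2 := by
  have ht := S.t_pos
  have he := S.excess_pos
  have h3 : S.excess = S.s ^ 2 + S.t ^ 2 - 1 := rfl
  simp only [edge]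
  rw [sub_nonneg, div_le_iff₀ ht]
  nlinarith [S.s_pos, S.s_lt_one]

theorem edge_eq (κ : ℝ) : S.s * (S.edge κ).1 + S.t * (S.edge κ).2 = 1 := by
  have hs := S.s_pos.ne'
  have ht := S.t_pos.ne'
  have h3 : S.excess = S.s ^ 2 + S.t ^ 2 - 1 := rfl
  simp only [edge]
  field_simp
  rw [h3]
  ring

theorem edge_mem {κ : ℝ} (h0 : 0 ≤ κ) (h1 : κ ≤ 1) : S.edge κ ∈ S.kleinOct := by
  refine ⟨?_, ?_, ?_⟩
  · rw [abs_of_nonneg (S.edge_nonneg h1)]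
    simp only [edge]
    have := div_nonneg (mul_nonneg S.excess_pos.le h0) S.s_pos.le
    linarith
  · rw [abs_of_nonneg (S.edge_nonneg' h0)]
    simp only [edge]
    have := div_nonneg (mul_nonneg S.excess_pos.le (sub_nonneg.2 h1)) S.t_pos.le
    linarith
  · rw [abs_of_nonneg (S.edge_nonneg h1), abs_of_nonneg (S.edge_nonneg' h0), edge_eq]

theorem klein_edge {κ : ℝ} (h0 : 0 ≤ κ) (h1 : κ ≤ 1) :
    S.s * cX (klein (S.edge κ)) + S.t * cY (klein (S.edge κ)) = cT (klein (S.edge κ)) := by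
  have h := S.kleinOct_lt_one (S.edge_mem h0 h1)
  rw [cX_klein h, cY_klein h]
  linear_combination cT (klein (S.edge κ)) * S.edge_eq κ

theorem edgePos_monotoneOn : MonotoneOn (fun κ => S.edgePos (klein (S.edge κ))) (Set.Icc 0 1) := by
  intro κ hκ κ' hκ' h
  refine S.edgePos_le (S.klein_edge hκ.1 hκ.2) (S.klein_edge hκ'.1 hκ'.2) ?_
  have e : ∀ κ ∈ Set.Icc (0 : ℝ) 1,
      (S.s * cY (klein (S.edge κ)) - S.t * cX (klein (S.edge κ))) / cT (klein (S.edge κ))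
        = S.s * (S.edge κ).2 - S.t * (S.edge κ).1 := by
    intro κ hκ
    have h := S.kleinOct_lt_one (S.edge_mem hκ.1 hκ.2)
    have hT := (cT_pos (klein (S.edge κ))).ne'
    rw [cX_klein h, cY_klein h]
    field_simp
  rw [e κ hκ, e κ' hκ']
  have hs := S.s_pos
  have ht := S.t_pos
  have he := S.excess_pos
  simp only [edge]
  have h1 : S.excess * κ / S.s ≤ S.excess * κ' / S.s := by gcongr
  have h2 : S.excess * (1 - κ') / S.t ≤ S.excess * (1 - κ) / S.t := by gcongr
  have := mul_le_mul_of_nonneg_left h1 ht.le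
  have := mul_le_mul_of_nonneg_left h2 hs.le
  linarith

/-- A quarter of the octagon is a right-angled pentagon with adjacent sides `p`, `q` on the axes and
the boundary edge opposite to them; this is its cosine formula. Symmetry in `p` and `q` is what
gives the swapped shape the same boundary length. -/
theorem dist_edge_ends : Real.cosh (dist (klein (S.edge 0)) (klein (S.edge 1)))
    = Real.sinh S.p * Real.sinh S.q := by
  have hs := S.s_pos
  have ht := S.t_pos
  have hs1 : 0 < 1 - S.s ^ 2 := by nlinarith [S.s_lt_one]
  have ht1 : 0 < 1 - S.t ^ 2 := by nlinarith [S.t_lt_one]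
  have he := S.excess_pos
  have h3 : S.excess = S.s ^ 2 + S.t ^ 2 - 1 := rfl
  have hm0 := S.kleinOct_lt_one (S.edge_mem le_rfl zero_le_one)
  have hm1 := S.kleinOct_lt_one (S.edge_mem zero_le_one le_rfl)
  have hp : Real.sinh S.p ^ 2 * (1 - S.s ^ 2) = S.s ^ 2 := by
    have hc := (Real.cosh_pos S.p).ne'
    rw [s, Real.tanh_eq_sinh_div_cosh]
    field_simp
    linear_combination Real.sinh S.p ^ 2 * Real.cosh_sq S.p
  have hq : Real.sinh S.q ^ 2 * (1 - S.t ^ 2) = S.t ^ 2 := by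
    have hc := (Real.cosh_pos S.q).ne'
    rw [t, Real.tanh_eq_sinh_div_cosh]
    field_simp
    linear_combination Real.sinh S.q ^ 2 * Real.cosh_sq S.q
  have hsp := Real.sinh_pos_iff.2 S.p_pos
  have hsq := Real.sinh_pos_iff.2 S.q_pos
  refine (pow_left_inj₀ (Real.cosh_pos _).le (mul_pos hsp hsq).le two_ne_zero).1 ?_
  rw [cosh_dist_eq, cX_klein hm0, cY_klein hm0, cX_klein hm1, cY_klein hm1]
  have e0 : cT (klein (S.edge 0)) ^ 2 * ((1 - S.s ^ 2) * S.excess) = S.t ^ 2 := by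
    have h0 : 0 < 1 - (S.edge 0).1 ^ 2 - (S.edge 0).2 ^ 2 := by linarith
    rw [cT_klein hm0, div_pow, Real.sq_sqrt h0.le, one_pow]
    have : 1 - (S.edge 0).1 ^ 2 - (S.edge 0).2 ^ 2 = (1 - S.s ^ 2) * S.excess / S.t ^ 2 := by
      simp only [edge]
      field_simp
      rw [h3]
      ring
    rw [this]
    field_simp
  have e1 : cT (klein (S.edge 1)) ^ 2 * ((1 - S.t ^ 2) * S.excess) = S.s ^ 2 := by
    have h0 : 0 < 1 - (S.edge 1).1 ^ 2 - (S.edge 1).2 ^ 2 := by linarith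
    rw [cT_klein hm1, div_pow, Real.sq_sqrt h0.le, one_pow]
    have : 1 - (S.edge 1).1 ^ 2 - (S.edge 1).2 ^ 2 = (1 - S.t ^ 2) * S.excess / S.s ^ 2 := by
      simp only [edge]
      field_simp
      rw [h3]
      ring
    rw [this]
    field_simp
  have e2 : 1 - (S.edge 0).1 * (S.edge 1).1 - (S.edge 0).2 * (S.edge 1).2 = S.excess := by
    simp only [edge]
    field_simp
    rw [h3]
    ring
  have e3 : cT (klein (S.edge 0)) * cT (klein (S.edge 1)) -
      (S.edge 0).1 * cT (klein (S.edge 0)) * ((S.edge 1).1 * cT (klein (S.edge 1))) -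
      (S.edge 0).2 * cT (klein (S.edge 0)) * ((S.edge 1).2 * cT (klein (S.edge 1)))
      = cT (klein (S.edge 0)) * cT (klein (S.edge 1)) * S.excess := by
    rw [← e2]
    ring
  rw [e3]
  refine mul_right_cancel₀ (mul_pos hs1 ht1).ne' ?_
  calc (cT (klein (S.edge 0)) * cT (klein (S.edge 1)) * S.excess) ^ 2
        * ((1 - S.s ^ 2) * (1 - S.t ^ 2))
      = (cT (klein (S.edge 0)) ^ 2 * ((1 - S.s ^ 2) * S.excess)) *
        (cT (klein (S.edge 1)) ^ 2 * ((1 - S.t ^ 2) * S.excess)) := by ring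
    _ = S.t ^ 2 * S.s ^ 2 := by rw [e0, e1]
    _ = (Real.sinh S.p ^ 2 * (1 - S.s ^ 2)) * (Real.sinh S.q ^ 2 * (1 - S.t ^ 2)) := by
        rw [hp, hq]; ring
    _ = _ := by ring

theorem fold_klein (v : ℝ × ℝ) : fold (klein v) = klein (|v.1|, |v.2|) := by
  refine ext_coords ?_ ?_
  · simp [klein, abs_div, abs_of_nonneg (Real.sqrt_nonneg _)]
  · simp [klein, abs_div, abs_of_nonneg (Real.sqrt_nonneg _)]

theorem abs_half_add {σ c : ℝ} (hσ : σ = 1 ∨ σ = -1) (h : σ * c ≤ 0) (hc : |c| ≤ 1) :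
    |σ / 2 + c / 4| = 1 / 2 - |c| / 4 := by
  rcases hσ with rfl | rfl
  · have h0 : c ≤ 0 := by linarith
    rw [abs_of_nonpos h0] at hc ⊢
    rw [abs_of_nonneg (by linarith)]
    ring
  · have h0 : 0 ≤ c := by linarith
    rw [abs_of_nonneg h0] at hc ⊢
    rw [abs_of_nonpos (by linarith)]
    ring

theorem coe_half_add {σ c : ℝ} (hσ : σ = 1 ∨ σ = -1) :
    ((σ / 2 + c / 4 + 1 / 2 : ℝ) : UnitAddCircle) = ((c / 4 : ℝ) : UnitAddCircle) := by
  rcases hσ with rfl | rfl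
  · rw [← AddCircle.coe_add_period (1 : ℝ) (c / 4)]
    congr 1
    ring
  · congr 1
    ring

/-- Here `σ` selects the side of the square and `c` is the cosine of the boundary angle. The profile
turns it into `c ^ 2`, so the boundary angle `θ` corresponds to the parameter `cos θ ^ 2` of `edge`.
-/
theorem px_half_add {σ c : ℝ} (hσ : σ = 1 ∨ σ = -1) (h : σ * c ≤ 0) (hc : |c| ≤ 1) :
    S.px (σ / 2 + c / 4) = σ * (S.s - S.excess * c ^ 2 / S.s) := by
  have hs := S.s_pos.ne'
  have key : S.px (1 / 2 - |c| / 4) = S.s - S.excess * c ^ 2 / S.s := by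
    have := S.s_mul_px_of_ge (u := 1 / 2 - |c| / 4) (by linarith)
    rw [sub_sub_cancel, div_pow, sq_abs] at this
    generalize S.px (1 / 2 - |c| / 4) = P at this ⊢
    field_simp
    linear_combination this
  rcases hσ with rfl | rfl
  · rw [← key, one_mul, abs_of_nonpos (by linarith)]
    congr 1
    ring
  · rw [← key, neg_one_mul, ← px_neg, abs_of_nonneg (by linarith)]
    congr 1
    ring

theorem py_half_add {σ c : ℝ} (hσ : σ = 1 ∨ σ = -1) (h : σ * c ≤ 0) (hc : |c| ≤ 1) :
    S.py (σ / 2 + c / 4) = σ * (S.t - S.excess * c ^ 2 / S.t) := by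
  rw [py_eq, S.swap.px_half_add hσ h hc, excess_swap, swap_s]

/-- A lift of the boundary loop to the cut square, in one quadrant. -/
theorem exists_lift_boundaryLoop {σ τ θ : ℝ} (hσ : σ = 1 ∨ σ = -1) (hτ : τ = 1 ∨ τ = -1)
    (h1 : σ * Real.cos θ ≤ 0) (h2 : τ * Real.sin θ ≤ 0) :
    ∃ v : cutSquare, wrap v = boundaryLoop (Circle.exp θ) ∧
      (S.toKlein v).1 = (σ * (S.edge (Real.cos θ ^ 2)).1, τ * (S.edge (Real.cos θ ^ 2)).2) := by
  have hc := Real.abs_cos_le_one θ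
  have hs := Real.abs_sin_le_one θ
  have a1 := abs_half_add hσ h1 hc
  have a2 := abs_half_add hτ h2 hs
  refine ⟨⟨(σ / 2 + Real.cos θ / 4, τ / 2 + Real.sin θ / 4), ?_, ?_, ?_⟩, ?_, ?_⟩
  · rw [a1]
    linarith [abs_nonneg (Real.cos θ)]
  · rw [a2]
    linarith [abs_nonneg (Real.sin θ)]
  · simp only [a1, a2]
    have e : ∀ x : ℝ, (|x| / 4) ^ 2 = x ^ 2 / 16 := fun x => by
      rw [div_pow, sq_abs]
      norm_num
    rw [sub_sub_cancel, sub_sub_cancel, e, e]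
    linarith [Real.sin_sq_add_cos_sq θ]
  · refine Subtype.ext (Prod.ext ?_ ?_)
    · show ((σ / 2 + Real.cos θ / 4 + 1 / 2 : ℝ) : UnitAddCircle)
        = (((Circle.exp θ : ℂ).re / 4 : ℝ) : UnitAddCircle)
      rw [coe_half_add hσ, Circle.coe_exp, Complex.exp_ofReal_mul_I_re]
    · show ((τ / 2 + Real.sin θ / 4 + 1 / 2 : ℝ) : UnitAddCircle)
        = (((Circle.exp θ : ℂ).im / 4 : ℝ) : UnitAddCircle)
      rw [coe_half_add hτ, Circle.coe_exp, Complex.exp_ofReal_mul_I_im]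
  · refine Prod.ext ?_ ?_
    · exact S.px_half_add hσ h1 hc
    · have := S.py_half_add hτ h2 hs
      rw [Real.sin_sq] at this
      exact this

/-- During a quarter turn the lifts stay in one closed quadrant, where folding is isometric and the
glued distance is the hyperbolic one. -/
theorem edist_boundaryLoop {σ τ θ θ' : ℝ} (hσ : σ = 1 ∨ σ = -1) (hτ : τ = 1 ∨ τ = -1)
    (h1 : σ * Real.cos θ ≤ 0) (h2 : τ * Real.sin θ ≤ 0)
    (h1' : σ * Real.cos θ' ≤ 0) (h2' : τ * Real.sin θ' ≤ 0) :
    edist (S.mark (boundaryLoop (Circle.exp θ))) (S.mark (boundaryLoop (Circle.exp θ'))) =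
      edist (S.edgePos (klein (S.edge (Real.cos θ ^ 2))))
        (S.edgePos (klein (S.edge (Real.cos θ' ^ 2)))) := by
  obtain ⟨v, hv, ev⟩ := S.exists_lift_boundaryLoop hσ hτ h1 h2
  obtain ⟨w, hw, ew⟩ := S.exists_lift_boundaryLoop hσ hτ h1' h2'
  have c0 := sq_nonneg (Real.cos θ)
  have c1 : Real.cos θ ^ 2 ≤ 1 := Real.cos_sq_le_one θ
  have d0 := sq_nonneg (Real.cos θ')
  have d1 : Real.cos θ' ^ 2 ≤ 1 := Real.cos_sq_le_one θ'
  have hσ2 : σ * σ = 1 := by rcases hσ with rfl | rfl <;> norm_num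
  have hτ2 : τ * τ = 1 := by rcases hτ with rfl | rfl <;> norm_num
  have hσa : |σ| = 1 := by rcases hσ with rfl | rfl <;> norm_num
  have hτa : |τ| = 1 := by rcases hτ with rfl | rfl <;> norm_num
  have fv : fold (klein (S.toKlein v).1) = klein (S.edge (Real.cos θ ^ 2)) := by
    rw [fold_klein, ev, abs_mul, abs_mul, hσa, hτa, one_mul, one_mul,
      abs_of_nonneg (S.edge_nonneg c1), abs_of_nonneg (S.edge_nonneg' c0)]
  have fw : fold (klein (S.toKlein w).1) = klein (S.edge (Real.cos θ' ^ 2)) := by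
    rw [fold_klein, ew, abs_mul, abs_mul, hσa, hτa, one_mul, one_mul,
      abs_of_nonneg (S.edge_nonneg d1), abs_of_nonneg (S.edge_nonneg' d0)]
  have kv := S.kleinOct_lt_one (S.toKlein v).2
  have kw := S.kleinOct_lt_one (S.toKlein w).2
  have hT := (cT_pos (klein (S.toKlein v).1)).le
  have hT' := (cT_pos (klein (S.toKlein w).1)).le
  have hX : 0 ≤ cX (klein (S.toKlein v).1) * cX (klein (S.toKlein w).1) := by
    rw [cX_klein kv, cX_klein kw, mul_mul_mul_comm]
    refine mul_nonneg ?_ (mul_nonneg hT hT')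
    rw [ev, ew, mul_mul_mul_comm, hσ2, one_mul]
    exact mul_nonneg (S.edge_nonneg c1) (S.edge_nonneg d1)
  have hY : 0 ≤ cY (klein (S.toKlein v).1) * cY (klein (S.toKlein w).1) := by
    rw [cY_klein kv, cY_klein kw, mul_mul_mul_comm]
    refine mul_nonneg ?_ (mul_nonneg hT hT')
    rw [ev, ew, mul_mul_mul_comm, hτ2, one_mul]
    exact mul_nonneg (S.edge_nonneg' c0) (S.edge_nonneg' d0)
  rw [← hv, ← hw, mark_wrap, mark_wrap, edist_dist, edist_dist, Real.dist_eq,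
    ← S.dist_eq_edgePos (S.klein_edge c0 c1) (S.klein_edge d0 d1), ← fv, ← fw, dist_fold_eq hX hY]
  congr 1
  exact S.dist_proj_eq hX hY

/-- On a quarter turn `cos θ ^ 2` runs monotonically between `0` and `1`, with direction given by
`c`, so the variation is the full length of the edge. -/
theorem eVariationOn_boundaryLoop_quarter {σ τ a c : ℝ} (hσ : σ = 1 ∨ σ = -1)
    (hτ : τ = 1 ∨ τ = -1) (hc : c = 1 ∨ c = -1) (hcos : Real.cos (2 * a) = c)
    (h1 : ∀ θ ∈ Set.Icc a (a + Real.pi / 2), σ * Real.cos θ ≤ 0)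
    (h2 : ∀ θ ∈ Set.Icc a (a + Real.pi / 2), τ * Real.sin θ ≤ 0) :
    eVariationOn (fun θ => S.mark (boundaryLoop (Circle.exp θ))) (Set.Icc a (a + Real.pi / 2))
      = ENNReal.ofReal (dist (klein (S.edge 0)) (klein (S.edge 1))) := by
  have hπ := Real.pi_pos
  have hsin : Real.sin (2 * a) = 0 := by
    have := Real.sin_sq_add_cos_sq (2 * a)
    rw [hcos] at this
    have hc2 : c ^ 2 = 1 := by rcases hc with rfl | rfl <;> norm_num
    rw [hc2] at this
    exact pow_eq_zero_iff two_ne_zero |>.1 (by linarith)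
  have hsq : ∀ θ, Real.cos θ ^ 2 = 1 / 2 + c * Real.cos (2 * (θ - a)) / 2 := by
    intro θ
    rw [Real.cos_sq, show 2 * θ = 2 * (θ - a) + 2 * a by ring, Real.cos_add, hsin, hcos]
    ring
  have hanti : AntitoneOn (fun θ => Real.cos (2 * (θ - a))) (Set.Icc a (a + Real.pi / 2)) := by
    intro x hx y hy hxy
    exact Real.strictAntiOn_cos.antitoneOn ⟨by linarith [hx.1], by linarith [hx.2]⟩
      ⟨by linarith [hy.1], by linarith [hy.2]⟩ (by linarith)
  rw [eVariationOn_congr_edist (g := fun θ => S.edgePos (klein (S.edge (Real.cos θ ^ 2))))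
    fun x hx y hy => S.edist_boundaryLoop hσ hτ (h1 x hx) (h2 x hx) (h1 y hy) (h2 y hy),
    eVariationOn_of_monotone_or_antitone (by linarith)]
  · have e0 := hsq a
    have e1 := hsq (a + Real.pi / 2)
    rw [sub_self, mul_zero, Real.cos_zero] at e0
    rw [add_sub_cancel_left, mul_div_cancel₀ _ two_ne_zero, Real.cos_pi] at e1
    rw [S.dist_eq_edgePos (S.klein_edge le_rfl zero_le_one) (S.klein_edge zero_le_one le_rfl)]
    rw [e0, e1]
    rcases hc with rfl | rfl
    · rw [abs_sub_comm]
      norm_num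
    · norm_num
  · have hmem : ∀ θ, Real.cos θ ^ 2 ∈ Set.Icc (0 : ℝ) 1 := fun θ =>
      ⟨sq_nonneg _, Real.cos_sq_le_one θ⟩
    rcases hc with rfl | rfl
    · right
      intro x hx y hy hxy
      refine S.edgePos_monotoneOn (hmem y) (hmem x) ?_
      rw [hsq, hsq]
      linarith [hanti hx hy hxy]
    · left
      intro x hx y hy hxy
      refine S.edgePos_monotoneOn (hmem x) (hmem y) ?_
      rw [hsq, hsq]
      linarith [hanti hx hy hxy]

theorem loopLength_boundaryLoop : loopLength (fun z => S.markHomeo (boundaryLoop z)) =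
    ENNReal.ofReal (4 * dist (klein (S.edge 0)) (klein (S.edge 1))) := by
  have hπ := Real.pi_pos
  have q0 := S.eVariationOn_boundaryLoop_quarter (σ := -1) (τ := -1) (a := 0) (Or.inr rfl)
    (Or.inr rfl) (Or.inl rfl) (by simp)
    (fun θ hθ => by
      have := Real.cos_nonneg_of_mem_Icc (x := θ) ⟨by linarith [hθ.1], by linarith [hθ.2]⟩
      linarith)
    (fun θ hθ => by
      have := Real.sin_nonneg_of_mem_Icc (x := θ) ⟨by linarith [hθ.1], by linarith [hθ.2]⟩
      linarith)
  have q1 := S.eVariationOn_boundaryLoop_quarter (σ := 1) (τ := -1) (a := Real.pi / 2) (Or.inl rfl)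
    (Or.inr rfl) (Or.inr rfl) (by rw [mul_div_cancel₀ _ two_ne_zero, Real.cos_pi])
    (fun θ hθ => by
      have := Real.cos_nonpos_of_pi_div_two_le_of_le (x := θ) (by linarith [hθ.1])
        (by linarith [hθ.2])
      linarith)
    (fun θ hθ => by
      have := Real.sin_nonneg_of_mem_Icc (x := θ) ⟨by linarith [hθ.1], by linarith [hθ.2]⟩
      linarith)
  have q2 := S.eVariationOn_boundaryLoop_quarter (σ := 1) (τ := 1) (a := Real.pi) (Or.inl rfl)
    (Or.inl rfl) (Or.inl rfl) (by simp)
    (fun θ hθ => by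
      have := Real.cos_nonpos_of_pi_div_two_le_of_le (x := θ) (by linarith [hθ.1])
        (by linarith [hθ.2])
      linarith)
    (fun θ hθ => by
      have := Real.sin_nonneg_of_mem_Icc (x := θ - Real.pi)
        ⟨by linarith [hθ.1], by linarith [hθ.2]⟩
      rw [Real.sin_sub_pi] at this
      linarith)
  have q3 := S.eVariationOn_boundaryLoop_quarter (σ := -1) (τ := 1) (a := Real.pi + Real.pi / 2)
    (Or.inr rfl) (Or.inl rfl) (Or.inr rfl)
    (by rw [show 2 * (Real.pi + Real.pi / 2) = Real.pi + 2 * Real.pi by ring,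
      Real.cos_add_two_pi, Real.cos_pi])
    (fun θ hθ => by
      have := Real.cos_nonneg_of_mem_Icc (x := θ - 2 * Real.pi)
        ⟨by linarith [hθ.1], by linarith [hθ.2]⟩
      rw [Real.cos_sub_two_pi] at this
      linarith)
    (fun θ hθ => by
      have := Real.sin_nonneg_of_mem_Icc (x := θ - Real.pi)
        ⟨by linarith [hθ.1], by linarith [hθ.2]⟩
      rw [Real.sin_sub_pi] at this
      linarith)
  have split : ∀ {a b c : ℝ}, a ≤ b → b ≤ c →
      eVariationOn (fun θ => S.mark (boundaryLoop (Circle.exp θ))) (Set.Icc a c) =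
        eVariationOn (fun θ => S.mark (boundaryLoop (Circle.exp θ))) (Set.Icc a b) +
        eVariationOn (fun θ => S.mark (boundaryLoop (Circle.exp θ))) (Set.Icc b c) := by
    intro a b c hab hbc
    have := eVariationOn.Icc_add_Icc (fun θ => S.mark (boundaryLoop (Circle.exp θ)))
      (s := Set.univ) hab hbc (Set.mem_univ b)
    simpa only [Set.univ_inter] using this.symm
  have f0 : (0 : ℝ) + Real.pi / 2 = Real.pi / 2 := by ring
  have f1 : Real.pi / 2 + Real.pi / 2 = Real.pi := by ring
  have f3 : Real.pi + Real.pi / 2 + Real.pi / 2 = 2 * Real.pi := by ring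
  rw [f0] at q0
  rw [f1] at q1
  rw [f3] at q3
  show eVariationOn (fun θ => S.mark (boundaryLoop (Circle.exp θ))) (Set.Icc 0 (2 * Real.pi)) = _
  rw [split (b := Real.pi / 2) (by linarith) (by linarith),
    split (a := Real.pi / 2) (b := Real.pi) (by linarith) (by linarith),
    split (a := Real.pi) (b := Real.pi + Real.pi / 2) (by linarith) (by linarith), q0, q1, q2, q3]
  have hd := dist_nonneg (x := klein (S.edge 0)) (y := klein (S.edge 1))
  rw [← ENNReal.ofReal_add hd hd, ← ENNReal.ofReal_add hd (by linarith),
    ← ENNReal.ofReal_add hd (by linarith)]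
  congr 1
  ring

/-- The marked hyperbolic torus of the given shape. -/
def toMarkedTorus (b : ℝ) (hb : 0 ≤ b)
    (h : Real.cosh (b / 4) = Real.sinh S.p * Real.sinh S.q) : MarkedTorus b where
  carrier := S.Surface
  marking := S.markHomeo
  exists_short_path := S.gluing.exists_short_path S.exists_path_of_gluing
  interior_hyperbolic p hp := by
    obtain ⟨v, rfl⟩ := wrap_surjective p
    rw [markHomeo_apply, mark_wrap]
    refine S.isModeledAt_of_lt _ (lt_of_le_of_ne (S.kleinPt (S.toKlein v)).2.2.2 ?_)
    rwa [S.wrap_mem_bdry_iff_klein] at hp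
  boundary_geodesic p hp := by
    obtain ⟨v, rfl⟩ := wrap_surjective p
    rw [markHomeo_apply, mark_wrap]
    refine S.isModeledAt_of_eq _ ?_
    rwa [S.wrap_mem_bdry_iff_klein] at hp
  boundary_length := by
    rw [S.loopLength_boundaryLoop]
    have := dist_eq_of_cosh (S.dist_edge_ends.trans h.symm)
    rw [this, abs_of_nonneg (by linarith)]
    congr 1
    ring

end Shape

/-! ### A Lipschitz map between the tori of a shape and of the swapped shape -/

theorem sinh_le_of_le_one {d : ℝ} (h0 : 0 ≤ d) (h1 : d ≤ 1) : Real.sinh d ≤ 2 * d := by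
  have h2 := (le_abs_self _).trans (Real.abs_exp_sub_one_le (x := d) (by rwa [abs_of_nonneg h0]))
  rw [abs_of_nonneg h0] at h2
  have h3 := Real.add_one_le_exp (-d)
  rw [Real.sinh_eq]
  linarith

theorem abs_klein_sub_le_sinh (z w : ℍ) :
    |cX z / cT z - cX w / cT w| ≤ Real.sinh (dist z w) := by
  have hz := one_le_cT z
  have hw := one_le_cT w
  have ez := cT_sq z
  have ew := cT_sq w
  have hd := Real.cosh_sq (dist z w)
  rw [cosh_dist_eq] at hd
  refine abs_le_of_sq_le_sq ?_ (Real.sinh_nonneg_iff.2 dist_nonneg)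
  generalize Real.sinh (dist z w) = D at *
  have h1 : (cX z * cT w - cX w * cT z) ^ 2 ≤ cT z ^ 2 * D ^ 2 := by
    -- A Lagrange-type identity: the scaled square of `sinh` of the distance is a sum of three
    -- squares, one of them the wanted one.
    have : cT z ^ 2 * D ^ 2 = (cX z * cT w - cX w * cT z) ^ 2 + (cY z * cT w - cY w * cT z) ^ 2 +
        (cX z * (cX z * cT w - cX w * cT z) + cY z * (cY z * cT w - cY w * cT z)) ^ 2 := by
      have e2 : D ^ 2 = (cT z * cT w - cX z * cX w - cY z * cY w) ^ 2 - 1 := by linarith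
      have e3 : D ^ 2 = (cX z * cT w - cX w * cT z) ^ 2 + (cY z * cT w - cY w * cT z) ^ 2
          - (cX z * cY w - cX w * cY z) ^ 2 := by
        rw [e2]
        linear_combination (cT w ^ 2 - cX w ^ 2 - cY w ^ 2) * ez + ew
      rw [e3]
      linear_combination
        ((cX z * cT w - cX w * cT z) ^ 2 + (cY z * cT w - cY w * cT z) ^ 2) * ez
    rw [this]
    nlinarith [sq_nonneg (cY z * cT w - cY w * cT z), sq_nonneg
      (cX z * (cX z * cT w - cX w * cT z) + cY z * (cY z * cT w - cY w * cT z))]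
  have e : cX z / cT z - cX w / cT w = (cX z * cT w - cX w * cT z) / (cT z * cT w) := by
    have := (cT_pos z).ne'
    have := (cT_pos w).ne'
    field_simp
  have hp : 0 < (cT z * cT w) ^ 2 := by positivity
  rw [e, div_pow, div_le_iff₀ hp]
  have h2 : cT z ^ 2 * D ^ 2 * 1 ≤ cT z ^ 2 * D ^ 2 * cT w ^ 2 :=
    mul_le_mul_of_nonneg_left (one_le_pow₀ hw) (by positivity)
  linarith [mul_pow (cT z) (cT w) 2]

/-- Up to distance `1`, `sinh d ≤ 2 * d`; beyond it, Klein coordinates lie in `[-1, 1]` and differ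
by at most `2`. -/
theorem abs_klein_sub_le (z w : ℍ) : |cX z / cT z - cX w / cT w| ≤ 2 * dist z w := by
  rcases le_total (dist z w) 1 with h | h
  · exact (abs_klein_sub_le_sinh z w).trans (sinh_le_of_le_one dist_nonneg h)
  · have aux : ∀ u : ℍ, |cX u / cT u| ≤ 1 := fun u => by
      rw [abs_div, abs_of_pos (cT_pos u), div_le_one (cT_pos u)]
      exact (abs_cX_lt_cT u).le
    have := abs_sub (cX z / cT z) (cX w / cT w)
    linarith [aux z, aux w]

theorem abs_klein_sub_le' (z w : ℍ) : |cY z / cT z - cY w / cT w| ≤ 2 * dist z w := by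
  have := abs_klein_sub_le (swapXY z) (swapXY w)
  simpa [swapXY.isometry.dist_eq] using this

theorem klein_tanh_fst (a : ℝ) : cX (klein (Real.tanh a, 0)) = Real.sinh a ∧
    cY (klein (Real.tanh a, 0)) = 0 ∧ cT (klein (Real.tanh a, 0)) = Real.cosh a := by
  have hc := Real.cosh_pos a
  have e : 1 - Real.tanh a ^ 2 - (0 : ℝ) ^ 2 = (1 / Real.cosh a) ^ 2 := by
    rw [Real.tanh_eq_sinh_div_cosh]
    field_simp
    linear_combination Real.cosh_sq a
  have h : (Real.tanh a, (0 : ℝ)).1 ^ 2 + (Real.tanh a, (0 : ℝ)).2 ^ 2 < 1 := by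
    have : (0 : ℝ) < (1 / Real.cosh a) ^ 2 := by positivity
    show Real.tanh a ^ 2 + 0 ^ 2 < 1
    linarith
  have hT : cT (klein (Real.tanh a, 0)) = Real.cosh a := by
    rw [cT_klein h]
    simp only [e]
    rw [Real.sqrt_sq (by positivity), one_div_one_div]
  refine ⟨?_, ?_, hT⟩
  · rw [cX_klein h, hT, Real.tanh_eq_sinh_div_cosh]
    exact div_mul_cancel₀ _ hc.ne'
  · rw [cY_klein h, zero_mul]

theorem swapXY_klein (v : ℝ × ℝ) : swapXY (klein v) = klein (v.2, v.1) := by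
  have : 1 - v.1 ^ 2 - v.2 ^ 2 = 1 - v.2 ^ 2 - v.1 ^ 2 := by ring
  refine ext_coords ?_ ?_
  · simp [klein, this]
  · simp [klein, this]

theorem dist_klein_tanh_fst (a b : ℝ) :
    dist (klein (Real.tanh a, 0)) (klein (Real.tanh b, 0)) = |a - b| := by
  rw [dist_eq_of_cY_eq_zero (klein_tanh_fst a).2.1 (klein_tanh_fst b).2.1, (klein_tanh_fst a).1,
    (klein_tanh_fst b).1, Real.arsinh_sinh, Real.arsinh_sinh]

theorem dist_klein_tanh_snd (a b : ℝ) :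
    dist (klein (0, Real.tanh a)) (klein (0, Real.tanh b)) = |a - b| := by
  rw [← dist_klein_tanh_fst, ← swapXY_klein (Real.tanh a, 0), ← swapXY_klein (Real.tanh b, 0),
    swapXY.isometry.dist_eq]

/-- Both points lie on the cross of the two axes, with `a` and `b` as arc lengths. Points on
different axes are compared through the centre. -/
theorem dist_klein_tanh_le {a b a' b' : ℝ} (h : a = 0 ∨ b = 0) (h' : a' = 0 ∨ b' = 0) :
    dist (klein (Real.tanh a, Real.tanh b)) (klein (Real.tanh a', Real.tanh b'))
      ≤ |a - a'| + |b - b'| := by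
  have mixed : ∀ a b : ℝ,
      dist (klein (Real.tanh a, 0)) (klein (0, Real.tanh b)) ≤ |a| + |b| := fun a b => by
    refine (dist_triangle _ (klein (0, 0)) _).trans (le_of_eq ?_)
    have h1 := dist_klein_tanh_fst a 0
    have h2 := dist_klein_tanh_snd 0 b
    rw [Real.tanh_zero, sub_zero] at h1
    rw [Real.tanh_zero, zero_sub, abs_neg] at h2
    rw [h1, h2]
  rcases h with rfl | rfl <;> rcases h' with rfl | rfl <;> rw [Real.tanh_zero]
  · rw [dist_klein_tanh_snd]
    simp
  · rw [dist_comm]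
    refine (mixed _ _).trans (le_of_eq ?_)
    simp
  · refine (mixed _ _).trans (le_of_eq ?_)
    simp
  · rw [dist_klein_tanh_fst]
    simp

theorem tanh_mono : Monotone Real.tanh := by
  intro a b h
  rw [Real.tanh_eq_sinh_div_cosh, Real.tanh_eq_sinh_div_cosh,
    div_le_div_iff₀ (Real.cosh_pos a) (Real.cosh_pos b)]
  have := Real.sinh_nonneg_iff.2 (sub_nonneg.2 h)
  rw [Real.sinh_sub] at this
  linarith

theorem continuous_tanh : Continuous Real.tanh := by
  have : Real.tanh = fun x => Real.sinh x / Real.cosh x := funext Real.tanh_eq_sinh_div_cosh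
  rw [this]
  exact Real.continuous_sinh.div Real.continuous_cosh fun x => (Real.cosh_pos x).ne'

theorem abs_tanh_mul_le {q r : ℝ} (hq : 0 < q) (hr : |r| ≤ 1) :
    |Real.tanh (q * r)| ≤ Real.tanh q := by
  have h := abs_le.1 hr
  refine abs_le.2 ⟨?_, tanh_mono (by nlinarith)⟩
  rw [← Real.tanh_neg]
  exact tanh_mono (by nlinarith)

/-- The odd function that vanishes on `[-c, c]` and is affine from `c` to `m` with value `1`
at `m`. -/
def ramp (c m u : ℝ) : ℝ := (u - max (-c) (min c u)) / (m - c)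

theorem continuous_ramp (c m : ℝ) : Continuous (ramp c m) := by
  unfold ramp
  fun_prop

theorem ramp_neg {c : ℝ} (hc : 0 ≤ c) (m u : ℝ) : ramp c m (-u) = -ramp c m u := by
  unfold ramp
  rw [← neg_div]
  congr 1
  rw [min_def, min_def, max_def, max_def]
  split_ifs <;> linarith

theorem ramp_of_abs_le {c m u : ℝ} (h : |u| ≤ c) : ramp c m u = 0 := by
  have h := abs_le.1 h
  rw [ramp, min_eq_right h.2, max_eq_right h.1, sub_self, zero_div]

theorem ramp_self {c m : ℝ} (hc : 0 ≤ c) (h : c < m) : ramp c m m = 1 := by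
  rw [ramp, min_eq_left h.le, max_eq_right (by linarith)]
  exact div_self (by linarith)

theorem abs_ramp_sub_le {c m : ℝ} (hc : 0 ≤ c) (h : c < m) (u w : ℝ) :
    |ramp c m u - ramp c m w| ≤ |u - w| / (m - c) := by
  rw [ramp, ramp, ← sub_div, abs_div, abs_of_pos (sub_pos.2 h)]
  refine div_le_div_of_nonneg_right ?_ (sub_pos.2 h).le
  rw [min_def, min_def, max_def, max_def]
  split_ifs <;> rcases abs_cases (u - w) with ⟨h1, h1'⟩ | ⟨h1, h1'⟩ <;> rw [h1, abs_le] <;>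
    constructor <;> linarith

theorem abs_ramp_eq_one {c m u : ℝ} (hc : 0 ≤ c) (h : c < m) (hu : |u| = m) :
    |ramp c m u| = 1 := by
  rcases abs_cases u with ⟨h1, -⟩ | ⟨h1, -⟩
  · rw [← h1, hu, ramp_self hc h, abs_one]
  · rw [← neg_neg u, ← h1, hu, ramp_neg hc, ramp_self hc h, abs_neg, abs_one]

theorem abs_ramp_le_one {c m u : ℝ} (hc : 0 ≤ c) (h : c < m) (hu : |u| ≤ m) :
    |ramp c m u| ≤ 1 := by
  have hu := abs_le.1 hu
  rw [ramp, abs_div, abs_of_pos (sub_pos.2 h), div_le_one (sub_pos.2 h), min_def, max_def, abs_le]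
  split_ifs <;> constructor <;> linarith

namespace Shape

/-- Two cut-off values such that no point of the octagon exceeds both. -/
structure Bands (S : Shape) where
  c : ℝ
  d : ℝ
  c_nonneg : 0 ≤ c
  d_nonneg : 0 ≤ d
  c_lt : c < S.s
  d_lt : d < S.t
  one_le : 1 ≤ S.s * c + S.t * d

namespace Bands

variable {S : Shape} (N : S.Bands)

/-- If both coordinates exceeded their cut-offs, then `s * |x| + t * |y| > s * c + t * d ≥ 1`,
outside the octagon. So the collapsed image lies on the axes. -/
theorem ramp_eq_zero {v : ℝ × ℝ} (hv : v ∈ S.kleinOct) :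
    ramp N.c S.s v.1 = 0 ∨ ramp N.d S.t v.2 = 0 := by
  rcases le_or_gt |v.1| N.c with h | h
  · exact Or.inl (ramp_of_abs_le h)
  rcases le_or_gt |v.2| N.d with h' | h'
  · exact Or.inr (ramp_of_abs_le h')
  have h1 := mul_lt_mul_of_pos_left h S.s_pos
  have h2 := mul_lt_mul_of_pos_left h' S.t_pos
  linarith [hv.2.2, N.one_le]

/-- The map of octagons, in Klein coordinates, that collapses the octagon to the two axes and
stretches the bands at the walls. -/
def collapse (v : S.kleinOct) : S.swap.kleinOct :=
  ⟨(Real.tanh (S.q * ramp N.c S.s v.1.1), Real.tanh (S.p * ramp N.d S.t v.1.2)), by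
    have h1 := abs_tanh_mul_le S.q_pos (abs_ramp_le_one N.c_nonneg N.c_lt v.2.1)
    have h2 := abs_tanh_mul_le S.p_pos (abs_ramp_le_one N.d_nonneg N.d_lt v.2.2.1)
    refine ⟨h1, h2, ?_⟩
    have hs := S.swap.s_pos
    have ht := S.swap.t_pos
    have hs1 := S.swap.s_lt_one
    have ht1 := S.swap.t_lt_one
    rcases N.ramp_eq_zero v.2 with h | h <;> simp only [h, mul_zero, Real.tanh_zero, abs_zero]
    · have : S.swap.t * |Real.tanh (S.p * ramp N.d S.t v.1.2)| ≤ 1 * 1 :=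
        mul_le_mul ht1.le (h2.trans ht1.le) (abs_nonneg _) zero_le_one
      linarith
    · have : S.swap.s * |Real.tanh (S.q * ramp N.c S.s v.1.1)| ≤ 1 * 1 :=
        mul_le_mul hs1.le (h1.trans hs1.le) (abs_nonneg _) zero_le_one
      linarith⟩

theorem continuous_collapse : Continuous N.collapse := by
  refine Continuous.subtype_mk (Continuous.prodMk ?_ ?_) _
  · exact continuous_tanh.comp (continuous_const.mul ((continuous_ramp _ _).comp (by fun_prop)))
  · exact continuous_tanh.comp (continuous_const.mul ((continuous_ramp _ _).comp (by fun_prop)))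

theorem abs_collapse_fst {v : S.kleinOct} (h : |v.1.1| = S.s) :
    |(N.collapse v).1.1| = S.swap.s := by
  have h1 := abs_ramp_eq_one N.c_nonneg N.c_lt h
  show |Real.tanh (S.q * ramp N.c S.s v.1.1)| = Real.tanh S.q
  have := tanh_pos S.q_pos
  rcases eq_or_eq_neg_of_abs_eq h1 with h | h <;> rw [h]
  · rw [mul_one, abs_of_pos this]
  · rw [mul_neg_one, Real.tanh_neg, abs_neg, abs_of_pos this]

theorem abs_collapse_snd {v : S.kleinOct} (h : |v.1.2| = S.t) :
    |(N.collapse v).1.2| = S.swap.t := by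
  have h1 := abs_ramp_eq_one N.d_nonneg N.d_lt h
  show |Real.tanh (S.p * ramp N.d S.t v.1.2)| = Real.tanh S.p
  have := tanh_pos S.p_pos
  rcases eq_or_eq_neg_of_abs_eq h1 with h | h <;> rw [h]
  · rw [mul_one, abs_of_pos this]
  · rw [mul_neg_one, Real.tanh_neg, abs_neg, abs_of_pos this]

theorem collapse_neg_fst {v w : S.kleinOct} (h : w.1 = (-v.1.1, v.1.2)) :
    (N.collapse w).1 = (-(N.collapse v).1.1, (N.collapse v).1.2) := by
  simp only [collapse, h, ramp_neg N.c_nonneg, mul_neg, Real.tanh_neg]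

theorem collapse_neg_snd {v w : S.kleinOct} (h : w.1 = (v.1.1, -v.1.2)) :
    (N.collapse w).1 = ((N.collapse v).1.1, -(N.collapse v).1.2) := by
  simp only [collapse, h, ramp_neg N.d_nonneg, mul_neg, Real.tanh_neg]

/-- The ramps are odd and equal `±1` on the walls, so each wall maps into the corresponding wall of
the swapped octagon, compatibly with the identifications. -/
theorem kproj_collapse_eq {v w : S.kleinOct} (h : S.kproj v = S.kproj w) :
    S.swap.kproj (N.collapse v) = S.swap.kproj (N.collapse w) := by
  rw [kproj, kproj, proj_kleinPt_eq_iff] at h ⊢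
  rcases h with h | ⟨h1, h2⟩ | ⟨h1, h2⟩
  · left
    rw [Subtype.ext h]
  · exact Or.inr (Or.inl ⟨N.abs_collapse_fst h1, N.collapse_neg_fst h2⟩)
  · exact Or.inr (Or.inr ⟨N.abs_collapse_snd h1, N.collapse_neg_snd h2⟩)

/-- The Lipschitz map of surfaces induced by `collapse`. -/
def surfaceMap (x : S.Surface) : S.swap.Surface :=
  S.swap.kproj (N.collapse (Function.surjInv S.kproj_surjective x))

theorem surfaceMap_kproj (v : S.kleinOct) :
    N.surfaceMap (S.kproj v) = S.swap.kproj (N.collapse v) :=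
  N.kproj_collapse_eq (Function.surjInv_eq S.kproj_surjective _)

/-- The Lipschitz constant of `surfaceMap`. -/
def const : ℝ := 2 * (S.q / (S.s - N.c) + S.p / (S.t - N.d))

theorem const_pos : 0 < N.const := by
  have h1 := div_pos S.q_pos (sub_pos.2 N.c_lt)
  have h2 := div_pos S.p_pos (sub_pos.2 N.d_lt)
  unfold const
  linarith

/-- The constant collects a factor `2` from the Klein coordinates, the slopes of the ramps, and the
half-lengths `q`, `p` over which the bands are stretched. -/
theorem dist_surfaceMap_proj_le (x y : S.gluing.dom) :
    dist (N.surfaceMap (S.gluing.proj x)) (N.surfaceMap (S.gluing.proj y))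
      ≤ N.const * dist x.1 y.1 := by
  have hk : ∀ x : S.gluing.dom, S.gluing.proj x = S.kproj ⟨_, S.coords_mem_kleinOct x.2⟩ :=
    fun x => by
      rw [kproj]
      congr 1
      exact Subtype.ext (klein_coords x.1).symm
  rw [hk x, hk y, surfaceMap_kproj, surfaceMap_kproj]
  refine (S.swap.gluing.dist_proj_le_dist _ _).trans ?_
  have hx := N.ramp_eq_zero (S.coords_mem_kleinOct x.2)
  have hy := N.ramp_eq_zero (S.coords_mem_kleinOct y.2)
  refine (dist_klein_tanh_le ?_ ?_).trans ?_
  · rcases hx with h | h <;> simp [h]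
  · rcases hy with h | h <;> simp [h]
  simp only
  rw [← mul_sub, ← mul_sub, abs_mul, abs_mul, abs_of_pos S.q_pos, abs_of_pos S.p_pos]
  have e1 := abs_ramp_sub_le N.c_nonneg N.c_lt (cX x.1 / cT x.1) (cX y.1 / cT y.1)
  have e2 := abs_ramp_sub_le N.d_nonneg N.d_lt (cY x.1 / cT x.1) (cY y.1 / cT y.1)
  have f1 := div_le_div_of_nonneg_right (abs_klein_sub_le x.1 y.1) (sub_pos.2 N.c_lt).le
  have f2 := div_le_div_of_nonneg_right (abs_klein_sub_le' x.1 y.1) (sub_pos.2 N.d_lt).le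
  have g1 := mul_le_mul_of_nonneg_left (e1.trans f1) S.q_pos.le
  have g2 := mul_le_mul_of_nonneg_left (e2.trans f2) S.p_pos.le
  refine (add_le_add g1 g2).trans (le_of_eq ?_)
  unfold const
  ring

/-- A gluing link is cut at its crossing point with the wall, so the bound inside the octagon bounds
every link, and `le_dist_proj` passes it to the glued distance. -/
theorem lipschitzWith_surfaceMap : LipschitzWith N.const.toNNReal N.surfaceMap := by
  have hC := N.const_pos
  refine LipschitzWith.of_dist_le_mul fun x y => ?_
  rw [Real.coe_toNNReal _ hC.le]
  obtain ⟨x, rfl⟩ := S.gluing.proj_surjective x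
  obtain ⟨y, rfl⟩ := S.gluing.proj_surjective y
  have := S.gluing.le_dist_proj
    (fun x y => dist (N.surfaceMap (S.gluing.proj x)) (N.surfaceMap (S.gluing.proj y)) / N.const)
    (fun x y z => by
      rw [← add_div]
      exact div_le_div_of_nonneg_right (dist_triangle _ _ _) hC.le)
    (fun x y g hg => by
      obtain ⟨w, hw, w', hw', e, h⟩ := S.exists_crossing x.2 y.2 hg
      have ew : S.gluing.proj ⟨w, hw⟩ = S.gluing.proj ⟨w', hw'⟩ :=
        S.gluing.proj_eq_iff.2 ⟨g, hg, e⟩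
      have h1 := N.dist_surfaceMap_proj_le x ⟨w, hw⟩
      have h2 := N.dist_surfaceMap_proj_le ⟨w', hw'⟩ y
      rw [← ew] at h2
      rw [div_le_iff₀' hC, h, mul_add]
      exact (dist_triangle _ _ _).trans (add_le_add h1 h2)) x y
  rwa [div_le_iff₀' hC] at this

end Bands

/-! ### Homotopy between the collapse and the change of marking -/

theorem convex_kleinOct (S : Shape) : Convex ℝ S.kleinOct := by
  intro v hv w hw a b ha hb hab
  obtain ⟨v1, v2, v3⟩ := hv
  obtain ⟨w1, w2, w3⟩ := hw
  have h1 : |a * v.1 + b * w.1| ≤ a * |v.1| + b * |w.1| := by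
    refine (abs_add_le _ _).trans ?_
    rw [abs_mul, abs_mul, abs_of_nonneg ha, abs_of_nonneg hb]
  have h2 : |a * v.2 + b * w.2| ≤ a * |v.2| + b * |w.2| := by
    refine (abs_add_le _ _).trans ?_
    rw [abs_mul, abs_mul, abs_of_nonneg ha, abs_of_nonneg hb]
  have hs := S.s_pos
  have ht := S.t_pos
  refine ⟨?_, ?_, ?_⟩
  · show |a * v.1 + b * w.1| ≤ S.s
    have e : S.s = a * S.s + b * S.s := by rw [← add_mul, hab, one_mul]
    rw [e]
    exact h1.trans (add_le_add (mul_le_mul_of_nonneg_left v1 ha) (mul_le_mul_of_nonneg_left w1 hb))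
  · show |a * v.2 + b * w.2| ≤ S.t
    have e : S.t = a * S.t + b * S.t := by rw [← add_mul, hab, one_mul]
    rw [e]
    exact h2.trans (add_le_add (mul_le_mul_of_nonneg_left v2 ha) (mul_le_mul_of_nonneg_left w2 hb))
  · show S.s * |a * v.1 + b * w.1| + S.t * |a * v.2 + b * w.2| ≤ 1
    have g1 := mul_le_mul_of_nonneg_left h1 hs.le
    have g2 := mul_le_mul_of_nonneg_left h2 ht.le
    have g3 := mul_le_mul_of_nonneg_left v3 ha
    have g4 := mul_le_mul_of_nonneg_left w3 hb
    linarith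

namespace Bands

variable {S : Shape} (N : S.Bands)

/-- The straight-line homotopy from `collapse` to the marking of the swapped shape, on the cut
square. -/
def track (x : unitInterval × cutSquare) : S.swap.kleinOct :=
  ⟨(1 - (x.1 : ℝ)) • (N.collapse (S.toKlein x.2)).1 + (x.1 : ℝ) • (S.swap.toKlein x.2).1,
    S.swap.convex_kleinOct (N.collapse _).2 (S.swap.toKlein x.2).2
      (by linarith [x.1.2.2]) x.1.2.1 (by ring)⟩

theorem continuous_track : Continuous N.track := by
  have h1 : Continuous fun x : unitInterval × cutSquare => (N.collapse (S.toKlein x.2)).1 :=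
    continuous_subtype_val.comp
      ((N.continuous_collapse.comp S.continuous_toKlein).comp continuous_snd)
  have h2 : Continuous fun x : unitInterval × cutSquare => (S.swap.toKlein x.2).1 :=
    continuous_subtype_val.comp (S.swap.continuous_toKlein.comp continuous_snd)
  have h3 : Continuous fun x : unitInterval × cutSquare => (x.1 : ℝ) :=
    continuous_subtype_val.comp continuous_fst
  exact Continuous.subtype_mk (((continuous_const.sub h3).smul h1).add (h3.smul h2)) _

theorem toKlein_fst_eq_neg {S : Shape} {v w : cutSquare} (h : w.1 = (-v.1.1, v.1.2)) :
    (S.toKlein w).1 = (-(S.toKlein v).1.1, (S.toKlein v).1.2) := by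
  simp only [toKlein, h, px_neg]

theorem toKlein_snd_eq_neg {S : Shape} {v w : cutSquare} (h : w.1 = (v.1.1, -v.1.2)) :
    (S.toKlein w).1 = ((S.toKlein v).1.1, -(S.toKlein v).1.2) := by
  simp only [toKlein, h, py_neg]

theorem collapse_toKlein_fst {v : cutSquare} (h : |v.1.1| = 1 / 2) :
    (N.collapse (S.toKlein v)).1.1 = (S.swap.toKlein v).1.1 ∧
      |(S.swap.toKlein v).1.1| = S.swap.s := by
  have key : S.px (1 / 2) = S.s := S.px_half
  have key' : S.swap.px (1 / 2) = S.swap.s := S.swap.px_half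
  refine ⟨?_, (S.swap.abs_px_eq_iff v.2.1).2 h⟩
  show Real.tanh (S.q * ramp N.c S.s (S.px v.1.1)) = S.swap.px v.1.1
  rcases eq_or_eq_neg_of_abs_eq h with h | h <;> rw [h]
  · rw [key, key', ramp_self N.c_nonneg N.c_lt, mul_one]
    rfl
  · rw [px_neg, px_neg, key, key', ramp_neg N.c_nonneg, ramp_self N.c_nonneg N.c_lt, mul_neg_one,
      Real.tanh_neg]
    rfl

theorem collapse_toKlein_snd {v : cutSquare} (h : |v.1.2| = 1 / 2) :
    (N.collapse (S.toKlein v)).1.2 = (S.swap.toKlein v).1.2 ∧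
      |(S.swap.toKlein v).1.2| = S.swap.t := by
  have key : S.py (1 / 2) = S.t := S.py_half
  have key' : S.swap.py (1 / 2) = S.swap.t := S.swap.py_half
  refine ⟨?_, (S.swap.abs_py_eq_iff v.2.2.1).2 h⟩
  show Real.tanh (S.p * ramp N.d S.t (S.py v.1.2)) = S.swap.py v.1.2
  rcases eq_or_eq_neg_of_abs_eq h with h | h <;> rw [h]
  · rw [key, key', ramp_self N.d_nonneg N.d_lt, mul_one]
    rfl
  · rw [py_neg, py_neg, key, key', ramp_neg N.d_nonneg, ramp_self N.d_nonneg N.d_lt, mul_neg_one,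
      Real.tanh_neg]
    rfl

/-- On a side of the square both ends of the segment have the same extremal coordinate, so the
homotopy stays on that wall and respects the gluing. -/
theorem kproj_track_eq (τ : unitInterval) {v w : cutSquare} (h : wrap v = wrap w) :
    S.swap.kproj (N.track (τ, v)) = S.swap.kproj (N.track (τ, w)) := by
  rw [wrap_eq_iff] at h
  rw [kproj, kproj, proj_kleinPt_eq_iff]
  rcases h with h | ⟨h1, h2⟩ | ⟨h1, h2⟩
  · left
    rw [Subtype.ext h]
  · right; left
    obtain ⟨e1, e2⟩ := N.collapse_toKlein_fst h1
    have f1 := N.collapse_neg_fst (toKlein_fst_eq_neg (S := S) h2)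
    have f2 := toKlein_fst_eq_neg (S := S.swap) h2
    constructor
    · simp only [track, Prod.fst_add, Prod.smul_fst, smul_eq_mul, e1]
      rw [← add_mul, sub_add_cancel, one_mul, e2]
    · simp only [track, f1, f2]
      ext <;> simp
      ring
  · right; right
    obtain ⟨e1, e2⟩ := N.collapse_toKlein_snd h1
    have f1 := N.collapse_neg_snd (toKlein_snd_eq_neg (S := S) h2)
    have f2 := toKlein_snd_eq_neg (S := S.swap) h2
    constructor
    · simp only [track, Prod.snd_add, Prod.smul_snd, smul_eq_mul, e1]
      rw [← add_mul, sub_add_cancel, one_mul, e2]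
    · simp only [track, f1, f2]
      ext <;> simp
      ring

/-- Convexity gives a straight-line homotopy of octagons that descends to the quotients. It is only
a free homotopy: the collapse moves the boundary into the interior. -/
theorem surfaceMap_homotopic :
    (⟨fun p => N.surfaceMap (S.mark p),
      N.lipschitzWith_surfaceMap.continuous.comp S.continuous_mark⟩ :
        C(OneHoledTorus, S.swap.Surface)).Homotopic ⟨S.swap.mark, S.swap.continuous_mark⟩ := by
  let H : unitInterval × OneHoledTorus → S.swap.Surface := fun x =>
    S.swap.kproj (N.track (x.1, Function.surjInv wrap_surjective x.2))
  have hH : ∀ τ v, H (τ, wrap v) = S.swap.kproj (N.track (τ, v)) := fun τ v =>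
    N.kproj_track_eq τ (Function.surjInv_eq wrap_surjective _)
  -- Compactness of the source makes the product map closed, which allows the homotopy to be defined
  -- upstairs.
  have hq : Topology.IsQuotientMap (Prod.map (id : unitInterval → unitInterval) wrap) := by
    have hc : Continuous (Prod.map (id : unitInterval → unitInterval) wrap) :=
      continuous_id.prodMap continuous_wrap
    exact hc.isClosedMap.isQuotientMap hc (Function.surjective_id.prodMap wrap_surjective)
  have hcont : Continuous H := by
    rw [hq.continuous_iff]
    have : H ∘ Prod.map id wrap = S.swap.kproj ∘ N.track := funext fun x => hH x.1 x.2
    rw [this]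
    exact S.swap.continuous_kproj.comp N.continuous_track
  refine ⟨⟨⟨H, hcont⟩, fun p => ?_, fun p => ?_⟩⟩
  · obtain ⟨v, rfl⟩ := wrap_surjective p
    show H (0, wrap v) = N.surfaceMap (S.mark (wrap v))
    rw [hH, mark_wrap, surfaceMap_kproj]
    congr 1
    exact Subtype.ext (by simp [track])
  · obtain ⟨v, rfl⟩ := wrap_surjective p
    show H (1, wrap v) = S.swap.mark (wrap v)
    rw [hH, mark_wrap]
    congr 1
    exact Subtype.ext (by simp [track])

/-- Pushing a representative of the class forward by `surfaceMap` gives a representative for the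
swapped torus, longer by at most the Lipschitz constant. -/
theorem curveLength_swap_le {b : ℝ} (hb : 0 ≤ b)
    (h : Real.cosh (b / 4) = Real.sinh S.p * Real.sinh S.q)
    (h' : Real.cosh (b / 4) = Real.sinh S.swap.p * Real.sinh S.swap.q)
    (γ : C(Circle, OneHoledTorus)) : curveLength (S.swap.toMarkedTorus b hb h') γ
      ≤ ENNReal.ofReal N.const * curveLength (S.toMarkedTorus b hb h) γ := by
  have hC : ENNReal.ofReal N.const ≠ 0 := (ENNReal.ofReal_pos.2 N.const_pos).ne'
  have hle : ∀ c : C(Circle, OneHoledTorus), γ.Homotopic c →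
      curveLength (S.swap.toMarkedTorus b hb h') γ
        ≤ ENNReal.ofReal N.const * loopLength fun z => S.mark (c z) := by
    intro c hc
    let F : C(OneHoledTorus, S.swap.Surface) := ⟨fun p => N.surfaceMap (S.mark p),
      N.lipschitzWith_surfaceMap.continuous.comp S.continuous_mark⟩
    let m : C(S.swap.Surface, OneHoledTorus) :=
      ⟨S.swap.markHomeo.symm, S.swap.markHomeo.symm.continuous⟩
    let M : C(OneHoledTorus, S.swap.Surface) := ⟨S.swap.mark, S.swap.continuous_mark⟩
    have e : m.comp (M.comp c) = c := by
      ext1 z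
      exact S.swap.markHomeo.symm_apply_apply _
    have h1 : (m.comp (F.comp c)).Homotopic (m.comp (M.comp c)) :=
      (ContinuousMap.Homotopic.refl m).comp
        (N.surfaceMap_homotopic.comp (ContinuousMap.Homotopic.refl c))
    rw [e] at h1
    refine (iInf₂_le (m.comp (F.comp c)) (hc.trans h1.symm)).trans ?_
    have e2 : (fun z => (S.swap.toMarkedTorus b hb h').marking (m.comp (F.comp c) z))
        = fun z => N.surfaceMap (S.mark (c z)) := by
      funext z
      exact S.swap.markHomeo.apply_symm_apply _
    rw [e2]
    exact (N.lipschitzWith_surfaceMap.lipschitzOnWith (s := Set.univ)).comp_eVariationOn_le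
      (g := fun t : ℝ => S.mark (c (Circle.exp t))) (Set.mapsTo_univ _ _)
  rw [show curveLength (S.toMarkedTorus b hb h) γ =
    ⨅ (c : C(Circle, OneHoledTorus)) (_ : γ.Homotopic c), loopLength fun z => S.mark (c z) from rfl,
    ENNReal.mul_iInf_of_ne hC ENNReal.ofReal_ne_top]
  refine le_iInf fun c => ?_
  rw [ENNReal.mul_iInf_of_ne hC ENNReal.ofReal_ne_top]
  exact le_iInf fun hc => hle c hc

end Bands

end Shape

/-! ### An essential arc -/

/-- The point of the cut square that lies over the point of the arc with parameter `t`. -/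
def arcPt (t : unitInterval) : cutSquare :=
  ⟨(1 / 2, (t : ℝ) / 2 - 1 / 4), by
    have h0 := t.2.1
    have h1 := t.2.2
    have h : |(t : ℝ) / 2 - 1 / 4| ≤ 1 / 4 := abs_le.2 ⟨by linarith, by linarith⟩
    refine ⟨by norm_num, by linarith, ?_⟩
    show (1 / 4 : ℝ) ^ 2 ≤ (1 / 2 - |(1 / 2 : ℝ)|) ^ 2 + (1 / 2 - |(t : ℝ) / 2 - 1 / 4|) ^ 2
    have := pow_le_pow_left₀ (by norm_num : (0 : ℝ) ≤ 1 / 4)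
      (by linarith : (1 / 4 : ℝ) ≤ 1 / 2 - |(t : ℝ) / 2 - 1 / 4|) 2
    linarith [sq_nonneg (1 / 2 - |(1 / 2 : ℝ)|)]⟩

/-- The vertical arc that joins the boundary to itself. -/
def verticalArc : C(unitInterval, OneHoledTorus) where
  toFun t := wrap (arcPt t)
  continuous_toFun := continuous_wrap.comp (Continuous.subtype_mk (by fun_prop) _)

theorem verticalArc_snd (t : unitInterval) :
    (verticalArc t).1.2 = (((t : ℝ) / 2 + 1 / 4 : ℝ) : UnitAddCircle) := by
  show (((t : ℝ) / 2 - 1 / 4 + 1 / 2 : ℝ) : UnitAddCircle) = _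
  congr 1
  ring

theorem verticalArc_injective : Function.Injective verticalArc := by
  intro t t' h
  have h0 := t.2.1
  have h1 := t.2.2
  rcases (wrap_eq_iff _ _).1 h with h | ⟨-, h⟩ | ⟨h, -⟩
  · have := congrArg Prod.snd h
    simp only [arcPt] at this
    exact Subtype.ext (by linarith)
  · have := congrArg Prod.fst h
    norm_num [arcPt] at this
  · have h2 : |(t : ℝ) / 2 - 1 / 4| ≤ 1 / 4 := abs_le.2 ⟨by linarith, by linarith⟩
    simp only [arcPt] at h
    linarith

theorem verticalArc_zero_mem : verticalArc 0 ∈ bdry := by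
  refine (wrap_mem_bdry_iff _).2 ?_
  norm_num [arcPt, abs_of_pos]

theorem verticalArc_one_mem : verticalArc 1 ∈ bdry := by
  refine (wrap_mem_bdry_iff _).2 ?_
  norm_num [arcPt, abs_of_pos]

theorem norm_snd_le_of_mem_bdry {p : OneHoledTorus} (hp : p ∈ bdry) : ‖p.1.2‖ ≤ 1 / 4 := by
  have h : ‖p.1.1‖ ^ 2 + ‖p.1.2‖ ^ 2 = (1 / 4 : ℝ) ^ 2 := hp
  refine (pow_le_pow_iff_left₀ (norm_nonneg _) (by norm_num) two_ne_zero).1 ?_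
  linarith [sq_nonneg ‖p.1.1‖]

theorem norm_coe_of_abs_le_half {x : ℝ} (hx : |x| ≤ 1 / 2) : ‖(x : UnitAddCircle)‖ = |x| :=
  (AddCircle.norm_coe_eq_abs_iff (1 : ℝ) one_ne_zero).2 (by rwa [abs_one])

/-- A path of real numbers at distance at most `1/4` from the integers stays near the same
integer. -/
theorem abs_sub_le_of_norm_coe_le {φ : unitInterval → ℝ} (hφ : Continuous φ)
    (h : ∀ τ, ‖(φ τ : UnitAddCircle)‖ ≤ 1 / 4) {n : ℤ} (h0 : |φ 0 - n| ≤ 1 / 4) (τ : unitInterval) :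
    |φ τ - n| ≤ 1 / 4 := by
  by_contra! hτ
  have hsub : Set.Icc (1 / 4 : ℝ) |φ τ - n| ⊆ Set.range fun σ => |φ σ - n| := by
    intro x hx
    exact mem_range_of_exists_le_of_exists_ge (by fun_prop) ⟨0, h0.trans hx.1⟩ ⟨τ, hx.2⟩
  -- A path leaving the window takes a value at distance in `(1/4, 1/2]` from `n`, where the norm in
  -- the circle equals that distance.
  obtain ⟨σ, hσ⟩ := hsub (show min |φ τ - n| (1 / 2) ∈ _ from
    ⟨le_min hτ.le (by norm_num), min_le_left _ _⟩)
  simp only at hσ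
  have h1 : |φ σ - n| ≤ 1 / 2 := hσ ▸ min_le_right _ _
  have h2 : 1 / 4 < |φ σ - n| := hσ ▸ lt_min hτ (by norm_num)
  have e : ((φ σ - n : ℝ) : UnitAddCircle) = (φ σ : UnitAddCircle) := by
    have : ((n : ℝ) : UnitAddCircle) = 0 := (AddCircle.coe_eq_zero_iff (1 : ℝ)).2 ⟨n, by simp⟩
    rw [AddCircle.coe_sub, this, sub_zero]
  have h3 := norm_coe_of_abs_le_half h1
  rw [e] at h3
  linarith [h σ]

/-- Lift the second coordinate of the homotopy to `ℝ`. On the boundary this coordinate is within `1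
/ 4` of an integer, so the sliding endpoints remain near `0` and `1`. -/
theorem exists_lift_of_boundaryHomotopic {c : C(unitInterval, OneHoledTorus)}
    (h : BoundaryHomotopic verticalArc c) : ∃ Γ : C(unitInterval, ℝ),
      (∀ t, (Γ t : UnitAddCircle) = (c t).1.2) ∧ |Γ 0| ≤ 1 / 4 ∧ |Γ 1 - 1| ≤ 1 / 4 := by
  obtain ⟨F⟩ := h
  let snd : C(OneHoledTorus, UnitAddCircle) := ⟨fun p => p.1.2,
    continuous_snd.comp continuous_subtype_val⟩
  let H : C(unitInterval × unitInterval, UnitAddCircle) := snd.comp F.toContinuousMap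
  let f : C(unitInterval, ℝ) := ⟨fun t => (t : ℝ) / 2 + 1 / 4, by fun_prop⟩
  have cov := AddCircle.isCoveringMap_coe (1 : ℝ)
  have H0 : ∀ a, H (0, a) = (f a : UnitAddCircle) := fun a => by
    show (F (0, a)).1.2 = _
    rw [F.apply_zero]
    exact verticalArc_snd a
  let L := cov.liftHomotopy H f H0
  have hL : ∀ x, (L x : UnitAddCircle) = (F x).1.2 := fun x =>
    congrFun (cov.liftHomotopy_lifts H f H0) x
  have hL0 : ∀ a, L (0, a) = (a : ℝ) / 2 + 1 / 4 := fun a => cov.liftHomotopy_zero H f H0 a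
  have hF : ∀ τ, F (τ, 0) ∈ bdry ∧ F (τ, 1) ∈ bdry := fun τ => F.prop τ
  refine ⟨⟨fun t => L (1, t), by fun_prop⟩, fun t => ?_, ?_, ?_⟩
  · show (L (1, t) : UnitAddCircle) = _
    rw [hL, F.apply_one]
  · have := abs_sub_le_of_norm_coe_le (φ := fun τ => L (τ, 0)) (by fun_prop)
      (fun τ => by rw [hL]; exact norm_snd_le_of_mem_bdry (hF τ).1) (n := 0)
      (by rw [hL0]; norm_num [abs_of_pos]) 1
    simpa using this
  · have := abs_sub_le_of_norm_coe_le (φ := fun τ => L (τ, 1)) (by fun_prop)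
      (fun τ => by rw [hL]; exact norm_snd_le_of_mem_bdry (hF τ).2) (n := 1)
      (by rw [hL0]; norm_num [abs_of_pos]) 1
    simpa using this

/-- For a path inside the boundary the whole lift would stay near `0`, yet it ends near `1`. -/
theorem isEssentialSimpleArc_verticalArc : IsEssentialSimpleArc verticalArc := by
  refine ⟨verticalArc_injective, verticalArc_zero_mem, verticalArc_one_mem, ?_⟩
  rintro ⟨c, hc, hb⟩
  obtain ⟨Γ, hΓ, h0, h1⟩ := exists_lift_of_boundaryHomotopic hc
  have := abs_sub_le_of_norm_coe_le (φ := Γ) (n := 0) (by fun_prop)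
    (fun t => by rw [hΓ]; exact norm_snd_le_of_mem_bdry (hb t)) (by simpa using h0) 1
  have h2 := abs_le.1 this
  have h3 := abs_le.1 h1
  rw [Int.cast_zero] at h2
  linarith [h2.2, h3.1]

/-- The lift passes `1 / 2`; in the octagon this means meeting the axis `cY = 0`. -/
theorem exists_snd_eq_half {c : C(unitInterval, OneHoledTorus)}
    (h : BoundaryHomotopic verticalArc c) :
    ∃ t, (c t).1.2 = ((1 / 2 : ℝ) : UnitAddCircle) := by
  obtain ⟨Γ, hΓ, h0, h1⟩ := exists_lift_of_boundaryHomotopic h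
  obtain ⟨t, ht⟩ := mem_range_of_exists_le_of_exists_ge Γ.continuous (c := 1 / 2)
    ⟨0, by linarith [(abs_le.1 h0).2]⟩ ⟨1, by linarith [(abs_le.1 h1).1]⟩
  exact ⟨t, by rw [← hΓ, ht]⟩

/-! ### The length of the arc -/

theorem eVariationOn_le_of_edist_le {α E F : Type*} [LinearOrder α] [PseudoEMetricSpace E]
    [PseudoEMetricSpace F] {f : α → E} {g : α → F} {s : Set α}
    (h : ∀ x ∈ s, ∀ y ∈ s, edist (f x) (f y) ≤ edist (g x) (g y)) :
    eVariationOn f s ≤ eVariationOn g s := by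
  unfold eVariationOn
  exact iSup_mono fun p => Finset.sum_le_sum fun i _ => h _ (p.2.2.2 _) _ (p.2.2.2 _)

theorem eVariationOn_unitInterval_of_monotone {f : unitInterval → ℝ} (hf : Monotone f) :
    eVariationOn f Set.univ = ENNReal.ofReal (f 1 - f 0) := by
  have h := (hf.monotoneOn Set.univ).eVariationOn_eq (Set.mem_univ 0) (Set.mem_univ 1)
  have hu : (Set.univ : Set unitInterval) ∩ Set.Icc 0 1 = Set.univ :=
    Set.inter_eq_left.2 fun a _ => ⟨unitInterval.nonneg', unitInterval.le_one'⟩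
  rwa [hu] at h

namespace Shape

variable (S : Shape)

/-- The smallest value of `|cY|` on the boundary of the octagon. -/
def height : ℝ := √((1 - S.s ^ 2) / S.excess)

theorem one_sub_s_sq_pos : 0 < 1 - S.s ^ 2 := by
  nlinarith [S.s_pos, S.s_lt_one]

/-- Completing the square minimizes `Y` along the boundary geodesic. On the boundary the square
vanishes exactly when `X = s * T`, so the minimum is attained at the wall. -/
theorem boundary_identity {X Y T : ℝ} (hT : T ^ 2 = 1 + X ^ 2 + Y ^ 2)
    (h : S.s * X + S.t * Y = T) :
    S.s ^ 2 * (S.excess * Y ^ 2) =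
      S.s ^ 2 * (1 - S.s ^ 2) + ((1 - S.s ^ 2) * T - S.t * Y) ^ 2 := by
  unfold excess
  linear_combination (1 - S.s ^ 2) * (S.s ^ 2 * hT + (S.s * X - S.t * Y + T) * h)

theorem height_le_abs_cY {z : ℍ} (hz : S.s * |cX z| + S.t * |cY z| = cT z) :
    S.height ≤ |cY z| := by
  have h := S.boundary_identity (X := |cX z|) (Y := |cY z|) (T := cT z)
    (by rw [sq_abs, sq_abs]; exact cT_sq z) hz
  have hs := S.s_pos
  have he := S.excess_pos
  refine Real.sqrt_le_iff.2 ⟨abs_nonneg _, ?_⟩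
  rw [div_le_iff₀ he]
  have : S.s ^ 2 * (1 - S.s ^ 2) ≤ S.s ^ 2 * (S.excess * |cY z| ^ 2) := by
    rw [h]
    linarith [sq_nonneg ((1 - S.s ^ 2) * cT z - S.t * |cY z|)]
  have := le_of_mul_le_mul_left this (by positivity)
  linarith

theorem py_zero : S.py 0 = 0 := by
  have := S.py_neg 0
  rw [neg_zero] at this
  linarith

/-- A homotopic path starts on the boundary and meets the axis `cY = 0`. Folding and then `arsinh ∘
cY` are contracting, so this portion already has the stated length; the remaining portion is
discarded. -/
theorem le_arcLength_verticalArc {b : ℝ} (hb : 0 ≤ b)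
    (h : Real.cosh (b / 4) = Real.sinh S.p * Real.sinh S.q) :
    ENNReal.ofReal (Real.arsinh S.height) ≤ arcLength (S.toMarkedTorus b hb h) verticalArc := by
  refine le_iInf₂ fun c hc => ?_
  have h0 : c 0 ∈ bdry := by
    obtain ⟨G⟩ := hc
    simpa using (G.prop 1).1
  obtain ⟨t, ht⟩ := exists_snd_eq_half hc
  refine le_trans ?_ (eVariationOn.edist_le _ (Set.mem_univ 0) (Set.mem_univ t))
  obtain ⟨v, hv⟩ := wrap_surjective (c 0)
  obtain ⟨w, hw⟩ := wrap_surjective (c t)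
  show _ ≤ edist (S.mark (c 0)) (S.mark (c t))
  rw [← hv, ← hw, mark_wrap, mark_wrap, edist_dist]
  refine ENNReal.ofReal_le_ofReal ?_
  refine le_trans ?_ (S.dist_fold_le_dist_proj (S.kleinPt (S.toKlein v)) (S.kleinPt (S.toKlein w)))
  refine le_trans ?_ (abs_arsinh_cY_sub_le _ _)
  rw [← hv, S.wrap_mem_bdry_iff_klein] at h0
  have hw2 : w.1.2 = 0 := by
    rw [← hw] at ht
    have ht' : ((w.1.2 + 1 / 2 : ℝ) : UnitAddCircle) = ((0 + 1 / 2 : ℝ) : UnitAddCircle) := by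
      rw [zero_add]
      exact ht
    rcases (coe_add_half_eq_iff w.2.2.1 (by norm_num)).1 ht' with e | ⟨-, e⟩
    · exact e
    · linarith
  have hY : cY (klein (S.toKlein w).1) = 0 := by
    rw [cY_klein (S.kleinOct_lt_one (S.toKlein w).2)]
    show S.py w.1.2 * _ = 0
    rw [hw2, py_zero, zero_mul]
  have key := S.height_le_abs_cY h0
  show _ ≤ |Real.arsinh (cY (fold (klein (S.toKlein v).1)))
    - Real.arsinh (cY (fold (klein (S.toKlein w).1)))|
  rw [cY_fold, cY_fold, hY, abs_zero, Real.arsinh_zero, sub_zero]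
  exact (Real.arsinh_le_arsinh.2 key).trans (le_abs_self _)

theorem cosh_arsinh_wall {z : ℍ} (hz : cX z = S.s * cT z) :
    Real.cosh (Real.arsinh (cY z)) = √(1 - S.s ^ 2) * cT z := by
  have hk := S.one_sub_s_sq_pos
  have hT := cT_pos z
  rw [Real.cosh_arsinh, ← Real.sqrt_sq (by positivity : 0 ≤ √(1 - S.s ^ 2) * cT z), mul_pow,
    Real.sq_sqrt hk.le]
  congr 1
  linear_combination -cT_sq z - (cX z + S.s * cT z) * hz

/-- The wall is orthogonal to the axis `cY = 0`, so signed distance to that axis is arc length on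
it. -/
theorem dist_wall {z w : ℍ} (hz : cX z = S.s * cT z) (hw : cX w = S.s * cT w) :
    dist z w = |Real.arsinh (cY z) - Real.arsinh (cY w)| := by
  have hk := S.one_sub_s_sq_pos
  refine dist_eq_of_cosh ?_
  rw [Real.cosh_sub, S.cosh_arsinh_wall hz, S.cosh_arsinh_wall hw, Real.sinh_arsinh,
    Real.sinh_arsinh, cosh_dist_eq, hz, hw]
  linear_combination -cT z * cT w * Real.mul_self_sqrt hk.le

theorem arsinh_wall_le {z w : ℍ} (hz : cX z = S.s * cT z) (hw : cX w = S.s * cT w)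
    (h : cY z * cT w ≤ cY w * cT z) : Real.arsinh (cY z) ≤ Real.arsinh (cY w) := by
  rw [← sub_nonneg, ← Real.sinh_nonneg_iff, Real.sinh_sub, S.cosh_arsinh_wall hz,
    S.cosh_arsinh_wall hw, Real.sinh_arsinh, Real.sinh_arsinh]
  have := mul_le_mul_of_nonneg_left h (Real.sqrt_nonneg (1 - S.s ^ 2))
  linarith

theorem py_monotoneOn : MonotoneOn S.py (Set.Icc (-(1 / 2)) (1 / 2)) := by
  intro u hu w hw h
  rw [py_eq, py_eq]
  exact S.swap.px_strictMonoOn.monotoneOn hu hw h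

/-- The arc itself is the competitor. It follows the right wall, with `arsinh ∘ cY` increasing from
the lower boundary point to the upper one. -/
theorem arcLength_verticalArc_le {b : ℝ} (hb : 0 ≤ b)
    (h : Real.cosh (b / 4) = Real.sinh S.p * Real.sinh S.q) :
    arcLength (S.toMarkedTorus b hb h) verticalArc
      ≤ ENNReal.ofReal (2 * Real.arsinh S.height) := by
  have hrefl : BoundaryHomotopic verticalArc verticalArc :=
    ContinuousMap.HomotopicWith.refl _ ⟨verticalArc_zero_mem, verticalArc_one_mem⟩
  refine (iInf₂_le verticalArc hrefl).trans ?_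
  let z : unitInterval → ℍ := fun t => klein (S.toKlein (arcPt t)).1
  have hm : ∀ t, (S.toKlein (arcPt t)).1.1 ^ 2 + (S.toKlein (arcPt t)).1.2 ^ 2 < 1 :=
    fun t => S.kleinOct_lt_one (S.toKlein (arcPt t)).2
  have hX : ∀ t, cX (z t) = S.s * cT (z t) := fun t => by
    rw [cX_klein (hm t)]
    congr 1
    exact S.px_half
  have hY : ∀ t, cY (z t) = S.py ((t : ℝ) / 2 - 1 / 4) * cT (z t) := fun t => cY_klein (hm t)
  have hmono : Monotone fun t => Real.arsinh (cY (z t)) := by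
    intro t t' htt'
    refine S.arsinh_wall_le (hX t) (hX t') ?_
    rw [hY, hY]
    have h1 : S.py ((t : ℝ) / 2 - 1 / 4) ≤ S.py ((t' : ℝ) / 2 - 1 / 4) := by
      have := t.2.1
      have := t.2.2
      have := t'.2.1
      have := t'.2.2
      have h2 : (t : ℝ) ≤ t' := htt'
      exact S.py_monotoneOn ⟨by linarith, by linarith⟩ ⟨by linarith, by linarith⟩ (by linarith)
    have := mul_le_mul_of_nonneg_right h1 (mul_pos (cT_pos (z t)) (cT_pos (z t'))).le
    linarith
  have hle : pathLength (fun t => (S.toMarkedTorus b hb h).marking (verticalArc t))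
      ≤ eVariationOn (fun t => Real.arsinh (cY (z t))) Set.univ := by
    refine eVariationOn_le_of_edist_le fun t _ t' _ => ?_
    show edist (S.mark (wrap (arcPt t))) (S.mark (wrap (arcPt t'))) ≤ _
    rw [mark_wrap, mark_wrap, edist_dist, edist_dist, Real.dist_eq, ← S.dist_wall (hX t) (hX t')]
    exact ENNReal.ofReal_le_ofReal (S.gluing.dist_proj_le_dist _ _)
  refine hle.trans ?_
  rw [eVariationOn_unitInterval_of_monotone hmono]
  refine ENNReal.ofReal_le_ofReal ?_
  have hend : ∀ t, wrap (arcPt t) ∈ bdry → |cY (z t)| ≤ S.height := by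
    intro t ht
    rw [S.wrap_mem_bdry_iff_klein] at ht
    have hs := S.s_pos
    have ht0 := S.t_pos
    have hT := cT_pos (z t)
    have ht2 : S.s * |cX (z t)| + S.t * |cY (z t)| = cT (z t) := ht
    have hid := S.boundary_identity (by rw [sq_abs, sq_abs]; exact cT_sq (z t)) ht2
    have e0 : (1 - S.s ^ 2) * cT (z t) - S.t * |cY (z t)| = 0 := by
      rw [hX t, abs_of_pos (by positivity)] at ht2
      linarith
    rw [e0, zero_pow two_ne_zero, add_zero] at hid
    have := mul_left_cancel₀ (by positivity) hid
    refine Real.le_sqrt_of_sq_le ?_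
    rw [le_div_iff₀ S.excess_pos]
    linarith
  have h1 := abs_le.1 (hend 1 verticalArc_one_mem)
  have h0 := abs_le.1 (hend 0 verticalArc_zero_mem)
  have g1 := Real.arsinh_le_arsinh.2 h1.2
  have g0 := Real.arsinh_le_arsinh.2 h0.1
  rw [Real.arsinh_neg] at g0
  linarith

end Shape

/-! ### Comparison of the two metrics -/

theorem curveMetric_lt_arcMetric {b : ℝ} {h₀ h₁ : MarkedTorus b} {C ℓ₀ ℓ₁ : ℝ} (hℓ₀ : 0 < ℓ₀)
    (hC : 0 < C) (hlt : C < ℓ₁ / ℓ₀)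
    (hcurve : ∀ γ, curveLength h₁ γ ≤ ENNReal.ofReal C * curveLength h₀ γ)
    {a : C(unitInterval, OneHoledTorus)} (ha : IsEssentialSimpleArc a)
    (h₀a : arcLength h₀ a ≤ ENNReal.ofReal ℓ₀) (h₁a : ENNReal.ofReal ℓ₁ ≤ arcLength h₁ a) :
    curveMetric (⟦h₀⟧ : Teich b) ⟦h₁⟧ < arcMetric (⟦h₀⟧ : Teich b) ⟦h₁⟧ := by
  have hK : curveMetric (⟦h₀⟧ : Teich b) ⟦h₁⟧ ≤ ENNReal.log (ENNReal.ofReal C) :=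
    iSup₂_le fun γ _ => ENNReal.log_monotone (ENNReal.div_le_of_le_mul (hcurve γ))
  have hr : ENNReal.ofReal C < arcLength h₁ a / arcLength h₀ a := by
    calc ENNReal.ofReal C < ENNReal.ofReal (ℓ₁ / ℓ₀) :=
          (ENNReal.ofReal_lt_ofReal_iff (hC.trans hlt)).2 hlt
      _ = ENNReal.ofReal ℓ₁ / ENNReal.ofReal ℓ₀ := ENNReal.ofReal_div_of_pos hℓ₀
      _ ≤ _ := ENNReal.div_le_div h₁a h₀a
  refine hK.trans_lt ((ENNReal.log_strictMono hr).trans_le ?_)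
  exact le_sup_of_le_left (le_iSup₂_of_le a ha le_rfl)

/-! ### Numerical estimates for the long shape -/

theorem one_sub_tanh_sq (p : ℝ) : 1 - Real.tanh p ^ 2 = 1 / Real.cosh p ^ 2 := by
  have := (Real.cosh_pos p).ne'
  rw [Real.tanh_eq_sinh_div_cosh]
  field_simp
  linear_combination Real.cosh_sq p

theorem pow_four_le_cosh {p : ℝ} (hp : 0 ≤ p) : (1 + p / 4) ^ 4 / 2 ≤ Real.cosh p := by
  have h1 := Real.add_one_le_exp (p / 4)
  have h2 := pow_le_pow_left₀ (by linarith) h1 4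
  rw [← Real.exp_nat_mul] at h2
  have e : ((4 : ℕ) : ℝ) * (p / 4) = p := by push_cast; ring
  rw [e] at h2
  have h3 := Real.exp_pos (-p)
  rw [Real.cosh_eq]
  linarith

theorem linear_lt_cosh {p : ℝ} (hp : 100 ≤ p) : 28 + 10 * p < Real.cosh p / 8 := by
  have h := pow_four_le_cosh (p := p) (by linarith)
  -- `26 = 1 + 100 / 4`; three of the four factors become constants and one linear factor remains.
  have h1 : (26 : ℝ) ^ 3 ≤ (1 + p / 4) ^ 3 := pow_le_pow_left₀ (by norm_num) (by linarith) 3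
  have h2 : (1 + p / 4) * 26 ^ 3 ≤ (1 + p / 4) * (1 + p / 4) ^ 3 :=
    mul_le_mul_of_nonneg_left h1 (by linarith)
  have h3 : (1 + p / 4) * (1 + p / 4) ^ 3 = (1 + p / 4) ^ 4 := by ring
  rw [h3] at h2
  linarith

theorem hundred_le_arsinh {b : ℝ} (hb : 404 ≤ b) :
    100 ≤ Real.arsinh (3 / 4 * Real.cosh (b / 4)) := by
  rw [← Real.sinh_le_sinh, Real.sinh_arsinh]
  -- `404 / 4 = 101` leaves a spare factor `exp 1 ≥ 2`, which absorbs the `3 / 4`.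
  have h1 : Real.exp 101 ≤ Real.exp (b / 4) := Real.exp_le_exp.2 (by linarith)
  have h2 : Real.exp 101 = Real.exp 100 * Real.exp 1 := by
    rw [← Real.exp_add]
    norm_num
  have h3 := Real.add_one_le_exp (1 : ℝ)
  have h4 := Real.exp_pos 100
  have h5 := Real.exp_pos (-100)
  have h6 := Real.exp_pos (-(b / 4))
  have h7 := mul_le_mul_of_nonneg_left h3 h4.le
  rw [Real.sinh_eq, Real.cosh_eq]
  linarith

theorem cosh_arsinh_four_thirds : Real.cosh (Real.arsinh (4 / 3)) = 5 / 3 := by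
  rw [Real.cosh_arsinh, show (1 : ℝ) + (4 / 3) ^ 2 = (5 / 3) ^ 2 by norm_num,
    Real.sqrt_sq (by norm_num)]

theorem tanh_arsinh_four_thirds : Real.tanh (Real.arsinh (4 / 3)) = 4 / 5 := by
  rw [Real.tanh_eq_sinh_div_cosh, Real.sinh_arsinh, cosh_arsinh_four_thirds]
  norm_num

theorem arsinh_le_self {x : ℝ} (hx : 0 ≤ x) : Real.arsinh x ≤ x := by
  have := Real.self_le_sinh_iff.2 (Real.arsinh_nonneg_iff.2 hx)
  rwa [Real.sinh_arsinh] at this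

theorem half_le_arsinh : 1 / 2 ≤ Real.arsinh (3 / 4) := by
  have h : Real.arsinh (3 / 4) = Real.log 2 := by
    rw [Real.arsinh, show (1 : ℝ) + (3 / 4) ^ 2 = (5 / 4) ^ 2 by norm_num,
      Real.sqrt_sq (by norm_num)]
    norm_num
  linarith [Real.log_two_gt_d9]

theorem four_fifths_le_tanh {p : ℝ} (hp : 100 ≤ p) : 4 / 5 ≤ Real.tanh p := by
  have h := linear_lt_cosh hp
  have h0 : (3 : ℝ) ^ 2 ≤ Real.cosh p ^ 2 := pow_le_pow_left₀ (by norm_num) (by linarith) 2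
  have h1 : 1 / Real.cosh p ^ 2 ≤ 1 / 3 ^ 2 := one_div_le_one_div_of_le (by norm_num) h0
  have h2 := one_sub_tanh_sq p
  have h3 := Shape.tanh_pos (show 0 < p by linarith)
  nlinarith

/-- The shape with `tanh q = 4/5` and long first side. -/
def longShape (p : ℝ) (hp : 100 ≤ p) : Shape where
  p := p
  q := Real.arsinh (4 / 3)
  p_pos := by linarith
  q_pos := Real.arsinh_pos_iff.2 (by norm_num)
  one_lt := by
    have := four_fifths_le_tanh hp
    rw [tanh_arsinh_four_thirds]
    nlinarith

variable {p : ℝ} (hp : 100 ≤ p)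

theorem longShape_t : (longShape p hp).t = 4 / 5 := tanh_arsinh_four_thirds

theorem longShape_le_s : 4 / 5 ≤ (longShape p hp).s := four_fifths_le_tanh hp

/-- Cut-off values for `longShape`. -/
def longBands : (longShape p hp).Bands where
  -- With `s` and `t` at least `4 / 5`, the required bound is `4 / 5 * (13 / 20 + 3 / 5) = 1`.
  c := 13 / 20
  d := 3 / 5
  c_nonneg := by norm_num
  d_nonneg := by norm_num
  c_lt := by linarith [longShape_le_s hp]
  d_lt := by rw [longShape_t]; norm_num
  one_le := by rw [longShape_t]; linarith [longShape_le_s hp]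

/-- The short length satisfies `q ≤ 4 / 3` and `s - c ≥ 3 / 20`, while `t - d = 1 / 5`; the constant
is therefore at most `2 * (14 + 5 * p)`. -/
theorem longBands_const_lt : (longBands hp).const < Real.cosh p / 8 := by
  refine lt_of_le_of_lt ?_ (linear_lt_cosh hp)
  have hs := longShape_le_s hp
  have hq := arsinh_le_self (x := 4 / 3) (by norm_num)
  have h1 : Real.arsinh (4 / 3) / ((longShape p hp).s - 13 / 20) ≤ 14 := by
    rw [div_le_iff₀ (by linarith)]
    linarith
  have e : (longBands hp).const = 2 * (Real.arsinh (4 / 3) / ((longShape p hp).s - 13 / 20)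
      + p / ((longShape p hp).t - 3 / 5)) := rfl
  have h2 : p / (4 / 5 - 3 / 5) = 5 * p := by ring
  rw [e, longShape_t, h2]
  linarith

/-- `1 - s ^ 2 = 1 / cosh p ^ 2`, while the excess stays at least `1 / 4`. -/
theorem longShape_height_le : 2 * Real.arsinh (longShape p hp).height ≤ 4 / Real.cosh p := by
  have hc := Real.cosh_pos p
  have hs := longShape_le_s hp
  have he : 1 / 4 ≤ (longShape p hp).excess := by
    rw [Shape.excess, longShape_t]
    nlinarith
  have h1 : (longShape p hp).height ≤ 2 / Real.cosh p := by
    refine Real.sqrt_le_iff.2 ⟨by positivity, ?_⟩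
    rw [div_le_iff₀ (longShape p hp).excess_pos, div_pow]
    have : 1 - (longShape p hp).s ^ 2 = 1 / Real.cosh p ^ 2 := one_sub_tanh_sq p
    rw [this]
    have h2 : 0 < 1 / Real.cosh p ^ 2 := by positivity
    have h3 : (2 : ℝ) ^ 2 / Real.cosh p ^ 2 = 4 * (1 / Real.cosh p ^ 2) := by ring
    rw [h3]
    nlinarith
  have h0 := arsinh_le_self (x := (longShape p hp).height) (Real.sqrt_nonneg _)
  have : 4 / Real.cosh p = 2 * (2 / Real.cosh p) := by ring
  linarith

/-- After the swap the numerator is `9 / 25` and the excess is less than `16 / 25`, so the height is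
at least `3 / 4`. -/
theorem longShape_swap_height : 1 / 2 ≤ Real.arsinh (longShape p hp).swap.height := by
  refine half_le_arsinh.trans (Real.arsinh_le_arsinh.2 ?_)
  refine Real.le_sqrt_of_sq_le ?_
  rw [le_div_iff₀ (longShape p hp).swap.excess_pos, Shape.excess, Shape.swap_s, Shape.swap_t,
    longShape_t]
  have := (longShape p hp).s_lt_one
  have := (longShape p hp).s_pos
  nlinarith

end TorusMetrics

end

theorem mainTheorem5 :
    ∃ B : ℝ, 0 < B ∧ ∀ b : ℝ, B ≤ b →
      ∃ h₀ h₁ : TorusMetrics.Teich b,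
        TorusMetrics.curveMetric h₀ h₁ < TorusMetrics.arcMetric h₀ h₁ := by
  refine ⟨404, by norm_num, fun b hb => ?_⟩
  have hb0 : 0 ≤ b := by linarith
  have hp := TorusMetrics.hundred_le_arsinh hb
  -- The long length is chosen by `sinh p = 3 / 4 * cosh (b / 4)`, to compensate `sinh q = 4 / 3`.
  have h : Real.cosh (b / 4) = Real.sinh (Real.arsinh (3 / 4 * Real.cosh (b / 4)))
      * Real.sinh (Real.arsinh (4 / 3)) := by
    rw [Real.sinh_arsinh, Real.sinh_arsinh]
    ring
  have h' : Real.cosh (b / 4) = Real.sinh (Real.arsinh (4 / 3))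
      * Real.sinh (Real.arsinh (3 / 4 * Real.cosh (b / 4))) := by
    rw [mul_comm]
    exact h
  have hc := Real.cosh_pos (Real.arsinh (3 / 4 * Real.cosh (b / 4)))
  refine ⟨⟦(TorusMetrics.longShape _ hp).toMarkedTorus b hb0 h⟧,
    ⟦(TorusMetrics.longShape _ hp).swap.toMarkedTorus b hb0 h'⟧,
    TorusMetrics.curveMetric_lt_arcMetric (ℓ₁ := 1 / 2) (div_pos four_pos hc)
      (TorusMetrics.longBands hp).const_pos ?_
      ((TorusMetrics.longBands hp).curveLength_swap_le hb0 h h')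
      TorusMetrics.isEssentialSimpleArc_verticalArc
      (((TorusMetrics.longShape _ hp).arcLength_verticalArc_le hb0 h).trans
        (ENNReal.ofReal_le_ofReal (TorusMetrics.longShape_height_le hp)))
      ((ENNReal.ofReal_le_ofReal (TorusMetrics.longShape_swap_height hp)).trans
        ((TorusMetrics.longShape _ hp).swap.le_arcLength_verticalArc hb0 h'))⟩
  -- The arc ratio `(1 / 2) / (4 / cosh p)` is `cosh p / 8`.
  refine (TorusMetrics.longBands_const_lt hp).trans_le (le_of_eq ?_)
  field_simp
  norm_num
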